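/- Let \(M\) and \(N\) be manifolds of class \(C^2\) (Hausdorff, with a countable basis), of dimensions \(m\) and \(n\), endowed with Riemannian metrics \(g_M, g_N\) of class \(C^1\) and their Levi-Civita connections. Let \(\iota \in C^2(N,\mathbb{R}^\nu)\) be an isometric embedding and let \(p \in [1,+\infty)\). Then \[ \dot W^{2,p}_\iota(M,N) \subseteq \dot W^{2,p}(M,N). \] Here \(\dot W^{2,p}_\iota(M,N)\) is the set of maps \(u\colon M\to N\) such that \(\iota\circ u\in W^{2,1}_{\mathrm{loc}}(M,\mathbb{R}^\nu)\) and \(|D^2(\iota\circ u)|\in L^p(M)\), where \(D^2\) is the second covariant derivative on \((M,g_M)\), which in a chart is \(D^2v(a,b)=\partial_a\partial_b v-Dv(\Gamma(a,b))\) with the Christoffel symbols \(\Gamma\) of \(g_M\), the norm is that of \(g_M^*\otimes g_M^*\otimes g_{\mathbb{R}^\nu}\), and \(L^p(M)\) refers to the Riemannian measure. The space \(\dot W^{2,p}(M,N)\) is defined intrinsically. A map \(w\colon M\to P\) into a manifold \(P\) is *colocally weakly differentiable* if it is measurable and \(f\circ w\in W^{1,1}_{\mathrm{loc}}(M)\)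 for every \(f\in C^1_c(P,\mathbb{R})\). The *colocal weak derivative* of such a map \(u\colon M\to N\) is the measurable bundle morphism \(Tu\colon TM\to TN\) covering \(u\) such that \(T(f\circ u)=Tf\circ Tu\) almost everywhere for every \(f\in C^1_c(N,\mathbb{R})\); it is viewed as a map \(Tu\colon M\to T^*M\otimes TN\) into the bundle over \(M\times N\) with fibres \(\mathcal L(T_xM,T_yN)\). The map \(u\) is *twice colocally weakly differentiable* if \(u\) and \(Tu\) are colocally weakly differentiable. The *colocal weak covariant derivative* of \(Tu\) is the measurable map \(D_K(Tu)\colon M\to T^*M\otimes T^*M\otimes TN\), with \(D_K(Tu)(x)\colon T_xM\times T_xM\to T_{u(x)}N\) bilinear, such that for every \(f\in C^1_c(T^*M\otimes TN,\mathbb{R})\), for almost every \(x \in M\) and every \(e\in T_xM\), \[ Tf(Tu(x))\bigl[\operatorname{Vert}(D_K(Tu)(x)[e])\bigr]=T(f\circ Tu)(x)[e]-Tf(Tu(x))\bigl[\operatorname{Hor}(e,Tu(x)[e])\bigr], \] where \(\operatorname{Vert}\) and \(\operatorname{Hor}\) are the vertical lift and the horizontal lift to \(T_{Tu(x)}(T^*M\otimes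 TN)\), the latter for the connection induced by the Levi-Civita connections of \(M\) and \(N\). Finally, \(\dot W^{2,p}(M,N)\) is the set of twice colocally weakly differentiable maps \(u\colon M\to N\) such that \(|D_K(Tu)|_{g_M^*\otimes g_M^*\otimes g_N}\in L^p(M)\). -/

import Mathlib

open Set MeasureTheory
open scoped Manifold ContDiff ENNReal

set_option maxSynthPendingDepth 3

noncomputable section

namespace ColocalSobolev

/-- The Euclidean space `ℝ^m`, the model space of `m`-dimensional manifolds. -/
abbrev Euc (m : ℕ) : Type := EuclideanSpace ℝ (Fin m)

/-! ### Weak derivatives on open subsets of `ℝ^m` -/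

section Euclidean

variable {m : ℕ} {F : Type*} [NormedAddCommGroup F] [NormedSpace ℝ F]

/-- `f` is weakly differentiable (that is, `f ∈ W^{1,1}_loc(Ω)`) on the open set `Ω`, with weak
derivative `f'`: both are locally integrable on `Ω` and the integration by parts formula holds
against all smooth functions with compact support in `Ω`. -/
def HasWeakFDerivOn (Ω : Set (Euc m)) (f : Euc m → F) (f' : Euc m → Euc m →L[ℝ] F) : Prop :=
  LocallyIntegrableOn f Ω volume ∧ LocallyIntegrableOn f' Ω volume ∧
    ∀ φ : Euc m → ℝ, ContDiff ℝ ∞ φ → HasCompactSupport φ → tsupport φ ⊆ Ω →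
      ∀ a : Euc m, ∫ z, fderiv ℝ φ z a • f z = -∫ z, φ z • f' z a

end Euclidean

/-! ### Measurability and weak derivatives on a manifold of class `C²`

As these notions are invariant under changes of charts, it is enough that around each point there
is one chart in which they hold. -/

section Manifold

variable {m : ℕ} {M : Type*} [TopologicalSpace M] [ChartedSpace (Euc m) M]

/-- A (Lebesgue) measurable map from a manifold to a topological space: around each point there is
a chart in which the preimages of open sets are Lebesgue measurable. -/
def LocallyMeasurable (m : ℕ) {M : Type*} [TopologicalSpace M] [ChartedSpace (Euc m) M]
    {P : Type*} [TopologicalSpace P] (u : M → P) : Prop :=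
  ∀ x₀ : M, ∃ ψ ∈ IsManifold.maximalAtlas (𝓡 m) 2 M, x₀ ∈ ψ.source ∧
    ∀ O : Set P, IsOpen O → NullMeasurableSet (ψ.target ∩ ψ.symm ⁻¹' (u ⁻¹' O)) volume

variable {F : Type*} [NormedAddCommGroup F] [NormedSpace ℝ F]

/-- The differential `T_z ℝ^m → T_{ψ⁻¹(z)} M` of the inverse of the chart `ψ`, at a point `z` of
the target of `ψ`. -/
def chartInvDeriv (ψ : OpenPartialHomeomorph M (Euc m)) (z : Euc m) :
    Euc m →L[ℝ] TangentSpace (𝓡 m) (ψ.symm z) :=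
  mfderiv (𝓡 m) (𝓡 m) ψ.symm z

/-- `f : M → F` is weakly differentiable, i.e. `f ∈ W^{1,1}_loc(M)`. -/
def IsWeaklyDifferentiable (m : ℕ) {M : Type*} [TopologicalSpace M] [ChartedSpace (Euc m) M]
    {F : Type*} [NormedAddCommGroup F] [NormedSpace ℝ F] (f : M → F) : Prop :=
  ∀ x₀ : M, ∃ ψ ∈ IsManifold.maximalAtlas (𝓡 m) 2 M, x₀ ∈ ψ.source ∧
    ∃ w : Euc m → Euc m →L[ℝ] F, HasWeakFDerivOn ψ.target (f ∘ ψ.symm) w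

/-- `f : M → F` is weakly differentiable and its weak derivative `T f` is (almost everywhere) equal
to `f'`. -/
def HasWeakMFDeriv (f : M → F) (f' : ∀ x : M, TangentSpace (𝓡 m) x →L[ℝ] F) : Prop :=
  ∀ x₀ : M, ∃ ψ ∈ IsManifold.maximalAtlas (𝓡 m) 2 M, x₀ ∈ ψ.source ∧
    HasWeakFDerivOn ψ.target (f ∘ ψ.symm) fun z => f' (ψ.symm z) ∘L chartInvDeriv ψ z

/-- A measurable map `u : M → P` into a manifold is colocally weakly differentiable if `f ∘ u` is
weakly differentiable for every `f ∈ C¹_c(P, ℝ)`. Here `J` is the model of `P`. -/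
def IsColocallyWeaklyDifferentiable (m : ℕ) {M : Type*} [TopologicalSpace M]
    [ChartedSpace (Euc m) M] {E' H' P : Type*} [NormedAddCommGroup E'] [NormedSpace ℝ E']
    [TopologicalSpace H'] (J : ModelWithCorners ℝ E' H') [TopologicalSpace P] [ChartedSpace H' P]
    (u : M → P) : Prop :=
  LocallyMeasurable m u ∧
    ∀ f : P → ℝ, ContMDiff J 𝓘(ℝ, ℝ) 1 f → HasCompactSupport f → IsWeaklyDifferentiable m (f ∘ u)

end Manifold

/-! ### Riemannian metrics -/

section Riemannian

/-- Given the derivative `G' a b c = ∂_a G(b, c)` of a metric `G`, this is the form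
`(a, b, c) ↦ ½ (∂_a G(b, c) + ∂_b G(a, c) - ∂_c G(a, b))`. -/
def koszulForm {E : Type*} [NormedAddCommGroup E] [NormedSpace ℝ E]
    (G' : E →L[ℝ] E →L[ℝ] E →L[ℝ] ℝ) : E →L[ℝ] E →L[ℝ] E →L[ℝ] ℝ :=
  let T : E →L[ℝ] E →L[ℝ] E →L[ℝ] ℝ :=
    (ContinuousLinearMap.flipₗᵢ ℝ E E ℝ).toContinuousLinearEquiv.toContinuousLinearMap ∘L G'.flip
  (2⁻¹ : ℝ) • (G' + G'.flip - T)

variable {m : ℕ} {M : Type*} [TopologicalSpace M] [ChartedSpace (Euc m) M]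
  [IsManifold (𝓡 m) 2 M]

/-- A Riemannian metric of class `C¹` on a manifold of class `C²`. -/
abbrev Metric (m : ℕ) (M : Type*) [TopologicalSpace M] [ChartedSpace (Euc m) M]
    [IsManifold (𝓡 m) 2 M] : Type _ :=
  Bundle.ContMDiffRiemannianMetric (𝓡 m) 1 (Euc m) (fun x : M => TangentSpace (𝓡 m) x)

/-- The metric in the chart `ψ`: `G(z)(a, b) = g_{ψ⁻¹(z)}(Dψ⁻¹(z) a, Dψ⁻¹(z) b)`. -/
def metricInChart (g : Metric m M) (ψ : OpenPartialHomeomorph M (Euc m)) (z : Euc m) :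
    Euc m →L[ℝ] Euc m →L[ℝ] ℝ :=
  ContinuousLinearMap.bilinearComp (E := Euc m) (F := Euc m) (G := ℝ) (g.inner (ψ.symm z) : Euc m →L[ℝ] Euc m →L[ℝ] ℝ)
    (chartInvDeriv ψ z) (chartInvDeriv ψ z)

/-- The Christoffel symbols `Γ(z)(a, b)` of the Levi-Civita connection in the chart `ψ`, given by
the Koszul formula `G(Γ(a, b), c) = ½ (∂_a G(b, c) + ∂_b G(a, c) - ∂_c G(a, b))`; thus
`∇_a b = ∂_a b + Γ(a, b)` in the chart. -/
def christoffel (g : Metric m M) (ψ : OpenPartialHomeomorph M (Euc m)) (z : Euc m) :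
    Euc m →L[ℝ] Euc m →L[ℝ] Euc m :=
  (ContinuousLinearMap.compL ℝ (Euc m) (Euc m →L[ℝ] ℝ) (Euc m)
    (metricInChart g ψ z).inverse) ∘L koszulForm (fderiv ℝ (metricInChart g ψ) z)

/-- The Christoffel symbols at `x` in the preferred chart at `x`. (Mathlib identifies `T_x M` with
the model space `ℝ^m` through that chart.) -/
def christoffelAt (g : Metric m M) (x : M) : Euc m →L[ℝ] Euc m →L[ℝ] Euc m :=
  christoffel g (chartAt (Euc m) x) (chartAt (Euc m) x x)

/-- The Riemannian measure. In each chart its density is `√(det G)`. Since the measures obtained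
from the various charts agree on the overlaps, it is the least measure which dominates the
measures of all the preferred charts. -/
def riemannianMeasure [MeasurableSpace M] (g : Metric m M) : Measure M :=
  ⨆ x : M, Measure.map (chartAt (Euc m) x).symm
    ((volume.restrict (chartAt (Euc m) x).target).withDensity fun z =>
      ENNReal.ofReal (Real.sqrt (Matrix.det (Matrix.of fun i j : Fin m =>
        metricInChart g (chartAt (Euc m) x) z
          (EuclideanSpace.single i 1) (EuclideanSpace.single j 1)))))

theorem exists_orthonormalFrame (g : Metric m M) (x : M) :
    ∃ e : Fin m → TangentSpace (𝓡 m) x, ∀ i j, g.inner x (e i) (e j) = if i = j then 1 else 0 := by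
  let c := g.toRiemannianMetric.toCore x
  let : NormedAddCommGroup (TangentSpace (𝓡 m) x) := c.toNormedAddCommGroup
  let : InnerProductSpace ℝ (TangentSpace (𝓡 m) x) := .ofCore c.toCore
  have h : Module.finrank ℝ (TangentSpace (𝓡 m) x) = m := finrank_euclideanSpace_fin (𝕜 := ℝ)
  have : FiniteDimensional ℝ (TangentSpace (𝓡 m) x) :=
    inferInstanceAs (FiniteDimensional ℝ (Euc m))
  have b := (stdOrthonormalBasis ℝ (TangentSpace (𝓡 m) x)).reindex (finCongr h)
  exact ⟨b, fun i j => (orthonormal_iff_ite.1 b.orthonormal) i j⟩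

/-- An orthonormal basis of `T_x M`. -/
def orthonormalFrame (g : Metric m M) (x : M) : Fin m → TangentSpace (𝓡 m) x :=
  (exists_orthonormalFrame g x).choose

end Riemannian

/-! ### The bundle `T*M ⊗ TN` over `M × N`

Its fibre over `(x, y)` is the space of linear maps `T_x M → T_y N`. -/

section TensorBundle

/-- The bundle over `M × N` whose fibre over `(x, y)` is `T_x M`. -/
def DomTangent (m n : ℕ) {M N : Type*} [TopologicalSpace M] [ChartedSpace (Euc m) M]
    [TopologicalSpace N] [ChartedSpace (Euc n) N] : M × N → Type :=
  Bundle.Pullback (ContMDiffMap.fst : C^1⟮(𝓡 m).prod (𝓡 n), M × N; 𝓡 m, M⟯)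
    (TangentSpace (𝓡 m) : M → Type)

/-- The bundle over `M × N` whose fibre over `(x, y)` is `T_y N`. -/
def CodTangent (m n : ℕ) {M N : Type*} [TopologicalSpace M] [ChartedSpace (Euc m) M]
    [TopologicalSpace N] [ChartedSpace (Euc n) N] : M × N → Type :=
  Bundle.Pullback (ContMDiffMap.snd : C^1⟮(𝓡 m).prod (𝓡 n), M × N; 𝓡 n, N⟯)
    (TangentSpace (𝓡 n) : N → Type)

variable {m n : ℕ} {M N : Type*} [TopologicalSpace M] [ChartedSpace (Euc m) M]
  [TopologicalSpace N] [ChartedSpace (Euc n) N]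

instance (q : M × N) : AddCommGroup (DomTangent m n q) :=
  inferInstanceAs (AddCommGroup (TangentSpace (𝓡 m) q.1))
instance (q : M × N) : Module ℝ (DomTangent m n q) :=
  inferInstanceAs (Module ℝ (TangentSpace (𝓡 m) q.1))
instance (q : M × N) : TopologicalSpace (DomTangent m n q) :=
  inferInstanceAs (TopologicalSpace (TangentSpace (𝓡 m) q.1))
instance (q : M × N) : IsTopologicalAddGroup (DomTangent m n q) :=
  inferInstanceAs (IsTopologicalAddGroup (TangentSpace (𝓡 m) q.1))
instance (q : M × N) : ContinuousSMul ℝ (DomTangent m n q) :=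
  inferInstanceAs (ContinuousSMul ℝ (TangentSpace (𝓡 m) q.1))

instance (q : M × N) : AddCommGroup (CodTangent m n q) :=
  inferInstanceAs (AddCommGroup (TangentSpace (𝓡 n) q.2))
instance (q : M × N) : Module ℝ (CodTangent m n q) :=
  inferInstanceAs (Module ℝ (TangentSpace (𝓡 n) q.2))
instance (q : M × N) : TopologicalSpace (CodTangent m n q) :=
  inferInstanceAs (TopologicalSpace (TangentSpace (𝓡 n) q.2))
instance (q : M × N) : IsTopologicalAddGroup (CodTangent m n q) :=
  inferInstanceAs (IsTopologicalAddGroup (TangentSpace (𝓡 n) q.2))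
instance (q : M × N) : ContinuousSMul ℝ (CodTangent m n q) :=
  inferInstanceAs (ContinuousSMul ℝ (TangentSpace (𝓡 n) q.2))

variable [IsManifold (𝓡 m) 2 M] [IsManifold (𝓡 n) 2 N]

instance : TopologicalSpace (Bundle.TotalSpace (Euc m) (DomTangent m n : M × N → Type)) :=
  inferInstanceAs (TopologicalSpace (Bundle.TotalSpace (Euc m)
    (Bundle.Pullback (ContMDiffMap.fst : C^1⟮(𝓡 m).prod (𝓡 n), M × N; 𝓡 m, M⟯)
      (TangentSpace (𝓡 m) : M → Type))))

instance : FiberBundle (Euc m) (DomTangent m n : M × N → Type) :=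
  inferInstanceAs (FiberBundle (Euc m)
    (Bundle.Pullback (ContMDiffMap.fst : C^1⟮(𝓡 m).prod (𝓡 n), M × N; 𝓡 m, M⟯)
      (TangentSpace (𝓡 m) : M → Type)))

instance : VectorBundle ℝ (Euc m) (DomTangent m n : M × N → Type) :=
  inferInstanceAs (VectorBundle ℝ (Euc m)
    (Bundle.Pullback (ContMDiffMap.fst : C^1⟮(𝓡 m).prod (𝓡 n), M × N; 𝓡 m, M⟯)
      (TangentSpace (𝓡 m) : M → Type)))

instance : TopologicalSpace (Bundle.TotalSpace (Euc n) (CodTangent m n : M × N → Type)) :=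
  inferInstanceAs (TopologicalSpace (Bundle.TotalSpace (Euc n)
    (Bundle.Pullback (ContMDiffMap.snd : C^1⟮(𝓡 m).prod (𝓡 n), M × N; 𝓡 n, N⟯)
      (TangentSpace (𝓡 n) : N → Type))))

instance : FiberBundle (Euc n) (CodTangent m n : M × N → Type) :=
  inferInstanceAs (FiberBundle (Euc n)
    (Bundle.Pullback (ContMDiffMap.snd : C^1⟮(𝓡 m).prod (𝓡 n), M × N; 𝓡 n, N⟯)
      (TangentSpace (𝓡 n) : N → Type)))

instance : VectorBundle ℝ (Euc n) (CodTangent m n : M × N → Type) :=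
  inferInstanceAs (VectorBundle ℝ (Euc n)
    (Bundle.Pullback (ContMDiffMap.snd : C^1⟮(𝓡 m).prod (𝓡 n), M × N; 𝓡 n, N⟯)
      (TangentSpace (𝓡 n) : N → Type)))

/-- The fibres `L(T_x M, T_y N)` of the bundle `T*M ⊗ TN` over `M × N`. -/
abbrev TensorFibre (m n : ℕ) {M N : Type*} [TopologicalSpace M] [ChartedSpace (Euc m) M]
    [TopologicalSpace N] [ChartedSpace (Euc n) N] (q : M × N) : Type :=
  DomTangent m n q →L[ℝ] CodTangent m n q

/-- The fibres `L(T_x M, L(T_x M, T_y N))` of the bundle `T*M ⊗ T*M ⊗ TN` over `M × N`. -/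
abbrev TensorFibre₂ (m n : ℕ) {M N : Type*} [TopologicalSpace M] [ChartedSpace (Euc m) M]
    [TopologicalSpace N] [ChartedSpace (Euc n) N] (q : M × N) : Type :=
  DomTangent m n q →L[ℝ] TensorFibre m n q

/-- The total space of `T*M ⊗ TN`, a manifold of class `C¹`. -/
abbrev TensorBundle (m n : ℕ) (M N : Type*) [TopologicalSpace M] [ChartedSpace (Euc m) M]
    [TopologicalSpace N] [ChartedSpace (Euc n) N] : Type _ :=
  Bundle.TotalSpace (Euc m →L[ℝ] Euc n) (TensorFibre m n : M × N → Type)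

/-- The total space of `T*M ⊗ T*M ⊗ TN`. -/
abbrev TensorBundle₂ (m n : ℕ) (M N : Type*) [TopologicalSpace M] [ChartedSpace (Euc m) M]
    [TopologicalSpace N] [ChartedSpace (Euc n) N] : Type _ :=
  Bundle.TotalSpace (Euc m →L[ℝ] Euc m →L[ℝ] Euc n) (TensorFibre₂ m n : M × N → Type)

/-- The model of the manifold `T*M ⊗ TN`. -/
abbrev tensorModel (m n : ℕ) :
    ModelWithCorners ℝ ((Euc m × Euc n) × (Euc m →L[ℝ] Euc n))
      (ModelProd (ModelProd (Euc m) (Euc n)) (Euc m →L[ℝ] Euc n)) :=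
  ((𝓡 m).prod (𝓡 n)).prod 𝓘(ℝ, Euc m →L[ℝ] Euc n)

/-- A linear map `L : T_x M → T_y N` as a point of `T*M ⊗ TN`. -/
def tensorPoint (x : M) (y : N) (L : TangentSpace (𝓡 m) x →L[ℝ] TangentSpace (𝓡 n) y) :
    TensorBundle m n M N :=
  ⟨(x, y), L⟩

/-- A bilinear map `B : T_x M × T_x M → T_y N` as a point of `T*M ⊗ T*M ⊗ TN`. -/
def tensorPoint₂ (x : M) (y : N)
    (B : TangentSpace (𝓡 m) x →L[ℝ] TangentSpace (𝓡 m) x →L[ℝ] TangentSpace (𝓡 n) y) :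
    TensorBundle₂ m n M N :=
  ⟨(x, y), B⟩

/-! Mathlib identifies the tangent space of `T*M ⊗ TN` at `L : T_x M → T_y N` with the model space
`(ℝ^m × ℝ^n) × L(ℝ^m, ℝ^n)`, through the preferred charts of `M` at `x` and of `N` at `y` and the
trivialization which they induce: a curve `(x(t), y(t), L(t))` has the velocity
`((x', y'), L')`, computed in these coordinates. -/

/-- The vertical lift `ξ ↦ d/dt (L + t ξ)|_{t = 0}`. -/
def vertLift (x : M) (y : N) (L : TangentSpace (𝓡 m) x →L[ℝ] TangentSpace (𝓡 n) y) :
    (TangentSpace (𝓡 m) x →L[ℝ] TangentSpace (𝓡 n) y) →L[ℝ]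
      TangentSpace (tensorModel m n) (tensorPoint x y L) :=
  ContinuousLinearMap.inr ℝ (Euc m × Euc n) (Euc m →L[ℝ] Euc n)

/-- The horizontal lift, at the point `L : T_x M → T_y N` of `T*M ⊗ TN`, of a tangent vector
`(e, v)` of `M × N` at `(x, y)`, for the connection induced on `T*M ⊗ TN` by the Levi-Civita
connections of `M` and `N`. A curve `(x(t), y(t), L(t))` is horizontal if
`L' + Γ^N(y', L ·) - L Γ^M(x', ·) = 0`. -/
def horLift (gM : Metric m M) (gN : Metric n N) (x : M) (y : N)
    (L : TangentSpace (𝓡 m) x →L[ℝ] TangentSpace (𝓡 n) y) :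
    (TangentSpace (𝓡 m) x × TangentSpace (𝓡 n) y) →L[ℝ]
      TangentSpace (tensorModel m n) (tensorPoint x y L) :=
  let L₀ : Euc m →L[ℝ] Euc n := L
  let lM : Euc m →L[ℝ] Euc m →L[ℝ] Euc n :=
    ContinuousLinearMap.compL ℝ (Euc m) (Euc m) (Euc n) L₀ ∘L christoffelAt gM x
  let lN : Euc n →L[ℝ] Euc m →L[ℝ] Euc n :=
    (ContinuousLinearMap.compL ℝ (Euc m) (Euc n) (Euc n)).flip L₀ ∘L christoffelAt gN y
  (ContinuousLinearMap.id ℝ (Euc m × Euc n)).prod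
    (lM ∘L ContinuousLinearMap.fst ℝ (Euc m) (Euc n) -
      lN ∘L ContinuousLinearMap.snd ℝ (Euc m) (Euc n))

end TensorBundle

/-! ### Colocal weak derivatives, colocal weak covariant derivatives -/

section Colocal

variable {m n : ℕ} {M N : Type*} [TopologicalSpace M] [ChartedSpace (Euc m) M]
  [IsManifold (𝓡 m) 2 M] [TopologicalSpace N] [ChartedSpace (Euc n) N] [IsManifold (𝓡 n) 2 N]

/-- `Tu` is the colocal weak derivative of `u : M → N`: it is a measurable bundle morphism which
covers `u`, and `T(f ∘ u) = Tf ∘ Tu` almost everywhere for every `f ∈ C¹_c(N, ℝ)`. -/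
def HasColocalWeakDeriv (u : M → N)
    (Tu : ∀ x : M, TangentSpace (𝓡 m) x →L[ℝ] TangentSpace (𝓡 n) (u x)) : Prop :=
  LocallyMeasurable m (fun x => tensorPoint x (u x) (Tu x)) ∧
    ∀ f : N → ℝ, ContMDiff (𝓡 n) 𝓘(ℝ, ℝ) 1 f → HasCompactSupport f →
      HasWeakMFDeriv (f ∘ u) fun x => (mfderiv (𝓡 n) 𝓘(ℝ, ℝ) f (u x) :
        TangentSpace (𝓡 n) (u x) →L[ℝ] ℝ) ∘L Tu x

/-- `D` is the colocal weak covariant derivative of the colocally weakly differentiable map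
`Tu : M → T*M ⊗ TN` (covering `u`): it is measurable and
`Tf(Tu)[Vert ∘ D] = T(f ∘ Tu) - Tf(Tu)[Hor ∘ Tu]` almost everywhere for every
`f ∈ C¹_c(T*M ⊗ TN, ℝ)`. Here `Hor ∘ Tu` at `e ∈ T_x M` is the horizontal lift of `(e, Tu(x)[e])`
at the point `Tu(x)`. -/
def HasColocalWeakCovDeriv (gM : Metric m M) (gN : Metric n N) (u : M → N)
    (Tu : ∀ x : M, TangentSpace (𝓡 m) x →L[ℝ] TangentSpace (𝓡 n) (u x))
    (D : ∀ x : M, TangentSpace (𝓡 m) x →L[ℝ] TangentSpace (𝓡 m) x →L[ℝ]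
      TangentSpace (𝓡 n) (u x)) : Prop :=
  LocallyMeasurable m (fun x => tensorPoint₂ x (u x) (D x)) ∧
    ∀ f : TensorBundle m n M N → ℝ, ContMDiff (tensorModel m n) 𝓘(ℝ, ℝ) 1 f →
      HasCompactSupport f →
      HasWeakMFDeriv (fun x => f (tensorPoint x (u x) (Tu x))) fun x =>
        (mfderiv (tensorModel m n) 𝓘(ℝ, ℝ) f (tensorPoint x (u x) (Tu x)) :
          TangentSpace (tensorModel m n) (tensorPoint x (u x) (Tu x)) →L[ℝ] ℝ) ∘L
        (vertLift x (u x) (Tu x) ∘L D x +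
          horLift gM gN x (u x) (Tu x) ∘L
            ((ContinuousLinearMap.id ℝ (TangentSpace (𝓡 m) x)).prod (Tu x)))

/-- The norm of a bilinear map `B : T_x M × T_x M → T_y N` for the metric `g_M^* ⊗ g_M^* ⊗ g_N`. -/
def tensorNorm (gM : Metric m M) (gN : Metric n N) (x : M) (y : N)
    (B : TangentSpace (𝓡 m) x →L[ℝ] TangentSpace (𝓡 m) x →L[ℝ] TangentSpace (𝓡 n) y) : ℝ :=
  Real.sqrt (∑ i, ∑ j, gN.inner y (B (orthonormalFrame gM x i) (orthonormalFrame gM x j))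
    (B (orthonormalFrame gM x i) (orthonormalFrame gM x j)))

/-- The intrinsic homogeneous Sobolev space `Ẇ^{2,p}(M, N)`: the maps `u` which are twice colocally
weakly differentiable, that is, `u` is colocally weakly differentiable and its colocal weak
derivative `Tu : M → T*M ⊗ TN` is colocally weakly differentiable, and for which
`|D_K(Tu)| ∈ L^p(M)`. -/
def intrinsicSobolev [MeasurableSpace M] (gM : Metric m M) (gN : Metric n N) (p : ℝ) :
    Set (M → N) :=
  {u | IsColocallyWeaklyDifferentiable m (𝓡 n) u ∧
    ∃ Tu : ∀ x : M, TangentSpace (𝓡 m) x →L[ℝ] TangentSpace (𝓡 n) (u x),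
      HasColocalWeakDeriv u Tu ∧
      IsColocallyWeaklyDifferentiable m (tensorModel m n)
        (fun x => tensorPoint x (u x) (Tu x)) ∧
      ∃ D : ∀ x : M, TangentSpace (𝓡 m) x →L[ℝ] TangentSpace (𝓡 m) x →L[ℝ]
          TangentSpace (𝓡 n) (u x),
        HasColocalWeakCovDeriv gM gN u Tu D ∧
        ∫⁻ x, ENNReal.ofReal (tensorNorm gM gN x (u x) (D x)) ^ p ∂riemannianMeasure gM < ⊤}

end Colocal

/-! ### The Sobolev space defined by an embedding of `N` -/

section Embedded

variable {m : ℕ} {M : Type*} [TopologicalSpace M] [ChartedSpace (Euc m) M]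
  [IsManifold (𝓡 m) 2 M] {ν : ℕ}

/-- `v : M → ℝ^ν` is twice weakly differentiable, i.e. `v ∈ W^{2,1}_loc(M, ℝ^ν)`, and its second
covariant derivative `D²v` is (almost everywhere) equal to `H`. In a chart one has
`D²v(a, b) = ∂_a ∂_b v - Dv(Γ(a, b))`. -/
def HasWeakHessian (gM : Metric m M) (v : M → Euc ν)
    (H : ∀ x : M, TangentSpace (𝓡 m) x →L[ℝ] TangentSpace (𝓡 m) x →L[ℝ] Euc ν) : Prop :=
  ∀ x₀ : M, ∃ ψ ∈ IsManifold.maximalAtlas (𝓡 m) 2 M, x₀ ∈ ψ.source ∧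
    ∃ (w₁ : Euc m → Euc m →L[ℝ] Euc ν) (w₂ : Euc m → Euc m →L[ℝ] Euc m →L[ℝ] Euc ν),
      HasWeakFDerivOn ψ.target (v ∘ ψ.symm) w₁ ∧ HasWeakFDerivOn ψ.target w₁ w₂ ∧
      ∀ᵐ z ∂volume.restrict ψ.target, ∀ a b : Euc m,
        H (ψ.symm z) (chartInvDeriv ψ z a) (chartInvDeriv ψ z b) =
          w₂ z a b - w₁ z (christoffel gM ψ z a b)

/-- The norm of a bilinear map `B : T_x M × T_x M → ℝ^ν` for the metric on `T_x M` and the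
Euclidean metric on `ℝ^ν`. -/
def hessianNorm (gM : Metric m M) (x : M)
    (B : TangentSpace (𝓡 m) x →L[ℝ] TangentSpace (𝓡 m) x →L[ℝ] Euc ν) : ℝ :=
  Real.sqrt (∑ i, ∑ j, ‖B (orthonormalFrame gM x i) (orthonormalFrame gM x j)‖ ^ 2)

/-- The homogeneous Sobolev space `Ẇ^{2,p}_ι(M, N)` defined by the map `ι : N → ℝ^ν`: the maps `u`
such that `ι ∘ u ∈ W^{2,1}_loc(M, ℝ^ν)` and `|D²(ι ∘ u)| ∈ L^p(M)`. -/
def embeddedSobolev [MeasurableSpace M] {N : Type*} (gM : Metric m M) (ι : N → Euc ν) (p : ℝ) :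
    Set (M → N) :=
  {u | ∃ H : ∀ x : M, TangentSpace (𝓡 m) x →L[ℝ] TangentSpace (𝓡 m) x →L[ℝ] Euc ν,
    HasWeakHessian gM (ι ∘ u) H ∧
    ∫⁻ x, ENNReal.ofReal (hessianNorm gM x (H x)) ^ p ∂riemannianMeasure gM < ⊤}

/-- `ι : N → ℝ^ν` is an isometric embedding of class `C²`. -/
structure IsIsometricEmbedding {n : ℕ} {N : Type*} [TopologicalSpace N] [ChartedSpace (Euc n) N]
    [IsManifold (𝓡 n) 2 N] (gN : Metric n N) (ι : N → Euc ν) : Prop where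
  contMDiff : ContMDiff (𝓡 n) (𝓡 ν) 2 ι
  isEmbedding : Topology.IsEmbedding ι
  isometric : ∀ (y : N) (v w : TangentSpace (𝓡 n) y),
    inner (E := Euc ν) ℝ (mfderiv (𝓡 n) (𝓡 ν) ι y v : Euc ν) (mfderiv (𝓡 n) (𝓡 ν) ι y w : Euc ν) =
      gN.inner y v w

end Embedded

end ColocalSobolev

end

/-! Write `v = ι ∘ u`. Near each of its points, `ι(N)` consists of fixed points of a map `A` of
class `C²` whose differential has tangent values along `ι(N)`. Since `A ∘ v = v`, the chain rule
gives `Dv = DA(v) Dv`, so `Dv` is tangent almost everywhere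
(`IsIsometricEmbedding.ae_mem_range_mapDeriv`). One order higher, the pair `(v, Dv)` is fixed by
`(q, W) ↦ (A q, DA(q) ∘ W)`, a map of class `C¹`; differentiating this relation shows that `∂_e ∂_a
v - D²ι(Tu e, Tu a)` is tangent (`IsIsometricEmbedding.ae_sub_mem_range_mapDeriv`).

The candidates are the tangential parts `Tu = Dι(u)⁻¹ Dv` and `D = Dι(u)⁻¹ (D²v)ᵀ`, where `Dι(u)⁻¹`
is extended by zero to normal vectors (`normalInv`). That `D` is the covariant derivative of `Tu` is
the Gauss formula: `D²ι(a, b) - Dι(Γ(a, b))` is normal, so the tangential part of `D²ι` is the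
Christoffel term of `N`. This is checked pointwise in `exists_hasFDerivAt_tensorEmb_comp`.

For the colocal definitions, a test function in `C¹_c(N)` is extended to `G ∈ C¹_c(ℝ^ν)`, so that `f
∘ u = G ∘ v`. For `T*M ⊗ TN` the same is done along the embedding `tensorEmb`, which sends `Tu(x)`
to `(z, v, Dv)` in a chart of `M`. These images are in `W^{1,1}_loc`, and the chain rule only needs
`DG` bounded; in particular no separate integrability of the quadratic expression `|Dv|²` is
required.

Finally the orthogonal projection onto the tangent space contracts norms and `ι` is isometric,
whence `|D| ≤ |D²v|` pointwise. -/

noncomputable section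

namespace ColocalSobolev

open Filter Topology

/-! ### Convergence of mollifications in `L¹` and almost everywhere. -/

section Mollification

variable {m : ℕ} {F : Type*} [NormedAddCommGroup F]

/-- Almost everywhere convergence together with a bound on the norms by the norm of the limit
implies convergence in `L¹`. -/
theorem tendsto_lintegral_enorm_sub_of_ae_tendsto {α : Type*} [MeasurableSpace α] {μ : Measure α}
    {g : α → F} {a : ℕ → α → F} (hg : Integrable g μ) (ha : ∀ k, AEStronglyMeasurable (a k) μ)
    (hle : ∀ k, ∫⁻ x, ‖a k x‖ₑ ∂μ ≤ ∫⁻ x, ‖g x‖ₑ ∂μ)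
    (hlim : ∀ᵐ x ∂μ, Tendsto (fun k => a k x) atTop (𝓝 (g x))) :
    Tendsto (fun k => ∫⁻ x, ‖a k x - g x‖ₑ ∂μ) atTop (𝓝 0) := by
  set N := ∫⁻ x, ‖g x‖ₑ ∂μ with hN
  have hNtop : N ≠ ⊤ := hg.2.ne
  -- Scheffé's argument: `h k` is nonnegative and tends to `2‖g‖`, so Fatou bounds `2N` by the lower
  -- limit of its integrals, while `hsum` says that `∫ h k` falls short of `2N` by at least the `L¹`
  -- distance.
  let h : ℕ → α → ℝ≥0∞ := fun k x => (‖g x‖ₑ + ‖a k x‖ₑ) - ‖a k x - g x‖ₑ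
  have hsum : ∀ k, ∫⁻ x, h k x ∂μ + ∫⁻ x, ‖a k x - g x‖ₑ ∂μ ≤ N + N := by
    intro k
    have hm : AEMeasurable (fun x => ‖a k x - g x‖ₑ) μ := ((ha k).sub hg.1).enorm
    rw [← lintegral_add_right' _ hm]
    calc ∫⁻ x, (h k x + ‖a k x - g x‖ₑ) ∂μ = ∫⁻ x, (‖g x‖ₑ + ‖a k x‖ₑ) ∂μ := by
          refine lintegral_congr fun x => tsub_add_cancel_of_le ?_
          rw [add_comm]; exact enorm_sub_le
      _ = N + ∫⁻ x, ‖a k x‖ₑ ∂μ := lintegral_add_left' hg.1.enorm _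
      _ ≤ N + N := by gcongr; exact hle k
  have hfatou : N + N ≤ liminf (fun k => ∫⁻ x, h k x ∂μ) atTop := by
    calc N + N = ∫⁻ x, (‖g x‖ₑ + ‖g x‖ₑ) ∂μ := (lintegral_add_left' hg.1.enorm _).symm
      _ = ∫⁻ x, liminf (fun k => h k x) atTop ∂μ := by
          refine lintegral_congr_ae ?_
          filter_upwards [hlim] with x hx
          refine (Tendsto.liminf_eq ?_).symm
          have h1 : Tendsto (fun k => ‖a k x - g x‖ₑ) atTop (𝓝 0) := by
            simpa using (hx.sub_const (g x)).enorm
          have h2 := (hx.enorm.const_add ‖g x‖ₑ)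
          simpa using ENNReal.Tendsto.sub h2 h1 (Or.inr (by simp))
      _ ≤ _ := lintegral_liminf_le' fun k =>
          (hg.1.enorm.add (ha k).enorm).sub ((ha k).sub hg.1).enorm
  refine ENNReal.tendsto_nhds_zero.2 fun ε hε => ?_
  -- The strict inequality `N + N - ε < N + N` fails for `N = 0`, a case in which `hsum` already
  -- gives a zero distance.
  rcases eq_or_ne N 0 with h0 | h0
  · refine Eventually.of_forall fun k => ?_
    have := (le_add_self).trans (hsum k)
    rw [h0] at this
    exact this.trans (by simp)
  · rcases eq_or_ne ε ⊤ with rfl | hεt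
    · simp
    have hlt : N + N - ε < liminf (fun k => ∫⁻ x, h k x ∂μ) atTop :=
      (ENNReal.sub_lt_self (by simp [hNtop]) (by simp [h0]) hε.ne').trans_le hfatou
    filter_upwards [eventually_lt_of_lt_liminf hlt] with k hk
    by_contra hc
    push Not at hc
    have h3 : N + N < ∫⁻ x, h k x ∂μ + ε := by
      have := ENNReal.add_lt_add_right hεt hk
      exact lt_of_le_of_lt le_tsub_add this
    exact absurd (h3.trans_le ((add_le_add_right hc.le _).trans (hsum k))) (lt_irrefl _)

variable [NormedSpace ℝ F]

/-- A sequence of bump functions shrinking to the origin, supported in the ball of radius `δ`. -/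
theorem exists_contDiffBump_seq (m : ℕ) {δ : ℝ} (hδ : 0 < δ) :
    ∃ φ : ℕ → ContDiffBump (0 : Euc m), (∀ k, (φ k).rOut ≤ δ) ∧
      Tendsto (fun k => (φ k).rOut) atTop (𝓝 0) ∧ ∀ k, (φ k).rOut ≤ 2 * (φ k).rIn := by
  -- The inner radius is half the outer one: the ratio must stay bounded for convergence at Lebesgue
  -- points.
  refine ⟨fun k => ⟨δ / (2 * (k + 1)), δ / (k + 1), by positivity, ?_⟩, fun k => ?_, ?_, fun k => ?_⟩
  · have : (0 : ℝ) < k + 1 := by positivity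
    rw [div_lt_div_iff₀ (by positivity) this]
    nlinarith
  · exact div_le_self hδ.le (by simp)
  · simpa [div_eq_mul_inv] using (tendsto_one_div_add_atTop_nhds_zero_nat (𝕜 := ℝ)).const_mul δ
  · exact le_of_eq (by field_simp)

/-- Young's inequality for a kernel of mass one: Tonelli, then translation invariance. -/
theorem lintegral_enorm_convolution_le [CompleteSpace F] (φ : ContDiffBump (0 : Euc m))
    {g : Euc m → F} (hg : Integrable g) :
    ∫⁻ x, ‖(convolution (φ.normed volume) g (ContinuousLinearMap.lsmul ℝ ℝ) volume) x‖ₑ ≤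
      ∫⁻ x, ‖g x‖ₑ := by
  have hφ : Integrable (φ.normed (volume : Measure (Euc m))) :=
    φ.continuous_normed.integrable_of_hasCompactSupport φ.hasCompactSupport_normed
  have h1 : ∫⁻ t, ‖φ.normed (volume : Measure (Euc m)) t‖ₑ = 1 := by
    have := ofReal_integral_eq_lintegral_ofReal hφ (ae_of_all _ fun x => φ.nonneg_normed x)
    rw [φ.integral_normed, ENNReal.ofReal_one] at this
    rw [this]
    exact lintegral_congr fun x => (Real.enorm_of_nonneg (φ.nonneg_normed x))
  calc _ ≤ ∫⁻ x, ∫⁻ t, ‖φ.normed (volume : Measure (Euc m)) t‖ₑ * ‖g (x - t)‖ₑ := by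
        refine lintegral_mono fun x => ?_
        refine (enorm_integral_le_lintegral_enorm _).trans (lintegral_mono fun t => ?_)
        simp [enorm_smul]
    _ = ∫⁻ t, ∫⁻ x, ‖φ.normed (volume : Measure (Euc m)) t‖ₑ * ‖g (x - t)‖ₑ := by
        refine lintegral_lintegral_swap ?_
        refine (hφ.1.enorm.comp_quasiMeasurePreserving Measure.quasiMeasurePreserving_snd).mul ?_
        exact hg.1.enorm.comp_quasiMeasurePreserving
          (quasiMeasurePreserving_sub_of_right_invariant volume volume)
    _ = ∫⁻ t, ‖φ.normed (volume : Measure (Euc m)) t‖ₑ * ∫⁻ x, ‖g x‖ₑ := by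
        refine lintegral_congr fun t => ?_
        rw [lintegral_const_mul' _ _ (by simp), lintegral_sub_right_eq_self (fun x => ‖g x‖ₑ) t]
    _ = _ := by rw [lintegral_mul_const' _ _ hg.2.ne, h1, one_mul]

/-- The pointwise limit is Lebesgue differentiation; with the contraction bound above, Scheffé's
argument upgrades it to `L¹`. -/
theorem ae_tendsto_and_tendsto_lintegral_convolution [CompleteSpace F]
    {φ : ℕ → ContDiffBump (0 : Euc m)} (h0 : Tendsto (fun k => (φ k).rOut) atTop (𝓝 0))
    (h2 : ∀ k, (φ k).rOut ≤ 2 * (φ k).rIn) {g : Euc m → F} (hg : Integrable g) :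
    (∀ᵐ x, Tendsto (fun k => (convolution ((φ k).normed volume) g
      (ContinuousLinearMap.lsmul ℝ ℝ) volume) x) atTop (𝓝 (g x))) ∧
    Tendsto (fun k => ∫⁻ x, ‖(convolution ((φ k).normed volume) g
      (ContinuousLinearMap.lsmul ℝ ℝ) volume) x - g x‖ₑ) atTop (𝓝 0) := by
  have h := ContDiffBump.ae_convolution_tendsto_right_of_locallyIntegrable (μ := volume) h0
    (Eventually.of_forall h2) hg.locallyIntegrable
  refine ⟨h, tendsto_lintegral_enorm_sub_of_ae_tendsto hg (fun k => ?_)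
    (fun k => lintegral_enorm_convolution_le (φ k) hg) h⟩
  exact ((φ k).hasCompactSupport_normed.continuous_convolution_left _ (φ k).continuous_normed
    hg.locallyIntegrable).aestronglyMeasurable

end Mollification

/-! ### Weak derivatives on open sets: uniqueness and smooth approximation. -/

section WeakDerivative

variable {m : ℕ} {F : Type*} [NormedAddCommGroup F] [NormedSpace ℝ F] {Ω Ω' : Set (Euc m)}
  {f g : Euc m → F} {f' g' : Euc m → Euc m →L[ℝ] F}

theorem HasWeakFDerivOn.mono (h : HasWeakFDerivOn Ω f f') (hΩ : Ω' ⊆ Ω) :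
    HasWeakFDerivOn Ω' f f' :=
  ⟨h.1.mono_set hΩ, h.2.1.mono_set hΩ, fun φ hφ hc hs a => h.2.2 φ hφ hc (hs.trans hΩ) a⟩

theorem HasWeakFDerivOn.congr_ae (h : HasWeakFDerivOn Ω f f') (hΩ : IsOpen Ω)
    (hf : f =ᵐ[volume.restrict Ω] g) (hf' : f' =ᵐ[volume.restrict Ω] g') :
    HasWeakFDerivOn Ω g g' := by
  refine ⟨h.1.congr hf, h.2.1.congr hf', fun φ hφ hc hs a => ?_⟩
  have key : ∀ {G : Type _} [NormedAddCommGroup G] [NormedSpace ℝ G] {p q : Euc m → G}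
      {χ : Euc m → ℝ}, (∀ z, z ∉ Ω → χ z = 0) → p =ᵐ[volume.restrict Ω] q →
      ∫ z, χ z • p z = ∫ z, χ z • q z := by
    intro G _ _ p q χ hχ hpq
    refine integral_congr_ae ?_
    filter_upwards [(ae_restrict_iff' hΩ.measurableSet).1 hpq] with z hz
    by_cases hzΩ : z ∈ Ω
    · simp only [hz hzΩ]
    · simp [hχ z hzΩ]
  rw [← key (fun z hz => ?_) hf, h.2.2 φ hφ hc hs a]
  · congr 1
    refine key (p := fun z => f' z a) (q := fun z => g' z a) (fun z hz => ?_) ?_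
    · exact image_eq_zero_of_notMem_tsupport fun h => hz (hs h)
    · filter_upwards [hf'] with z hz
      simp only [hz]
  · have : fderiv ℝ φ z = 0 := fderiv_of_notMem_tsupport (𝕜 := ℝ) fun h => hz (hs h)
    simp [this]

theorem _root_.MeasureTheory.LocallyIntegrableOn.integrable_smul_of_hasCompactSupport
    {G : Type*} [NormedAddCommGroup G] [NormedSpace ℝ G] {w : Euc m → G}
    (hw : LocallyIntegrableOn w Ω) {φ : Euc m → ℝ} (hφ : Continuous φ) (hc : HasCompactSupport φ)
    (hs : tsupport φ ⊆ Ω) : Integrable fun z => φ z • w z := by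
  have h1 : IntegrableOn (fun z => φ z • w z) (tsupport φ) :=
    (hw.integrableOn_compact_subset hs hc).continuousOn_smul hφ.continuousOn hc
  refine (integrableOn_iff_integrable_of_support_subset ?_).1 h1
  exact fun z hz => subset_tsupport φ fun h0 => hz (by simp [h0])

/-- The fundamental lemma of the calculus of variations, applied to the operator-valued `f' - g'`
and tested vector by vector. -/
theorem HasWeakFDerivOn.unique [CompleteSpace F] (h : HasWeakFDerivOn Ω f f')
    (h' : HasWeakFDerivOn Ω f g') (hΩ : IsOpen Ω) : f' =ᵐ[volume.restrict Ω] g' := by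
  have hd : LocallyIntegrableOn (fun z => f' z - g' z) Ω := h.2.1.sub h'.2.1
  have key := hΩ.ae_eq_zero_of_integral_contDiff_smul_eq_zero hd fun φ hφ hc hs => by
    have hint : ∀ {w : Euc m → Euc m →L[ℝ] F}, LocallyIntegrableOn w Ω →
        Integrable fun z => φ z • w z := fun {w} hw =>
      hw.integrable_smul_of_hasCompactSupport hφ.continuous hc hs
    ext a
    rw [ContinuousLinearMap.integral_apply (hint hd)]
    have e1 := h.2.2 φ hφ hc hs a
    have e2 := h'.2.2 φ hφ hc hs a
    simp only [smul_sub, sub_apply, smul_apply, zero_apply]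
    rw [integral_sub, sub_eq_zero]
    · rw [e1] at e2; exact neg_injective e2
    · exact (ContinuousLinearMap.apply ℝ F a).integrable_comp (hint h.2.1)
    · exact (ContinuousLinearMap.apply ℝ F a).integrable_comp (hint h'.2.1)
  rw [EventuallyEq, ae_restrict_iff' hΩ.measurableSet]
  filter_upwards [key] with z hz hzΩ
  exact sub_eq_zero.1 (hz hzΩ)

/-- A weakly differentiable function can be approximated by smooth functions in `W^{1,1}` on
compact sets, with almost everywhere convergence. -/
theorem HasWeakFDerivOn.exists_approx [CompleteSpace F] (h : HasWeakFDerivOn Ω f f')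
    (hΩ : IsOpen Ω) {K : Set (Euc m)} (hK : IsCompact K) (hKΩ : K ⊆ Ω) :
    ∃ a : ℕ → Euc m → F, (∀ k, ContDiff ℝ ∞ (a k)) ∧
      (∀ᵐ z ∂volume.restrict K, Tendsto (fun k => a k z) atTop (𝓝 (f z))) ∧
      Tendsto (fun k => ∫⁻ z in K, ‖a k z - f z‖ₑ) atTop (𝓝 0) ∧
      Tendsto (fun k => ∫⁻ z in K, ‖fderiv ℝ (a k) z - f' z‖ₑ) atTop (𝓝 0) := by
  -- With bumps of radius at most `δ`, the mollification at a point of `K` only sees `K' ⊆ Ω`.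
  -- Cutting `f` and `f'` off outside `K'` makes them globally integrable without affecting the
  -- values on `K`.
  obtain ⟨δ, hδ, hδΩ⟩ := hK.exists_cthickening_subset_open hΩ hKΩ
  set K' := Metric.cthickening δ K
  have hK' : IsCompact K' := hK.cthickening
  have hKK' : K ⊆ K' := Metric.self_subset_cthickening K
  have hmK' : MeasurableSet K' := hK'.measurableSet
  obtain ⟨φ, hφδ, hφ0, hφ2⟩ := exists_contDiffBump_seq m hδ
  have hf : Integrable (K'.indicator f) :=
    (integrable_indicator_iff hmK').2 (h.1.integrableOn_compact_subset hδΩ hK')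
  have hf' : Integrable (K'.indicator f') :=
    (integrable_indicator_iff hmK').2 (h.2.1.integrableOn_compact_subset hδΩ hK')
  obtain ⟨c1, c2⟩ := ae_tendsto_and_tendsto_lintegral_convolution hφ0 hφ2 hf
  obtain ⟨-, c3⟩ := ae_tendsto_and_tendsto_lintegral_convolution hφ0 hφ2 hf'
  have hind : ∀ {G : Type _} [NormedAddCommGroup G] (p : Euc m → G), ∀ z ∈ K,
      K'.indicator p z = p z := fun p z hz => indicator_of_mem (hKK' hz) p
  have hderiv : ∀ k, ∀ z ∈ K, fderiv ℝ (convolution ((φ k).normed volume) (K'.indicator f)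
      (ContinuousLinearMap.lsmul ℝ ℝ) volume) z = convolution ((φ k).normed volume)
      (K'.indicator f') (ContinuousLinearMap.lsmul ℝ ℝ) volume z := by
    intro k z hz
    have hd := (φ k).hasCompactSupport_normed.hasFDerivAt_convolution_left
      (μ := volume) (ContinuousLinearMap.lsmul ℝ ℝ : ℝ →L[ℝ] F →L[ℝ] F)
      ((φ k).contDiff_normed (n := 1) (μ := volume)) hf.locallyIntegrable z
    rw [hd.fderiv]
    have hc1 := ((φ k).hasCompactSupport_normed (μ := volume)).fderiv (𝕜 := ℝ) |>.convolutionExists_left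
      ((ContinuousLinearMap.lsmul ℝ ℝ : ℝ →L[ℝ] F →L[ℝ] F).precompL (Euc m))
      ((φ k).contDiff_normed (n := 1) (μ := volume) |>.continuous_fderiv one_ne_zero) hf.locallyIntegrable z
    have hc2 := ((φ k).hasCompactSupport_normed (μ := volume)).convolutionExists_left
      (ContinuousLinearMap.lsmul ℝ ℝ : ℝ →L[ℝ] (Euc m →L[ℝ] F) →L[ℝ] _)
      ((φ k).continuous_normed) hf'.locallyIntegrable z
    ext a
    rw [convolution, convolution, ContinuousLinearMap.integral_apply hc1,
      ContinuousLinearMap.integral_apply hc2]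
    simp only [ContinuousLinearMap.precompL_apply, ContinuousLinearMap.lsmul_apply,
      smul_apply]
    -- The derivative of a convolution falls on the kernel. As a function of `t`, the kernel `φ(z -
    -- t)` is an admissible test function, supported in a ball about `z ∈ K` inside `K'`, so the
    -- weak formula moves the derivative onto `f'`.
    let χ : Euc m → ℝ := fun t => (φ k).normed volume (z - t)
    have hχs : tsupport χ ⊆ Metric.closedBall z δ := by
      refine closure_minimal ?_ Metric.isClosed_closedBall
      intro t ht
      have : z - t ∈ Function.support ((φ k).normed volume) := ht
      rw [(φ k).support_normed_eq, mem_ball_zero_iff] at this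
      rw [Metric.mem_closedBall, dist_comm, dist_eq_norm]
      exact this.le.trans (hφδ k)
    have hzK' : Metric.closedBall z δ ⊆ K' := Metric.closedBall_subset_cthickening hz δ
    have hχd : ∀ t, fderiv ℝ χ t a = - fderiv ℝ ((φ k).normed volume) (z - t) a := by
      intro t
      have h1 : HasFDerivAt ((φ k).normed (volume : Measure (Euc m)))
          (fderiv ℝ ((φ k).normed volume) (z - t)) (z - t) :=
        (((φ k).contDiff_normed (n := 1) (μ := volume)).differentiable one_ne_zero _).hasFDerivAt
      have h2 : HasFDerivAt (fun t : Euc m => z - t) (-ContinuousLinearMap.id ℝ (Euc m)) t :=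
        (hasFDerivAt_id t).const_sub z
      have h3 : HasFDerivAt χ _ t := h1.comp t h2
      rw [h3.fderiv]
      simp
    have e := h.2.2 χ ((φ k).contDiff_normed.comp (contDiff_const.sub contDiff_id))
      (HasCompactSupport.of_support_subset_isCompact (isCompact_closedBall z δ)
        ((subset_tsupport _).trans hχs)) (hχs.trans (hzK'.trans hδΩ)) a
    have e1 : ∫ t, fderiv ℝ ((φ k).normed volume) t a • K'.indicator f (z - t) =
        - ∫ t, fderiv ℝ χ t a • f t := by
      rw [← integral_sub_left_eq_self _ volume z, ← integral_neg]
      refine integral_congr_ae (ae_of_all _ fun t => ?_)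
      simp only [sub_sub_cancel, hχd, neg_smul, neg_neg]
      by_cases ht : t ∈ K'
      · rw [indicator_of_mem ht]
      · have : fderiv ℝ χ t = 0 :=
          fderiv_of_notMem_tsupport (𝕜 := ℝ) fun h' => ht (hzK' (hχs h'))
        have h3 := hχd t
        rw [this] at h3
        simp only [zero_apply, zero_eq_neg] at h3
        rw [h3, zero_smul, zero_smul]
    have e2 : ∫ t, (φ k).normed volume t • (K'.indicator f' (z - t)) a = ∫ t, χ t • f' t a := by
      rw [← integral_sub_left_eq_self _ volume z]
      refine integral_congr_ae (ae_of_all _ fun t => ?_)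
      simp only [sub_sub_cancel]
      by_cases ht : t ∈ K'
      · rw [indicator_of_mem ht]
      · have : χ t = 0 := image_eq_zero_of_notMem_tsupport fun h' => ht (hzK' (hχs h'))
        change χ t • _ = _
        rw [this, zero_smul, zero_smul]
    rw [e1, e2, e, neg_neg]
  refine ⟨fun k => convolution ((φ k).normed volume) (K'.indicator f)
      (ContinuousLinearMap.lsmul ℝ ℝ) volume, fun k => ?_, ?_, ?_, ?_⟩
  · exact (φ k).hasCompactSupport_normed.contDiff_convolution_left _ (φ k).contDiff_normed
      hf.locallyIntegrable
  · refine (ae_restrict_iff' hK.measurableSet).2 ?_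
    filter_upwards [c1] with z hz hzK
    rwa [hind f z hzK] at hz
  · refine tendsto_of_tendsto_of_tendsto_of_le_of_le tendsto_const_nhds c2 (fun _ => zero_le)
      fun k => ?_
    refine le_trans (le_of_eq ?_) (setLIntegral_le_lintegral K _)
    exact setLIntegral_congr_fun hK.measurableSet fun z hz => by simp only [hind f z hz]
  · refine tendsto_of_tendsto_of_tendsto_of_le_of_le tendsto_const_nhds c3 (fun _ => zero_le)
      fun k => ?_
    refine le_trans (le_of_eq ?_) (setLIntegral_le_lintegral K _)
    exact setLIntegral_congr_fun hK.measurableSet fun z hz => by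
      simp only [hind f' z hz, hderiv k z hz]

end WeakDerivative

/-! ### Stability under approximation, and the chain rule. -/

section Approximation

variable {m : ℕ} {F : Type*} [NormedAddCommGroup F] [NormedSpace ℝ F] {Ω Ω' : Set (Euc m)}
  {f g : Euc m → F} {f' g' : Euc m → Euc m →L[ℝ] F}

/-- Serves to pass to the limit in both sides of the integration by parts formula. -/
theorem tendsto_integral_smul_of_tendsto_lintegral {G : Type*} [NormedAddCommGroup G]
    [NormedSpace ℝ G] {K : Set (Euc m)} (hK : IsCompact K) {χ : Euc m → ℝ} (hχ : Continuous χ)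
    (hχK : ∀ z, z ∉ K → χ z = 0) {p : Euc m → G} {q : ℕ → Euc m → G} (hp : IntegrableOn p K)
    (hq : ∀ k, IntegrableOn (q k) K)
    (h : Tendsto (fun k => ∫⁻ z in K, ‖q k z - p z‖ₑ) atTop (𝓝 0)) :
    Tendsto (fun k => ∫ z, χ z • q k z) atTop (𝓝 (∫ z, χ z • p z)) := by
  have hset : ∀ r : Euc m → G, ∫ z, χ z • r z = ∫ z in K, χ z • r z := fun r =>
    (setIntegral_eq_integral_of_forall_compl_eq_zero fun z hz => by simp [hχK z hz]).symm
  simp only [hset]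
  obtain ⟨C, hC⟩ := hK.exists_bound_of_continuousOn hχ.continuousOn
  refine tendsto_integral_of_L1' _ (hp.continuousOn_smul hχ.continuousOn hK).1
    (Eventually.of_forall fun k => (hq k).continuousOn_smul hχ.continuousOn hK) ?_
  have h0 : Tendsto (fun k => ENNReal.ofReal C * ∫⁻ z in K, ‖q k z - p z‖ₑ) atTop (𝓝 0) := by
    simpa using ENNReal.Tendsto.const_mul h (Or.inr (ENNReal.ofReal_ne_top (r := C)))
  refine tendsto_of_tendsto_of_tendsto_of_le_of_le tendsto_const_nhds h0 (fun _ => zero_le)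
    fun k => ?_
  simp only [eLpNorm_one_eq_lintegral_enorm]
  rw [← lintegral_const_mul' _ _ ENNReal.ofReal_ne_top]
  refine setLIntegral_mono' hK.measurableSet fun z hz => ?_
  simp only [Pi.sub_apply, ← smul_sub, enorm_smul]
  gcongr
  rw [← ofReal_norm]
  exact ENNReal.ofReal_le_ofReal (hC z hz)

/-- A function which can be approximated by `C¹` functions in `W^{1,1}` on compact sets is weakly
differentiable. -/
theorem hasWeakFDerivOn_of_approx (hf : LocallyIntegrableOn f Ω) (hf' : LocallyIntegrableOn f' Ω)
    (h : ∀ K ⊆ Ω, IsCompact K → ∃ a : ℕ → Euc m → F, (∀ k, ∀ z ∈ K, ContDiffAt ℝ 1 (a k) z) ∧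
      Tendsto (fun k => ∫⁻ z in K, ‖a k z - f z‖ₑ) atTop (𝓝 0) ∧
      Tendsto (fun k => ∫⁻ z in K, ‖fderiv ℝ (a k) z - f' z‖ₑ) atTop (𝓝 0)) :
    HasWeakFDerivOn Ω f f' := by
  refine ⟨hf, hf', fun φ hφ hc hs v => ?_⟩
  obtain ⟨a, ha, h1, h2⟩ := h (tsupport φ) hs hc
  have hφ' : Continuous fun z => fderiv ℝ φ z v :=
    (hφ.continuous_fderiv (by simp)).clm_apply continuous_const
  have hz : ∀ z, z ∉ tsupport φ → φ z = 0 := fun z hz => image_eq_zero_of_notMem_tsupport hz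
  have hz' : ∀ z, z ∉ tsupport φ → fderiv ℝ φ z v = 0 := fun z hz => by
    rw [fderiv_of_notMem_tsupport (𝕜 := ℝ) hz, zero_apply]
  have hK : IsCompact (tsupport φ) := hc
  have i1 : ∀ k, IntegrableOn (a k) (tsupport φ) := fun k =>
    ContinuousOn.integrableOn_compact hK fun z hz => (ha k z hz).continuousAt.continuousWithinAt
  have i2 : ∀ k, IntegrableOn (fun z => fderiv ℝ (a k) z v) (tsupport φ) := fun k =>
    ContinuousOn.integrableOn_compact hK fun z hz =>
      (((ha k z hz).continuousAt_fderiv one_ne_zero).clm_apply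
        continuousAt_const).continuousWithinAt
  have hext : ∀ {χ : Euc m → ℝ} (_ : Continuous χ) (_ : ∀ z, z ∉ tsupport φ → χ z = 0)
      {p : Euc m → F} (_ : IntegrableOn p (tsupport φ)), Integrable fun z => χ z • p z := by
    intro χ hχ hχ0 p hp
    refine (integrableOn_iff_integrable_of_support_subset ?_).1
      (hp.continuousOn_smul hχ.continuousOn hK)
    intro z hz
    by_contra hzK
    exact hz (by simp [hχ0 z hzK])
  have hparts : ∀ k, ∫ z, fderiv ℝ φ z v • a k z = -∫ z, φ z • fderiv ℝ (a k) z v := fun k => by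
    rw [integral_smul_fderiv_eq_neg_fderiv_smul_of_integrable (hext hφ' hz' (i1 k))
      (hext hφ.continuous hz (i2 k)) (hext hφ.continuous hz (i1 k))
      (fun z _ => (hφ.differentiable (by simp)) z)
      (fun z hz => (ha k z hz).differentiableAt one_ne_zero), neg_neg]
  have l1 := tendsto_integral_smul_of_tendsto_lintegral hK hφ' hz'
    (hf.integrableOn_compact_subset hs hK) i1 h1
  have l2 := tendsto_integral_smul_of_tendsto_lintegral hK hφ.continuous hz (p := fun z => f' z v)
    ((ContinuousLinearMap.apply ℝ F v).integrable_comp (hf'.integrableOn_compact_subset hs hK)) i2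
    (by
      have h0 : Tendsto (fun k => ‖v‖ₑ * ∫⁻ z in tsupport φ, ‖fderiv ℝ (a k) z - f' z‖ₑ) atTop
          (𝓝 0) := by
        simpa using ENNReal.Tendsto.const_mul h2 (Or.inr (enorm_ne_top (x := v)))
      refine tendsto_of_tendsto_of_tendsto_of_le_of_le tendsto_const_nhds h0 (fun _ => zero_le)
        fun k => ?_
      dsimp only
      rw [← lintegral_const_mul' _ _ enorm_ne_top]
      refine lintegral_mono fun z => ?_
      rw [← sub_apply, mul_comm]
      exact ContinuousLinearMap.le_opENorm _ _)
  simp only [hparts] at l1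
  exact tendsto_nhds_unique l1 l2.neg

theorem hasWeakFDerivOn_of_contDiffOn (hΩ : IsOpen Ω) (hf : ContDiffOn ℝ 1 f Ω) :
    HasWeakFDerivOn Ω f (fderiv ℝ f) := by
  have hat : ∀ z ∈ Ω, ContDiffAt ℝ 1 f z := fun z hz => hf.contDiffAt (hΩ.mem_nhds hz)
  refine hasWeakFDerivOn_of_approx (hf.continuousOn.locallyIntegrableOn hΩ.measurableSet)
    (ContinuousOn.locallyIntegrableOn (fun z hz =>
      ((hat z hz).continuousAt_fderiv one_ne_zero).continuousWithinAt) hΩ.measurableSet)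
    fun K hKΩ hK => ⟨fun _ => f, fun _ z hz => hat z (hKΩ hz), by simp, by simp⟩

theorem HasWeakFDerivOn.add (hf : HasWeakFDerivOn Ω f f') (hg : HasWeakFDerivOn Ω g g') :
    HasWeakFDerivOn Ω (fun z => f z + g z) fun z => f' z + g' z := by
  refine ⟨hf.1.add hg.1, hf.2.1.add hg.2.1, fun φ hφ hc hs v => ?_⟩
  have hφ' : Continuous fun z => fderiv ℝ φ z v :=
    (hφ.continuous_fderiv (by simp)).clm_apply continuous_const
  have hc' : HasCompactSupport fun z => fderiv ℝ φ z v := hc.fderiv_apply (𝕜 := ℝ) v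
  have hs' : tsupport (fun z => fderiv ℝ φ z v) ⊆ Ω := (tsupport_fderiv_apply_subset ℝ v).trans hs
  have e1 : Integrable fun z => φ z • f' z v := (ContinuousLinearMap.apply ℝ F v).integrable_comp
    (hf.2.1.integrable_smul_of_hasCompactSupport hφ.continuous hc hs)
  have e2 : Integrable fun z => φ z • g' z v := (ContinuousLinearMap.apply ℝ F v).integrable_comp
    (hg.2.1.integrable_smul_of_hasCompactSupport hφ.continuous hc hs)
  have e3 := hf.1.integrable_smul_of_hasCompactSupport hφ' hc' hs'
  have e4 := hg.1.integrable_smul_of_hasCompactSupport hφ' hc' hs'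
  calc ∫ z, fderiv ℝ φ z v • (f z + g z)
      = ∫ z, (fderiv ℝ φ z v • f z + fderiv ℝ φ z v • g z) := by simp only [smul_add]
    _ = -∫ z, (φ z • f' z v + φ z • g' z v) := by
        rw [integral_add e3 e4, integral_add e1 e2, hf.2.2 φ hφ hc hs v, hg.2.2 φ hφ hc hs v,
          neg_add]
    _ = -∫ z, φ z • (f' z + g' z) v := by simp only [add_apply, smul_add]

theorem _root_.MeasureTheory.LocallyIntegrableOn.of_norm_le {α G₁ G₂ : Type*} [TopologicalSpace α]
    [MeasurableSpace α] {μ : Measure α} {s : Set α} [NormedAddCommGroup G₁]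
    [NormedAddCommGroup G₂] {p : α → G₁} {q : α → G₂}
    (hp : LocallyIntegrableOn p s μ) (hq : AEStronglyMeasurable q (μ.restrict s))
    (h : ∀ z, ‖q z‖ ≤ ‖p z‖) : LocallyIntegrableOn q s μ := by
  intro x hx
  obtain ⟨t, ht, hi⟩ := hp x hx
  refine ⟨t ∩ s, inter_mem ht self_mem_nhdsWithin, ?_⟩
  exact Integrable.mono (hi.mono_set inter_subset_left : Integrable p (μ.restrict (t ∩ s)))
    (hq.mono_measure (Measure.restrict_mono inter_subset_right le_rfl)) (ae_of_all _ h)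

/-- The chain rule for weak derivatives. -/
theorem HasWeakFDerivOn.comp_contDiff [CompleteSpace F] {F₂ : Type*} [NormedAddCommGroup F₂]
    [NormedSpace ℝ F₂] (hf : HasWeakFDerivOn Ω f f') (hΩ : IsOpen Ω) {G : F → F₂}
    (hG : ContDiff ℝ 1 G) {C : ℝ} (hC : ∀ q, ‖fderiv ℝ G q‖ ≤ C) :
    HasWeakFDerivOn Ω (fun z => G (f z)) fun z => fderiv ℝ G (f z) ∘L f' z := by
  have hC0 : 0 ≤ C := (norm_nonneg _).trans (hC 0)
  have hdG : Differentiable ℝ G := hG.differentiable one_ne_zero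
  have hlip : ∀ p q, ‖G p - G q‖ ≤ C * ‖p - q‖ := fun p q =>
    Convex.norm_image_sub_le_of_norm_fderiv_le (fun x _ => hdG x) (fun x _ => hC x) convex_univ
      (mem_univ q) (mem_univ p)
  have hcG : Continuous (fderiv ℝ G) := hG.continuous_fderiv one_ne_zero
  have hmf := hf.1.aestronglyMeasurable
  have hmf' := hf.2.1.aestronglyMeasurable
  have hmd : AEStronglyMeasurable (fun z => fderiv ℝ G (f z) ∘L f' z) (volume.restrict Ω) :=
    (ContinuousLinearMap.compL ℝ (Euc m) F F₂).aestronglyMeasurable_comp₂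
      (hcG.comp_aestronglyMeasurable hmf) hmf'
  refine hasWeakFDerivOn_of_approx ?_ ?_ fun K hKΩ hK => ?_
  · refine LocallyIntegrableOn.of_norm_le ((locallyIntegrableOn_const (‖G 0‖)).add
      (hf.1.norm.smul C)) (hG.continuous.comp_aestronglyMeasurable hmf) fun z => ?_
    have h1 := hlip (f z) 0
    have h2 : ‖G (f z)‖ ≤ ‖G 0‖ + C * ‖f z‖ := by
      rw [sub_zero] at h1
      calc ‖G (f z)‖ = ‖G 0 + (G (f z) - G 0)‖ := by rw [add_sub_cancel]
        _ ≤ _ := (norm_add_le _ _).trans (by gcongr)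
    exact h2.trans (le_abs_self _)
  · refine LocallyIntegrableOn.of_norm_le (hf.2.1.norm.smul C) hmd fun z => ?_
    refine (ContinuousLinearMap.opNorm_comp_le _ _).trans (le_trans ?_ (le_abs_self _))
    change _ ≤ C * ‖f' z‖
    gcongr
    exact hC _
  · obtain ⟨a, ha, hae, h1, h2⟩ := hf.exists_approx hΩ hK hKΩ
    have hCe : ∀ q, ‖fderiv ℝ G q‖ₑ ≤ ENNReal.ofReal C := fun q => by
      rw [← ofReal_norm]; exact ENNReal.ofReal_le_ofReal (hC q)
    have hda : ∀ k z, fderiv ℝ (fun z => G (a k z)) z = fderiv ℝ G (a k z) ∘L fderiv ℝ (a k) z :=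
      fun k z => fderiv_comp (g := G) z (hdG _) ((ha k).differentiable (by simp) z)
    refine ⟨fun k z => G (a k z), fun k z _ => ?_, ?_, ?_⟩
    · exact (hG.comp ((ha k).of_le (by exact_mod_cast le_top))).contDiffAt
    · have h0 : Tendsto (fun k => ENNReal.ofReal C * ∫⁻ z in K, ‖a k z - f z‖ₑ) atTop (𝓝 0) := by
        simpa using ENNReal.Tendsto.const_mul h1 (Or.inr (ENNReal.ofReal_ne_top (r := C)))
      refine tendsto_of_tendsto_of_tendsto_of_le_of_le tendsto_const_nhds h0 (fun _ => zero_le)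
        fun k => ?_
      dsimp only
      rw [← lintegral_const_mul' _ _ ENNReal.ofReal_ne_top]
      refine lintegral_mono fun z => ?_
      rw [← ofReal_norm, ← ofReal_norm, ← ENNReal.ofReal_mul hC0]
      exact ENNReal.ofReal_le_ofReal (hlip _ _)
    · have hint : ∫⁻ z in K, ‖f' z‖ₑ ≠ ⊤ := (hf.2.1.integrableOn_compact_subset hKΩ hK).2.ne
      have hmK := hmf.mono_measure (Measure.restrict_mono hKΩ le_rfl)
      have hmK' := hmf'.mono_measure (Measure.restrict_mono hKΩ le_rfl)
      -- The error splits as `DG(a k) (D(a k) - f')`, controlled by `C`, plus `(DG(a k) - DG(f))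
      -- f'`. The latter is treated by dominated convergence with majorant `2C‖f'‖`, using the
      -- almost everywhere convergence of the approximants and the continuity of `DG`.
      have h3 : Tendsto (fun k => ∫⁻ z in K, ‖fderiv ℝ G (a k z) - fderiv ℝ G (f z)‖ₑ * ‖f' z‖ₑ)
          atTop (𝓝 0) := by
        have := tendsto_lintegral_of_dominated_convergence' (μ := volume.restrict K)
          (F := fun k z => ‖fderiv ℝ G (a k z) - fderiv ℝ G (f z)‖ₑ * ‖f' z‖ₑ) (f := fun _ => 0)
          (fun z => (ENNReal.ofReal C + ENNReal.ofReal C) * ‖f' z‖ₑ)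
          (fun k => ((((hcG.comp (ha k).continuous).aestronglyMeasurable).sub
            (hcG.comp_aestronglyMeasurable hmK)).enorm).mul hmK'.enorm)
          (fun k => ae_of_all _ fun z => by
            dsimp only
            gcongr
            exact enorm_sub_le.trans (add_le_add (hCe _) (hCe _)))
          (by
            rw [lintegral_const_mul' _ _ (by simp)]
            exact ENNReal.mul_ne_top (by simp) hint)
          (by
            filter_upwards [hae] with z hz
            have : Tendsto (fun k => ‖fderiv ℝ G (a k z) - fderiv ℝ G (f z)‖ₑ) atTop (𝓝 0) := by
              simpa using (((hcG.tendsto _).comp hz).sub_const (fderiv ℝ G (f z))).enorm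
            simpa using ENNReal.Tendsto.mul_const this (Or.inr (enorm_ne_top (x := f' z))))
        simpa using this
      have h0 : Tendsto (fun k => ENNReal.ofReal C * (∫⁻ z in K, ‖fderiv ℝ (a k) z - f' z‖ₑ) +
          ∫⁻ z in K, ‖fderiv ℝ G (a k z) - fderiv ℝ G (f z)‖ₑ * ‖f' z‖ₑ) atTop (𝓝 0) := by
        simpa using (ENNReal.Tendsto.const_mul h2
          (Or.inr (ENNReal.ofReal_ne_top (r := C)))).add h3
      refine tendsto_of_tendsto_of_tendsto_of_le_of_le tendsto_const_nhds h0 (fun _ => zero_le)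
        fun k => ?_
      dsimp only
      rw [← lintegral_const_mul' _ _ ENNReal.ofReal_ne_top, ← lintegral_add_left']
      · refine lintegral_mono fun z => ?_
        rw [hda]
        have e : fderiv ℝ G (a k z) ∘L fderiv ℝ (a k) z - fderiv ℝ G (f z) ∘L f' z =
            fderiv ℝ G (a k z) ∘L (fderiv ℝ (a k) z - f' z) +
              (fderiv ℝ G (a k z) - fderiv ℝ G (f z)) ∘L f' z := by
          ext v; simp
        rw [e]
        refine (enorm_add_le _ _).trans (add_le_add ?_ ?_)
        · exact (ContinuousLinearMap.opENorm_comp_le _ _).trans (by gcongr; exact hCe _)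
        · exact ContinuousLinearMap.opENorm_comp_le _ _
      · exact (((((ha k).continuous_fderiv (by simp)).aestronglyMeasurable).sub
          hmK').enorm).const_mul _

theorem HasWeakFDerivOn.clm_comp [CompleteSpace F] {F₂ : Type*} [NormedAddCommGroup F₂]
    [NormedSpace ℝ F₂] (hf : HasWeakFDerivOn Ω f f') (hΩ : IsOpen Ω) (A : F →L[ℝ] F₂) :
    HasWeakFDerivOn Ω (fun z => A (f z)) fun z => A ∘L f' z := by
  simpa using hf.comp_contDiff hΩ A.contDiff (C := ‖A‖) fun q => by simp

theorem HasWeakFDerivOn.prodMk [CompleteSpace F] {F₂ : Type*} [NormedAddCommGroup F₂]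
    [NormedSpace ℝ F₂] [CompleteSpace F₂] {g : Euc m → F₂} {g' : Euc m → Euc m →L[ℝ] F₂}
    (hf : HasWeakFDerivOn Ω f f') (hg : HasWeakFDerivOn Ω g g') (hΩ : IsOpen Ω) :
    HasWeakFDerivOn Ω (fun z => (f z, g z)) fun z => (f' z).prod (g' z) := by
  have h := (hf.clm_comp hΩ (ContinuousLinearMap.inl ℝ F F₂)).add
    (hg.clm_comp hΩ (ContinuousLinearMap.inr ℝ F F₂))
  convert h using 2 with z z
  · simp
  · ext v <;> simp

end Approximation

/-! ### Weak derivatives under `C¹` changes of variables. -/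

section Diffeomorphism

variable {m : ℕ}

/-- A map of class `C¹` between spaces of equal dimension sends null sets to null sets; here the map
is `e.symm`. -/
theorem ae_restrict_source_of_ae_restrict_target (e : OpenPartialHomeomorph (Euc m) (Euc m))
    (he' : ContDiffOn ℝ 1 e.symm e.target) {p : Euc m → Prop}
    (h : ∀ᵐ w ∂volume.restrict e.target, p w) : ∀ᵐ z ∂volume.restrict e.source, p (e z) := by
  rw [ae_restrict_iff' e.open_target.measurableSet, ae_iff] at h
  rw [ae_restrict_iff' e.open_source.measurableSet, ae_iff]
  have h1 := addHaar_image_eq_zero_of_differentiableOn_of_addHaar_eq_zero (μ := volume)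
    (f := e.symm) (s := {w | ¬(w ∈ e.target → p w)}) ((he'.differentiableOn one_ne_zero).mono
      fun w hw => by
        by_contra hc
        exact hw fun h => absurd h hc) h
  refine measure_mono_null (fun z hz => ?_) h1
  simp only [mem_ofPred_eq, Classical.not_imp] at hz
  exact ⟨e z, by simpa using ⟨e.map_source hz.1, hz.2⟩, e.left_inv hz.1⟩

/-- Change of variables through `e.symm`, whose Jacobian is bounded on the compact set `e '' K`. -/
theorem exists_setLIntegral_comp_le (e : OpenPartialHomeomorph (Euc m) (Euc m))
    (he' : ContDiffOn ℝ 1 e.symm e.target) {K : Set (Euc m)} (hK : IsCompact K)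
    (hKs : K ⊆ e.source) :
    ∃ C : ℝ, ∀ h : Euc m → ℝ≥0∞, ∫⁻ z in K, h (e z) ≤ ENNReal.ofReal C * ∫⁻ w in e '' K, h w := by
  have hcK : IsCompact (e '' K) := hK.image_of_continuousOn (e.continuousOn.mono hKs)
  have hsub : e '' K ⊆ e.target := by
    rintro _ ⟨z, hz, rfl⟩; exact e.map_source (hKs hz)
  have hat : ∀ w ∈ e '' K, ContDiffAt ℝ 1 e.symm w := fun w hw =>
    he'.contDiffAt (e.open_target.mem_nhds (hsub hw))
  have hcont : ContinuousOn (fun w => (fderiv ℝ e.symm w).det) (e '' K) := fun w hw =>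
    (ContinuousLinearMap.continuous_det.continuousAt.comp
      ((hat w hw).continuousAt_fderiv one_ne_zero)).continuousWithinAt
  obtain ⟨C, hC⟩ := hcK.exists_bound_of_continuousOn hcont
  refine ⟨C, fun h => ?_⟩
  have himg : e.symm '' (e '' K) = K := by
    rw [image_image]
    calc _ = id '' K := image_congr fun z hz => e.left_inv (hKs hz)
      _ = K := image_id K
  have key := lintegral_image_eq_lintegral_abs_det_fderiv_mul volume hcK.measurableSet
    (fun w hw => ((hat w hw).differentiableAt one_ne_zero).hasFDerivAt.hasFDerivWithinAt)
    (e.symm.injOn.mono hsub) fun z => h (e z)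
  rw [himg] at key
  rw [key, ← lintegral_const_mul' _ _ ENNReal.ofReal_ne_top]
  refine setLIntegral_mono' hcK.measurableSet fun w hw => ?_
  rw [e.right_inv (hsub hw)]
  gcongr
  exact hC w hw

variable {F : Type*} [NormedAddCommGroup F] [NormedSpace ℝ F] {Ω : Set (Euc m)}
  {f : Euc m → F} {f' : Euc m → Euc m →L[ℝ] F}

/-- Weak derivatives under a change of variables of class `C¹`. -/
theorem HasWeakFDerivOn.comp_openPartialHomeomorph [CompleteSpace F] (hf : HasWeakFDerivOn Ω f f')
    (hΩ : IsOpen Ω) (e : OpenPartialHomeomorph (Euc m) (Euc m)) (hΩe : e.target ⊆ Ω)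
    (he : ContDiffOn ℝ 1 e e.source) (he' : ContDiffOn ℝ 1 e.symm e.target) :
    HasWeakFDerivOn e.source (fun z => f (e z)) fun z => f' (e z) ∘L fderiv ℝ e z := by
  have hat : ∀ z ∈ e.source, ContDiffAt ℝ 1 e z := fun z hz =>
    he.contDiffAt (e.open_source.mem_nhds hz)
  have hme : AEMeasurable e (volume.restrict e.source) :=
    e.continuousOn.aemeasurable e.open_source.measurableSet
  -- Almost everywhere strong measurability survives composition with `e` because preimages of null
  -- sets under `e` are null.
  have hac : Measure.map e (volume.restrict e.source) ≪ volume.restrict e.target := by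
    refine Measure.AbsolutelyContinuous.mk fun s hs h0 => ?_
    rw [Measure.map_apply_of_aemeasurable hme hs]
    have : ∀ᵐ w ∂volume.restrict e.target, w ∉ s := measure_eq_zero_iff_ae_notMem.1 h0
    exact measure_eq_zero_iff_ae_notMem.2 (ae_restrict_source_of_ae_restrict_target e he' this)
  have hcomp : ∀ {G : Type _} [NormedAddCommGroup G] {p : Euc m → G}, LocallyIntegrableOn p Ω →
      AEStronglyMeasurable (fun z => p (e z)) (volume.restrict e.source) := fun {G} _ {p} hp =>
    ((hp.mono_set hΩe).aestronglyMeasurable.mono_ac hac).comp_aemeasurable hme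
  have hcd : ContinuousOn (fderiv ℝ e) e.source := fun z hz =>
    ((hat z hz).continuousAt_fderiv one_ne_zero).continuousWithinAt
  have hmd : AEStronglyMeasurable (fun z => f' (e z) ∘L fderiv ℝ e z)
      (volume.restrict e.source) :=
    (ContinuousLinearMap.compL ℝ (Euc m) (Euc m) F).aestronglyMeasurable_comp₂ (hcomp hf.2.1)
      (hcd.aestronglyMeasurable e.open_source.measurableSet)
  have himg : ∀ {K : Set (Euc m)}, K ⊆ e.source → e '' K ⊆ Ω := by
    rintro K hK _ ⟨z, hz, rfl⟩; exact hΩe (e.map_source (hK hz))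
  have hcimg : ∀ {K : Set (Euc m)}, K ⊆ e.source → IsCompact K → IsCompact (e '' K) :=
    fun hKs hK => hK.image_of_continuousOn (e.continuousOn.mono hKs)
  have hlc := e.open_source.isLocallyClosed
  have hle : ∀ K ⊆ e.source, IsCompact K → ∃ C : ℝ, ∀ p : Euc m → Euc m →L[ℝ] F,
      ∫⁻ z in K, ‖p (e z) ∘L fderiv ℝ e z‖ₑ ≤ ENNReal.ofReal C * ∫⁻ w in e '' K, ‖p w‖ₑ := by
    intro K hKs hK
    obtain ⟨C, hC⟩ := exists_setLIntegral_comp_le e he' hK hKs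
    obtain ⟨B, hB⟩ := hK.exists_bound_of_continuousOn (hcd.mono hKs)
    refine ⟨max B 0 * C, fun p => ?_⟩
    rw [ENNReal.ofReal_mul (le_max_right _ _), mul_assoc]
    refine le_trans ?_ (mul_le_mul_right (hC fun w => ‖p w‖ₑ) (ENNReal.ofReal (max B 0)))
    rw [← lintegral_const_mul' _ _ ENNReal.ofReal_ne_top]
    refine setLIntegral_mono' hK.measurableSet fun z hz => ?_
    refine (ContinuousLinearMap.opENorm_comp_le _ _).trans ?_
    rw [mul_comm]
    gcongr
    rw [← ofReal_norm]
    exact ENNReal.ofReal_le_ofReal ((hB z hz).trans (le_max_left _ _))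
  refine hasWeakFDerivOn_of_approx ?_ ?_ fun K hKs hK => ?_
  · refine (locallyIntegrableOn_iff hlc).2 fun K hKs hK =>
      ⟨(hcomp hf.1).mono_measure (Measure.restrict_mono hKs le_rfl), ?_⟩
    obtain ⟨C, hC⟩ := exists_setLIntegral_comp_le e he' hK hKs
    exact (hC fun w => ‖f w‖ₑ).trans_lt (ENNReal.mul_lt_top ENNReal.ofReal_lt_top
      (hf.1.integrableOn_compact_subset (himg hKs) (hcimg hKs hK)).2)
  · refine (locallyIntegrableOn_iff hlc).2 fun K hKs hK =>
      ⟨hmd.mono_measure (Measure.restrict_mono hKs le_rfl), ?_⟩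
    obtain ⟨C, hC⟩ := hle K hKs hK
    exact (hC f').trans_lt (ENNReal.mul_lt_top ENNReal.ofReal_lt_top
      (hf.2.1.integrableOn_compact_subset (himg hKs) (hcimg hKs hK)).2)
  · obtain ⟨a, ha, -, h1, h2⟩ := hf.exists_approx hΩ (hcimg hKs hK) (himg hKs)
    have ha1 : ∀ k, ContDiff ℝ 1 (a k) := fun k => (ha k).of_le (by exact_mod_cast le_top)
    refine ⟨fun k z => a k (e z), fun k z hz => ?_, ?_, ?_⟩
    · exact (ha1 k).contDiffAt.comp z (hat z (hKs hz))
    · obtain ⟨C, hC⟩ := exists_setLIntegral_comp_le e he' hK hKs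
      have h0 : Tendsto (fun k => ENNReal.ofReal C * ∫⁻ z in e '' K, ‖a k z - f z‖ₑ) atTop
          (𝓝 0) := by
        simpa using ENNReal.Tendsto.const_mul h1 (Or.inr (ENNReal.ofReal_ne_top (r := C)))
      exact tendsto_of_tendsto_of_tendsto_of_le_of_le tendsto_const_nhds h0 (fun _ => zero_le)
        fun k => hC fun w => ‖a k w - f w‖ₑ
    · obtain ⟨C, hC⟩ := hle K hKs hK
      have h0 : Tendsto (fun k => ENNReal.ofReal C * ∫⁻ z in e '' K, ‖fderiv ℝ (a k) z - f' z‖ₑ)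
          atTop (𝓝 0) := by
        simpa using ENNReal.Tendsto.const_mul h2 (Or.inr (ENNReal.ofReal_ne_top (r := C)))
      refine tendsto_of_tendsto_of_tendsto_of_le_of_le tendsto_const_nhds h0 (fun _ => zero_le)
        fun k => le_trans (le_of_eq ?_) (hC fun w => fderiv ℝ (a k) w - f' w)
      refine setLIntegral_congr_fun hK.measurableSet fun z hz => ?_
      have hd : fderiv ℝ (fun z => a k (e z)) z = fderiv ℝ (a k) (e z) ∘L fderiv ℝ e z :=
        fderiv_comp (g := a k) z ((ha1 k).differentiable one_ne_zero _)
          ((hat z (hKs hz)).differentiableAt one_ne_zero)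
      simp only [hd, ContinuousLinearMap.sub_comp]

end Diffeomorphism

/-! ### Pointwise constraints inherited by weak derivatives. -/

section Constraint

variable {m : ℕ} {F : Type*} [NormedAddCommGroup F] [NormedSpace ℝ F] [FiniteDimensional ℝ F]
  {Ω : Set (Euc m)} {f : Euc m → F} {f' : Euc m → Euc m →L[ℝ] F}

/-- The chain rule for the composition with a compactly supported function of class `C¹`. -/
theorem HasWeakFDerivOn.comp_contDiff_of_hasCompactSupport {F₂ : Type*} [NormedAddCommGroup F₂]
    [NormedSpace ℝ F₂] (hf : HasWeakFDerivOn Ω f f') (hΩ : IsOpen Ω) {G : F → F₂}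
    (hG : ContDiff ℝ 1 G) (hc : HasCompactSupport G) :
    HasWeakFDerivOn Ω (fun z => G (f z)) fun z => fderiv ℝ G (f z) ∘L f' z := by
  have : CompleteSpace F := FiniteDimensional.complete ℝ F
  obtain ⟨C, hC⟩ := (hG.continuous_fderiv one_ne_zero).bounded_above_of_compact_support
    (hc.fderiv (𝕜 := ℝ))
  exact hf.comp_contDiff hΩ hG hC

/-- If `f` takes its values in a set `S` on which the map `R` is the identity, then its weak
derivative takes its values in the invariant vectors of the derivative of `R`. -/
theorem HasWeakFDerivOn.exists_ae_eq_fderiv_comp (hf : HasWeakFDerivOn Ω f f') (hΩ : IsOpen Ω)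
    {S : Set F} (hS : ∀ᵐ z ∂volume.restrict Ω, f z ∈ S) {R : F → F} {p : F}
    (hR : ContDiffAt ℝ 1 R p) (hid : ∀ᶠ q in 𝓝 p, q ∈ S → R q = q) :
    ∃ U : Set F, IsOpen U ∧ p ∈ U ∧
      ∀ᵐ z ∂volume.restrict Ω, f z ∈ U → f' z = fderiv ℝ R (f z) ∘L f' z := by
  have hev : ∀ᶠ q in 𝓝 p, ContDiffAt ℝ 1 R q := hR.eventually (by simp)
  obtain ⟨r, hr, hball⟩ := Metric.nhds_basis_closedBall.mem_iff.1 (hev.and hid)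
  let θ : ContDiffBump p := ⟨r / 2, r, by positivity, by linarith⟩
  -- The cut-off makes `Φ` globally `C¹` with compact support. Since `R` fixes the points of `S`
  -- near `p`, `Φ ∘ f` vanishes almost everywhere, hence so does its weak derivative `DΦ(f) f'`;
  -- where `θ = 1` this reads `f' - DR(f) f' = 0`.
  let Φ : F → F := fun q => θ q • (q - R q)
  have hsupp : tsupport Φ ⊆ Metric.closedBall p r :=
    (tsupport_smul_subset_left _ _).trans θ.tsupport_eq.le
  have hΦ : ContDiff ℝ 1 Φ := contMDiff_iff_contDiff.1 <| contMDiff_of_tsupport fun q hq =>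
    contMDiffAt_iff_contDiffAt.2 (θ.contDiffAt.smul (contDiffAt_id.sub (hball (hsupp hq)).1))
  have hΦc : HasCompactSupport Φ :=
    HasCompactSupport.of_support_subset_isCompact (isCompact_closedBall p r)
      ((subset_tsupport _).trans hsupp)
  have h1 := hf.comp_contDiff_of_hasCompactSupport hΩ hΦ hΦc
  have h0 : (fun z => Φ (f z)) =ᵐ[volume.restrict Ω] fun _ => 0 := by
    filter_upwards [hS] with z hz
    by_cases hq : f z ∈ Metric.closedBall p r
    · simp only [Φ, (hball hq).2 hz, sub_self, smul_zero]
    · exact image_eq_zero_of_notMem_tsupport fun h => hq (hsupp h)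
  have h2 := h1.congr_ae hΩ h0 ae_eq_rfl
  have h3 : HasWeakFDerivOn Ω (fun _ : Euc m => (0 : F)) (fderiv ℝ fun _ => (0 : F)) :=
    hasWeakFDerivOn_of_contDiffOn hΩ contDiffOn_const
  have : CompleteSpace F := FiniteDimensional.complete ℝ F
  refine ⟨Metric.ball p (r / 2), Metric.isOpen_ball, Metric.mem_ball_self (by positivity), ?_⟩
  filter_upwards [h2.unique h3 hΩ] with z hz hzU
  have hz1 : fderiv ℝ Φ (f z) = ContinuousLinearMap.id ℝ F - fderiv ℝ R (f z) := by
    have e1 : Φ =ᶠ[𝓝 (f z)] fun q => q - R q := by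
      filter_upwards [Metric.isOpen_ball.mem_nhds hzU] with q hq
      have : θ q = 1 := θ.one_of_mem_closedBall (Metric.ball_subset_closedBall hq)
      simp only [Φ, this, one_smul]
    have hd : DifferentiableAt ℝ R (f z) :=
      (hball (Metric.closedBall_subset_closedBall (by linarith)
        (Metric.ball_subset_closedBall hzU))).1.differentiableAt one_ne_zero
    rw [e1.fderiv_eq, fderiv_fun_sub differentiableAt_fun_id hd, fderiv_fun_id]
  simp only [hz1, ContinuousLinearMap.sub_comp, ContinuousLinearMap.id_comp] at hz
  simpa [sub_eq_zero] using hz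

end Constraint

/-! ### Extension of test functions along embeddings. -/

section Extension

variable {E H X Z : Type*} [NormedAddCommGroup E] [NormedSpace ℝ E] [TopologicalSpace H]
  {I : ModelWithCorners ℝ E H} [I.Boundaryless] [TopologicalSpace X] [ChartedSpace H X]
  [NormedAddCommGroup Z] [NormedSpace ℝ Z]

/-- `r` is, near `J x`, a left inverse of the restriction of `J` to `S`, when `X` is identified
with its model space through the chart at `x`. -/
def IsLeftInverseInChart (I : ModelWithCorners ℝ E H) (J : X → Z) (S : Set X) (x : X)
    (r : Z → E) : Prop :=
  ∀ᶠ ζ in 𝓝 (J x), ∀ x' ∈ S, J x' = ζ → x' ∈ (chartAt H x).source ∧ r ζ = extChartAt I x x'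

omit [I.Boundaryless] [NormedSpace ℝ Z] in
-- Near `J x` a point of `S` is recovered continuously from its image, so `S` carries the topology
-- induced by `J`. This reduces measurability of a map into `S` to that of its composition with `J`.
theorem exists_isOpen_preimage_of_leftInverse {J : X → Z} {S : Set X}
    (hr : ∀ x ∈ S, ∃ r : Z → E, ContinuousAt r (J x) ∧ IsLeftInverseInChart I J S x r)
    {O : Set X} (hO : IsOpen O) : ∃ O' : Set Z, IsOpen O' ∧ ∀ x ∈ S, J x ∈ O' ↔ x ∈ O := by
  have hloc : ∀ x ∈ S ∩ O, ∃ U : Set Z, IsOpen U ∧ J x ∈ U ∧ ∀ x' ∈ S, J x' ∈ U → x' ∈ O := by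
    rintro x ⟨hxS, hxO⟩
    obtain ⟨r, hrc, hr⟩ := hr x hxS
    have hx : r (J x) = extChartAt I x x := (hr.self_of_nhds x hxS rfl).2
    have h1 : ∀ᶠ ζ in 𝓝 (J x), (extChartAt I x).symm (r ζ) ∈ O := by
      have hc : ContinuousAt (fun ζ => (extChartAt I x).symm (r ζ)) (J x) :=
        ContinuousAt.comp (g := (extChartAt I x).symm)
          (by rw [hx]; exact continuousAt_extChartAt_symm x) hrc
      refine hc.eventually_mem (hO.mem_nhds ?_)
      rwa [hx, extChartAt_to_inv]
    obtain ⟨U, hU, hUo, hxU⟩ := mem_nhds_iff.1 (hr.and h1)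
    refine ⟨U, hUo, hxU, fun x' hx' hJ => ?_⟩
    have h2 := (hU hJ).1 x' hx' rfl
    have h3 : (extChartAt I x).symm (r (J x')) ∈ O := (hU hJ).2
    rwa [h2.2, (extChartAt I x).left_inv (by rw [extChartAt_source]; exact h2.1)] at h3
  choose! U hUo hxU hU using hloc
  refine ⟨⋃ x ∈ S ∩ O, U x, isOpen_biUnion hUo, fun x hx => ⟨fun h => ?_, fun h => ?_⟩⟩
  · obtain ⟨y, hy, hxy⟩ := mem_iUnion₂.1 h
    exact hU y hy x hx hxy
  · exact mem_biUnion (show x ∈ S ∩ O from ⟨hx, h⟩) (hxU x ⟨hx, h⟩)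

/-- A `C¹` function with compact support extends along an embedding of class `C¹`. -/
theorem exists_extension_of_leftInverse [FiniteDimensional ℝ Z] {J : X → Z} {S : Set X}
    (hJ : ContinuousOn J S)
    (hr : ∀ x ∈ S, ∃ r : Z → E, ContDiffAt ℝ 1 r (J x) ∧ IsLeftInverseInChart I J S x r)
    {f : X → ℝ} (hf : ContMDiff I 𝓘(ℝ, ℝ) 1 f) (hc : IsCompact (S ∩ tsupport f)) :
    ∃ G : Z → ℝ, ContDiff ℝ 1 G ∧ HasCompactSupport G ∧ ∀ x ∈ S, G (J x) = f x := by
  have hK : IsCompact (J '' (S ∩ tsupport f)) := hc.image_of_continuousOn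
    (hJ.mono inter_subset_left)
  -- The value at `ζ` is prescribed on the image of `S` and free elsewhere. This constraint is
  -- convex, so local extensions can be glued by a partition of unity.
  let t : Z → Set ℝ := fun ζ => {c | ∀ x ∈ S, J x = ζ → c = f x}
  have ht : ∀ ζ, Convex ℝ (t ζ) := by
    intro ζ c₁ h₁ c₂ h₂ a b _ _ hab x hx hxζ
    rw [h₁ x hx hxζ, h₂ x hx hxζ, ← add_smul, hab, one_smul]
  obtain ⟨G, hG⟩ := exists_contMDiffMap_forall_mem_convex_of_local (n := 1) 𝓘(ℝ, Z) ht
    fun p => by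
      by_cases hp : p ∈ J '' (S ∩ tsupport f)
      · obtain ⟨x, ⟨hxS, -⟩, rfl⟩ := hp
        obtain ⟨r, hrc, hr⟩ := hr x hxS
        have hx : r (J x) = extChartAt I x x := (hr.self_of_nhds x hxS rfl).2
        have h1 : ContDiffAt ℝ 1 (fun ζ => f ((extChartAt I x).symm (r ζ))) (J x) := by
          have h2 := (contMDiffAt_iff.1 (hf x)).2
          rw [I.range_eq_univ, contDiffWithinAt_univ] at h2
          exact ContDiffAt.comp (J x) (g := f ∘ (extChartAt I x).symm)
            (by rw [hx]; exact h2) hrc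
        refine ⟨_, (h1.eventually (by simp)).and hr, _, fun ζ hζ =>
          (contMDiffAt_iff_contDiffAt.2 hζ.1).contMDiffWithinAt, fun ζ hζ x' hx' hJx' => ?_⟩
        have h3 := hζ.2 x' hx' hJx'
        rw [h3.2, (extChartAt I x).left_inv (by rw [extChartAt_source]; exact h3.1)]
      -- Away from the compact image of `S ∩ tsupport f` the zero function is a local extension;
      -- compactness is what makes this work although `J '' S` need not be closed.
      · refine ⟨_, hK.isClosed.isOpen_compl.mem_nhds hp, fun _ => 0, contMDiffOn_const,
          fun ζ hζ x hx hJx => ?_⟩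
        by_contra hne
        refine hζ ⟨x, ⟨hx, subset_tsupport f (Ne.symm hne)⟩, hJx⟩
  obtain ⟨R, hR⟩ := hK.isBounded.subset_closedBall (0 : Z)
  -- The glued function need not have compact support. The cut-off is `1` on the image of the
  -- support of `f`, and elsewhere on `J '' S` the prescribed value is zero anyway.
  let θ : ContDiffBump (0 : Z) := ⟨max R 1, max R 1 + 1, by positivity, by linarith⟩
  refine ⟨fun ζ => θ ζ * G ζ, θ.contDiff.mul (contMDiff_iff_contDiff.1 G.contMDiff),
    θ.hasCompactSupport.mul_right, fun x hx => ?_⟩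
  have hGx : G (J x) = f x := hG (J x) x hx rfl
  dsimp only
  rw [hGx]
  by_cases hxf : x ∈ tsupport f
  · have h1 : θ (J x) = 1 := θ.one_of_mem_closedBall
      (Metric.closedBall_subset_closedBall (le_max_left R 1) (hR ⟨x, ⟨hx, hxf⟩, rfl⟩))
    rw [h1, one_mul]
  · rw [image_eq_zero_of_notMem_tsupport hxf, mul_zero]

/-- The identity `G ∘ J = f` holds on a neighbourhood of `x`, so it can be differentiated in the
chart at `x`. -/
theorem mfderiv_eq_fderiv_comp_of_extension {J : X → Z} {S : Set X} {f : X → ℝ} {G : Z → ℝ}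
    {x : X} (hS : S ∈ 𝓝 x) (hf : MDifferentiableAt I 𝓘(ℝ, ℝ) f x) (hG : ContDiff ℝ 1 G)
    (hGJ : ∀ x ∈ S, G (J x) = f x) {J' : E →L[ℝ] Z}
    (hJ : HasFDerivAt (fun ξ => J ((extChartAt I x).symm ξ)) J' (extChartAt I x x)) :
    (mfderiv I 𝓘(ℝ, ℝ) f x : E →L[ℝ] ℝ) = fderiv ℝ G (J x) ∘L J' := by
  have h1 : (mfderiv I 𝓘(ℝ, ℝ) f x : E →L[ℝ] ℝ) =
      fderiv ℝ (fun ξ => f ((extChartAt I x).symm ξ)) (extChartAt I x x) := by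
    have h0 : fderivWithin ℝ (writtenInExtChartAt I 𝓘(ℝ, ℝ) x f) (range I) (extChartAt I x x) =
        fderiv ℝ (fun ξ => f ((extChartAt I x).symm ξ)) (extChartAt I x x) := by
      rw [I.range_eq_univ, fderivWithin_univ]
      rfl
    exact hf.mfderiv.trans h0
  have h2 : (fun ξ => f ((extChartAt I x).symm ξ)) =ᶠ[𝓝 (extChartAt I x x)]
      fun ξ => G (J ((extChartAt I x).symm ξ)) := by
    have h3 : ∀ᶠ ξ in 𝓝 (extChartAt I x x), (extChartAt I x).symm ξ ∈ S :=
      (continuousAt_extChartAt_symm (I := I) x).eventually_mem (by rwa [extChartAt_to_inv])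
    filter_upwards [h3] with ξ hξ
    exact (hGJ _ hξ).symm
  rw [h1, h2.fderiv_eq]
  have h4 : HasFDerivAt G (fderiv ℝ G (J x)) (J ((extChartAt I x).symm (extChartAt I x x))) := by
    rw [extChartAt_to_inv]
    exact (hG.differentiable one_ne_zero _).hasFDerivAt
  exact (h4.comp (extChartAt I x x) hJ).fderiv

/-- The composition of a `C¹` function with compact support on a manifold `X` with a map `γ` is
weakly differentiable, provided that the composition of `γ` with an embedding of class `C¹` is
weakly differentiable. -/
theorem hasWeakFDerivOn_comp_of_embedding [FiniteDimensional ℝ Z] {J : X → Z} {S : Set X}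
    (hJ : ContinuousOn J S)
    (hr : ∀ x ∈ S, ∃ r : Z → E, ContDiffAt ℝ 1 r (J x) ∧ IsLeftInverseInChart I J S x r)
    {f : X → ℝ} (hf : ContMDiff I 𝓘(ℝ, ℝ) 1 f) (hc : IsCompact (S ∩ tsupport f))
    {m : ℕ} {Ω : Set (Euc m)} (hΩ : IsOpen Ω) {V : Euc m → Z} {V' : Euc m → Euc m →L[ℝ] Z}
    (hV : HasWeakFDerivOn Ω V V') {γ : Euc m → X} (hS : ∀ z ∈ Ω, S ∈ 𝓝 (γ z))
    (hγ : ∀ᵐ z ∂volume.restrict Ω, J (γ z) = V z)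
    {T : ∀ z, Euc m →L[ℝ] TangentSpace I (γ z)}
    (hT : ∀ᵐ z ∂volume.restrict Ω, ∃ J' : E →L[ℝ] Z,
      HasFDerivAt (fun ξ => J ((extChartAt I (γ z)).symm ξ)) J' (extChartAt I (γ z) (γ z)) ∧
        V' z = J' ∘L (T z : Euc m →L[ℝ] E)) :
    HasWeakFDerivOn Ω (fun z => f (γ z)) fun z =>
      (mfderiv I 𝓘(ℝ, ℝ) f (γ z) : TangentSpace I (γ z) →L[ℝ] ℝ) ∘L T z := by
  obtain ⟨G, hG, hGc, hGJ⟩ := exists_extension_of_leftInverse hJ hr hf hc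
  have hmem : ∀ᵐ z ∂volume.restrict Ω, z ∈ Ω := ae_restrict_mem hΩ.measurableSet
  refine (hV.comp_contDiff_of_hasCompactSupport hΩ hG hGc).congr_ae hΩ ?_ ?_
  · filter_upwards [hmem, hγ] with z hz h1
    rw [← h1, hGJ _ (mem_of_mem_nhds (hS z hz))]
  · filter_upwards [hmem, hγ, hT] with z hz h1 ⟨J', h2, h3⟩
    have h4 := mfderiv_eq_fderiv_comp_of_extension (hS z hz)
      (hf.mdifferentiable one_ne_zero (γ z)) hG hGJ h2
    rw [h3, ← h1]
    change _ = (mfderiv I 𝓘(ℝ, ℝ) f (γ z) : E →L[ℝ] ℝ) ∘L (T z : Euc m →L[ℝ] E)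
    rw [h4]
    rfl

end Extension

/-! ### Differentials of charts in the preferred coordinates. -/

section Charts

variable {m : ℕ} {M : Type*} [TopologicalSpace M] [ChartedSpace (Euc m) M]

/-- The differential of `ψ⁻¹` at `z`, expressed in the preferred chart at `ψ⁻¹ z`. -/
def invDeriv (ψ : OpenPartialHomeomorph M (Euc m)) (z : Euc m) : Euc m →L[ℝ] Euc m :=
  chartInvDeriv ψ z

/-- The differential of the chart `ψ` at `x`, expressed in the preferred chart at `x`. -/
def chartDeriv (ψ : OpenPartialHomeomorph M (Euc m)) (x : M) : Euc m →L[ℝ] Euc m :=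
  fderiv ℝ (fun w => ψ ((chartAt (Euc m) x).symm w)) (chartAt (Euc m) x x)

/-- The differential of `f : M → F` at `x`, expressed in the preferred chart at `x`. -/
def mapDeriv (m : ℕ) {M : Type*} [TopologicalSpace M] [ChartedSpace (Euc m) M]
    {F : Type*} [NormedAddCommGroup F] [NormedSpace ℝ F] (f : M → F) (x : M) :
    Euc m →L[ℝ] F :=
  fderiv ℝ (fun w => f ((chartAt (Euc m) x).symm w)) (chartAt (Euc m) x x)

theorem mfderiv_eq_mapDeriv {F : Type*} [NormedAddCommGroup F] [NormedSpace ℝ F] {f : M → F}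
    {x : M} (hf : MDifferentiableAt (𝓡 m) 𝓘(ℝ, F) f x) :
    (mfderiv (𝓡 m) 𝓘(ℝ, F) f x : Euc m →L[ℝ] F) = mapDeriv m f x := by
  have h0 : fderivWithin ℝ (writtenInExtChartAt (𝓡 m) 𝓘(ℝ, F) x f) (range (𝓡 m))
      (extChartAt (𝓡 m) x x) = mapDeriv m f x := by
    rw [(𝓡 m).range_eq_univ, fderivWithin_univ]
    rfl
  exact hf.mfderiv.trans h0

variable {ψ ψ' : OpenPartialHomeomorph M (Euc m)}

omit [ChartedSpace (Euc m) M] in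
theorem fderiv_symm_self {z : Euc m} (hz : z ∈ ψ.target) :
    fderiv ℝ (fun w => ψ (ψ.symm w)) z = ContinuousLinearMap.id ℝ (Euc m) := by
  have hev : (fun w => ψ (ψ.symm w)) =ᶠ[𝓝 z] fun w => w := by
    filter_upwards [ψ.open_target.mem_nhds hz] with w hw using ψ.right_inv hw
  rw [hev.fderiv_eq, fderiv_fun_id]

theorem contDiffAt_chart_trans (hψ : ψ ∈ IsManifold.maximalAtlas (𝓡 m) 2 M)
    (hψ' : ψ' ∈ IsManifold.maximalAtlas (𝓡 m) 2 M) {z : Euc m} (hz : z ∈ ψ.target)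
    (hz' : ψ.symm z ∈ ψ'.source) : ContDiffAt ℝ 2 (fun w => ψ' (ψ.symm w)) z := by
  have h1 := contMDiffAt_symm_of_mem_maximalAtlas hψ hz
  have h2 := contMDiffAt_of_mem_maximalAtlas hψ' hz'
  exact contMDiffAt_iff_contDiffAt.1 (h2.comp z h1)

theorem contDiffAt_comp_symm {F : Type*} [NormedAddCommGroup F] [NormedSpace ℝ F] {f : M → F}
    {k : ℕ∞ω} (hk : k ≤ 2) (hf : ContMDiff (𝓡 m) 𝓘(ℝ, F) k f)
    (hψ : ψ ∈ IsManifold.maximalAtlas (𝓡 m) 2 M) {z : Euc m} (hz : z ∈ ψ.target) :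
    ContDiffAt ℝ k (fun w => f (ψ.symm w)) z := by
  have h1 := (contMDiffAt_symm_of_mem_maximalAtlas hψ hz).of_le hk
  exact contMDiffAt_iff_contDiffAt.1 ((hf _).comp z h1)

theorem invDeriv_eq_fderiv (hψ : ψ ∈ IsManifold.maximalAtlas (𝓡 m) 2 M) {z : Euc m}
    (hz : z ∈ ψ.target) :
    invDeriv ψ z = fderiv ℝ (fun w => chartAt (Euc m) (ψ.symm z) (ψ.symm w)) z := by
  have hd : MDifferentiableAt (𝓡 m) (𝓡 m) ψ.symm z :=
    (contMDiffAt_symm_of_mem_maximalAtlas hψ hz).mdifferentiableAt (by simp)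
  have h0 : fderivWithin ℝ (writtenInExtChartAt (𝓡 m) (𝓡 m) z ψ.symm) (range (𝓡 m))
      (extChartAt (𝓡 m) z z) =
        fderiv ℝ (fun w => chartAt (Euc m) (ψ.symm z) (ψ.symm w)) z := by
    rw [(𝓡 m).range_eq_univ, fderivWithin_univ]
    rfl
  exact hd.mfderiv.trans h0

/-- The chain rule through the chart `ψ'`. -/
theorem fderiv_comp_symm_eq {F : Type*} [NormedAddCommGroup F] [NormedSpace ℝ F] {f : M → F}
    (hψ : ψ ∈ IsManifold.maximalAtlas (𝓡 m) 2 M) (hψ' : ψ' ∈ IsManifold.maximalAtlas (𝓡 m) 2 M)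
    {z : Euc m} (hz : z ∈ ψ.target) (hz' : ψ.symm z ∈ ψ'.source)
    (hf : DifferentiableAt ℝ (fun w => f (ψ'.symm w)) (ψ' (ψ.symm z))) :
    fderiv ℝ (fun w => f (ψ.symm w)) z =
      fderiv ℝ (fun w => f (ψ'.symm w)) (ψ' (ψ.symm z)) ∘L
        fderiv ℝ (fun w => ψ' (ψ.symm w)) z := by
  have hev : (fun w => f (ψ.symm w)) =ᶠ[𝓝 z]
      (fun w => f (ψ'.symm w)) ∘ fun w => ψ' (ψ.symm w) := by
    filter_upwards [(ψ.continuousAt_symm hz).eventually_mem (ψ'.open_source.mem_nhds hz')] with w hw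
    simp only [Function.comp_apply]
    rw [ψ'.left_inv hw]
  rw [hev.fderiv_eq, fderiv_comp z hf
    ((contDiffAt_chart_trans hψ hψ' hz hz').differentiableAt (by simp))]

variable [IsManifold (𝓡 m) 2 M]

theorem chartAt_mem_maximalAtlas_two (x : M) :
    chartAt (Euc m) x ∈ IsManifold.maximalAtlas (𝓡 m) 2 M :=
  IsManifold.chart_mem_maximalAtlas x

theorem invDeriv_trans (hψ : ψ ∈ IsManifold.maximalAtlas (𝓡 m) 2 M)
    (hψ' : ψ' ∈ IsManifold.maximalAtlas (𝓡 m) 2 M) {z : Euc m} (hz : z ∈ ψ.target)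
    (hz' : ψ.symm z ∈ ψ'.source) :
    invDeriv ψ z = invDeriv ψ' (ψ' (ψ.symm z)) ∘L fderiv ℝ (fun w => ψ' (ψ.symm w)) z := by
  rw [invDeriv_eq_fderiv hψ hz, invDeriv_eq_fderiv hψ' (ψ'.map_source hz'), ψ'.left_inv hz']
  refine fderiv_comp_symm_eq (f := chartAt (Euc m) (ψ.symm z)) hψ hψ' hz hz' ?_
  refine (contDiffAt_chart_trans hψ' (chartAt_mem_maximalAtlas_two _) (ψ'.map_source hz')
    ?_).differentiableAt (by simp)
  rw [ψ'.left_inv hz']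
  exact mem_chart_source _ _

theorem chartDeriv_comp_invDeriv (hψ : ψ ∈ IsManifold.maximalAtlas (𝓡 m) 2 M)
    (hψ' : ψ' ∈ IsManifold.maximalAtlas (𝓡 m) 2 M) {z : Euc m} (hz : z ∈ ψ.target)
    (hz' : ψ.symm z ∈ ψ'.source) :
    chartDeriv ψ' (ψ.symm z) ∘L invDeriv ψ z = fderiv ℝ (fun w => ψ' (ψ.symm w)) z := by
  rw [invDeriv_eq_fderiv hψ hz, chartDeriv]
  refine (fderiv_comp_symm_eq (f := ψ') hψ (chartAt_mem_maximalAtlas_two _) hz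
    (mem_chart_source _ _) ?_).symm
  refine (contDiffAt_chart_trans (chartAt_mem_maximalAtlas_two _) hψ' (mem_chart_target _ _)
    ?_).differentiableAt (by simp)
  rwa [(chartAt (Euc m) (ψ.symm z)).left_inv (mem_chart_source _ _)]

theorem chartDeriv_comp_invDeriv_self (hψ : ψ ∈ IsManifold.maximalAtlas (𝓡 m) 2 M) {z : Euc m}
    (hz : z ∈ ψ.target) :
    chartDeriv ψ (ψ.symm z) ∘L invDeriv ψ z = ContinuousLinearMap.id ℝ (Euc m) := by
  rw [chartDeriv_comp_invDeriv hψ hψ hz (ψ.map_target hz), fderiv_symm_self hz]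

/-- A one-sided inverse of an endomorphism of a finite-dimensional space is two-sided. -/
theorem invDeriv_comp_chartDeriv_self (hψ : ψ ∈ IsManifold.maximalAtlas (𝓡 m) 2 M) {x : M}
    (hx : x ∈ ψ.source) :
    invDeriv ψ (ψ x) ∘L chartDeriv ψ x = ContinuousLinearMap.id ℝ (Euc m) := by
  have h := chartDeriv_comp_invDeriv_self hψ (ψ.map_source hx)
  rw [ψ.left_inv hx] at h
  have h' : (chartDeriv ψ x : Euc m →ₗ[ℝ] Euc m) ∘ₗ (invDeriv ψ (ψ x) : Euc m →ₗ[ℝ] Euc m) =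
      LinearMap.id := by
    ext1 v; exact congrArg (fun A : Euc m →L[ℝ] Euc m => A v) h
  ext1 v
  exact congrArg (fun A : Euc m →ₗ[ℝ] Euc m => A v) ((LinearMap.comp_eq_id_comm _ _).1 h')

theorem invDeriv_chartAt_self (x : M) :
    invDeriv (chartAt (Euc m) x) (chartAt (Euc m) x x) = ContinuousLinearMap.id ℝ (Euc m) := by
  have h := invDeriv_eq_fderiv (chartAt_mem_maximalAtlas_two x) (mem_chart_target (Euc m) x)
  rw [(chartAt (Euc m) x).left_inv (mem_chart_source _ _)] at h
  rw [h, fderiv_symm_self (mem_chart_target _ _)]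

/-- The chain rule for `f ∘ ψ⁻¹`. -/
theorem mapDeriv_comp_invDeriv {F : Type*} [NormedAddCommGroup F] [NormedSpace ℝ F] {f : M → F}
    (hψ : ψ ∈ IsManifold.maximalAtlas (𝓡 m) 2 M) {z : Euc m} (hz : z ∈ ψ.target)
    (hf : ContMDiff (𝓡 m) 𝓘(ℝ, F) 1 f) :
    mapDeriv m f (ψ.symm z) ∘L invDeriv ψ z = fderiv ℝ (fun w => f (ψ.symm w)) z := by
  rw [invDeriv_eq_fderiv hψ hz, mapDeriv]
  refine (fderiv_comp_symm_eq (f := f) hψ (chartAt_mem_maximalAtlas_two _) hz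
    (mem_chart_source _ _) ?_).symm
  exact (contDiffAt_comp_symm (by norm_num) hf (chartAt_mem_maximalAtlas_two _)
    (mem_chart_target _ _)).differentiableAt (by simp)

end Charts

/-! ### Local left inverses of the embedding. -/

section IsometricEmbedding

variable {n ν : ℕ} {N : Type*} [TopologicalSpace N] [ChartedSpace (Euc n) N]
  [IsManifold (𝓡 n) 2 N] {gN : Metric n N} {ι : N → Euc ν}

theorem IsIsometricEmbedding.mfderiv_eq (hι : IsIsometricEmbedding gN ι) (y : N) :
    (mfderiv (𝓡 n) (𝓡 ν) ι y : Euc n →L[ℝ] Euc ν) = mapDeriv n ι y :=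
  mfderiv_eq_mapDeriv (hι.contMDiff.mdifferentiable (by simp) y)

theorem IsIsometricEmbedding.inner_mapDeriv (hι : IsIsometricEmbedding gN ι) (y : N)
    (v w : Euc n) : inner ℝ (mapDeriv n ι y v) (mapDeriv n ι y w) =
      (gN.inner y : Euc n →L[ℝ] Euc n →L[ℝ] ℝ) v w := by
  rw [← hι.mfderiv_eq]
  exact hι.isometric y v w

theorem IsIsometricEmbedding.mapDeriv_injective (hι : IsIsometricEmbedding gN ι) (y : N) :
    Function.Injective (mapDeriv n ι y) := by
  refine (injective_iff_map_eq_zero _).2 fun v hv => ?_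
  by_contra hne
  have h1 : (0 : ℝ) < (gN.inner y : Euc n →L[ℝ] Euc n →L[ℝ] ℝ) v v := gN.pos y v hne
  rw [← hι.inner_mapDeriv, hv, inner_zero_left] at h1
  exact lt_irrefl _ h1

/-- By the inverse function theorem, `ι` has local left inverses of class `C²`. -/
theorem IsIsometricEmbedding.exists_leftInverse (hι : IsIsometricEmbedding gN ι) (y : N) :
    ∃ r : Euc ν → Euc n, ContDiffAt ℝ 2 r (ι y) ∧ IsLeftInverseInChart (𝓡 n) ι univ y r := by
  set κ := chartAt (Euc n) y with hκ
  have hκy : κ.symm (κ y) = y := κ.left_inv (mem_chart_source _ _)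
  -- A linear left inverse `C` of `Dι(y)` brings the problem to equal dimensions: `C ∘ ι ∘ κ⁻¹` has
  -- the identity as derivative at `κ y`, and `r` is its local inverse precomposed with `C`.
  obtain ⟨C, hC⟩ := (mapDeriv n ι y : Euc n →ₗ[ℝ] Euc ν).exists_leftInverse_of_injective
    (LinearMap.ker_eq_bot.2 (hι.mapDeriv_injective y))
  let C' : Euc ν →L[ℝ] Euc n := LinearMap.toContinuousLinearMap C
  let j : Euc n → Euc ν := fun w => ι (κ.symm w)
  have hj : ContDiffAt ℝ 2 j (κ y) := contDiffAt_comp_symm le_rfl hι.contMDiff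
    (chartAt_mem_maximalAtlas_two y) (mem_chart_target _ _)
  let h : Euc n → Euc n := fun w => C' (j w)
  have hh : ContDiffAt ℝ 2 h (κ y) := C'.contDiff.contDiffAt.comp _ hj
  have hd : HasFDerivAt h ((ContinuousLinearEquiv.refl ℝ (Euc n) : Euc n ≃L[ℝ] Euc n) :
      Euc n →L[ℝ] Euc n) (κ y) := by
    have h1 := C'.hasFDerivAt.comp (κ y) (hj.differentiableAt (by simp)).hasFDerivAt
    have e : ((ContinuousLinearEquiv.refl ℝ (Euc n) : Euc n ≃L[ℝ] Euc n) : Euc n →L[ℝ] Euc n) =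
        C' ∘L fderiv ℝ j (κ y) := by
      ext1 v
      exact (congrArg (fun A : Euc n →ₗ[ℝ] Euc n => A v) hC).symm
    rw [e]
    exact h1
  let s : Euc n → Euc n := hh.localInverse hd (by simp)
  have hjy : j (κ y) = ι y := by simp only [j, hκy]
  have hs : ContDiffAt ℝ 2 s (h (κ y)) := hh.to_localInverse hd (by simp)
  have hsl : ∀ᶠ w in 𝓝 (κ y), s (h w) = w :=
    (hh.hasStrictFDerivAt' hd (by simp)).eventually_left_inverse
  refine ⟨fun q => s (C' q), ?_, ?_⟩
  · refine ContDiffAt.comp (ι y) (g := s) ?_ C'.contDiff.contDiffAt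
    rwa [← hjy]
  · have h2 : ∀ᶠ y' in 𝓝 y, y' ∈ κ.source ∧ s (C' (ι y')) = κ y' := by
      filter_upwards [κ.open_source.mem_nhds (mem_chart_source _ _),
        (κ.continuousAt (mem_chart_source _ _)).eventually hsl] with y' h1 h2
      refine ⟨h1, ?_⟩
      simpa only [h, j, κ.left_inv h1] using h2
    -- The embedding property enters here: it excludes points `y'` far from `y` in `N` with `ι y'`
    -- close to `ι y`, as an injective immersion could have.
    rw [hι.isEmbedding.nhds_eq_comap, eventually_comap] at h2
    filter_upwards [h2] with ζ hζ y' _ hy'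
    obtain ⟨h3, h4⟩ := hζ y' hy'
    exact ⟨h3, by rw [← hy']; exact h4⟩

end IsometricEmbedding

/-! ### Koszul forms under pullback of metrics. -/

section Koszul

variable {E E' : Type*} [NormedAddCommGroup E] [NormedSpace ℝ E] [NormedAddCommGroup E']
  [NormedSpace ℝ E']

theorem koszulForm_apply (G' : E →L[ℝ] E →L[ℝ] E →L[ℝ] ℝ) (a b c : E) :
    koszulForm G' a b c = 2⁻¹ * (G' a b c + G' b a c - G' c a b) := rfl

/-- The behaviour of the Koszul form under the pullback of a metric by a map of class `C²`. -/
theorem koszulForm_pullback {G : E → E →L[ℝ] E →L[ℝ] ℝ} {G₂ : E' → E' →L[ℝ] E' →L[ℝ] ℝ}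
    {h : E → E'} {z : E} (hh : ContDiffAt ℝ 2 h z) (hG₂ : ContDiffAt ℝ 1 G₂ (h z))
    (hsymm : ∀ p q, G₂ (h z) p q = G₂ (h z) q p)
    (hG : ∀ᶠ w in 𝓝 z, ∀ a b, G w a b = G₂ (h w) (fderiv ℝ h w a) (fderiv ℝ h w b)) :
    ContDiffAt ℝ 1 G z ∧ ∀ a b c, koszulForm (fderiv ℝ G z) a b c =
      koszulForm (fderiv ℝ G₂ (h z)) (fderiv ℝ h z a) (fderiv ℝ h z b) (fderiv ℝ h z c) +
        G₂ (h z) (fderiv ℝ (fderiv ℝ h) z a b) (fderiv ℝ h z c) := by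
  have hh1 : ContDiffAt ℝ 1 h z := hh.of_le (by norm_num)
  have hdh : ContDiffAt ℝ 1 (fderiv ℝ h) z := hh.fderiv_right (by norm_num)
  have hG₂h : ContDiffAt ℝ 1 (fun w => G₂ (h w)) z := hG₂.comp z hh1
  have hGe : G =ᶠ[𝓝 z] fun w => ((ContinuousLinearMap.compL ℝ E E' ℝ).flip (fderiv ℝ h w)) ∘L
      (G₂ (h w) ∘L fderiv ℝ h w) := by
    filter_upwards [hG] with w hw
    ext a b
    exact hw a b
  have hGd : ContDiffAt ℝ 1 G z := ContDiffAt.congr_of_eventuallyEq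
    (((ContinuousLinearMap.compL ℝ E E' ℝ).flip.contDiff.contDiffAt.comp z hdh).clm_comp
      (hG₂h.clm_comp hdh)) hGe
  -- By symmetry of `D²h`, of the six second-order terms in the Koszul combination four cancel and
  -- two coincide; the factor `½` leaves a single one.
  have hsy : ∀ a b, fderiv ℝ (fderiv ℝ h) z a b = fderiv ℝ (fderiv ℝ h) z b a := fun a b =>
    hh.isSymmSndFDerivAt (by simp) a b
  have hder : ∀ c a b, fderiv ℝ G z c a b =
      fderiv ℝ G₂ (h z) (fderiv ℝ h z c) (fderiv ℝ h z a) (fderiv ℝ h z b) +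
        G₂ (h z) (fderiv ℝ (fderiv ℝ h) z c a) (fderiv ℝ h z b) +
        G₂ (h z) (fderiv ℝ h z a) (fderiv ℝ (fderiv ℝ h) z c b) := by
    intro c a b
    have e1 : HasFDerivAt (fun w => G w a b) (((fderiv ℝ G z).flip a).flip b) z :=
      (((hGd.differentiableAt one_ne_zero).hasFDerivAt.clm_apply (hasFDerivAt_const a z)).clm_apply
        (hasFDerivAt_const b z)).congr_fderiv (by ext c; simp)
    have d1 := (hdh.differentiableAt one_ne_zero).hasFDerivAt
    have d2 : HasFDerivAt (fun w => G₂ (h w)) (fderiv ℝ G₂ (h z) ∘L fderiv ℝ h z) z :=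
      (hG₂.differentiableAt one_ne_zero).hasFDerivAt.comp z
        (hh1.differentiableAt one_ne_zero).hasFDerivAt
    have e2 := (d2.clm_apply (d1.clm_apply (hasFDerivAt_const a z))).clm_apply
      (d1.clm_apply (hasFDerivAt_const b z))
    have e3 := e2.congr_of_eventuallyEq (show (fun w => G w a b) =ᶠ[𝓝 z] _ by
      filter_upwards [hG] with w hw using hw a b)
    have e4 := congrArg (fun A : E →L[ℝ] ℝ => A c) (e1.unique e3)
    simp at e4
    rw [e4]
    ring
  refine ⟨hGd, fun a b c => ?_⟩
  rw [koszulForm_apply, koszulForm_apply, hder, hder, hder, hsy b a, hsy c a, hsy c b,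
    hsymm (fderiv ℝ h z b), hsymm (fderiv ℝ h z a)]
  ring

end Koszul

/-! ### Orthogonal projection onto the range of an injective linear map. -/

section NormalInverse

variable {n ν : ℕ}

theorem exists_continuousLinearEquiv_of_injective {E E' : Type*} [NormedAddCommGroup E]
    [NormedSpace ℝ E] [NormedAddCommGroup E'] [NormedSpace ℝ E'] [FiniteDimensional ℝ E]
    [FiniteDimensional ℝ E'] (h : Module.finrank ℝ E = Module.finrank ℝ E') {A : E →L[ℝ] E'}
    (hA : Function.Injective A) : ∃ e : E ≃L[ℝ] E', (e : E →L[ℝ] E') = A :=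
  ⟨((A : E →ₗ[ℝ] E').linearEquivOfInjective hA h).toContinuousLinearEquiv, by ext; rfl⟩

/-- The left inverse of an injective linear map which vanishes on the orthogonal complement of its
range. -/
def normalInv (B : Euc n →L[ℝ] Euc ν) : Euc ν →L[ℝ] Euc n :=
  (ContinuousLinearMap.adjoint B ∘L B).inverse ∘L ContinuousLinearMap.adjoint B

variable {B : Euc n →L[ℝ] Euc ν}

theorem exists_equiv_adjoint_comp_self (hB : Function.Injective B) :
    ∃ e : Euc n ≃L[ℝ] Euc n, (e : Euc n →L[ℝ] Euc n) = ContinuousLinearMap.adjoint B ∘L B := by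
  refine exists_continuousLinearEquiv_of_injective rfl ?_
  refine (injective_iff_map_eq_zero _).2 fun v hv => hB ?_
  have h1 : inner ℝ (B v) (B v) = 0 := by
    rw [← ContinuousLinearMap.adjoint_inner_left]
    have : ContinuousLinearMap.adjoint B (B v) = 0 := hv
    rw [this, inner_zero_left]
  rw [inner_self_eq_zero.1 h1, map_zero]

/-- These are the normal equations of least squares. -/
theorem adjoint_comp_normalInv (hB : Function.Injective B) (q : Euc ν) :
    ContinuousLinearMap.adjoint B (B (normalInv B q)) = ContinuousLinearMap.adjoint B q := by
  obtain ⟨e, he⟩ := exists_equiv_adjoint_comp_self hB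
  have h1 : normalInv B q = e.symm (ContinuousLinearMap.adjoint B q) := by
    rw [normalInv, ← he, ContinuousLinearMap.inverse_equiv]; rfl
  have h2 : ContinuousLinearMap.adjoint B (B (normalInv B q)) = e (normalInv B q) := by
    change (ContinuousLinearMap.adjoint B ∘L B) _ = (e : Euc n →L[ℝ] Euc n) _
    rw [he]
  rw [h2, h1, e.apply_symm_apply]

theorem inner_normalInv (hB : Function.Injective B) (q : Euc ν) (c : Euc n) :
    inner ℝ (B (normalInv B q)) (B c) = inner ℝ q (B c) := by
  rw [← ContinuousLinearMap.adjoint_inner_left, adjoint_comp_normalInv hB,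
    ContinuousLinearMap.adjoint_inner_left]

theorem normalInv_apply_self (hB : Function.Injective B) (v : Euc n) : normalInv B (B v) = v := by
  refine hB ?_
  have h : ∀ c, inner ℝ (B (normalInv B (B v)) - B v) (B c) = 0 := fun c => by
    rw [inner_sub_left, inner_normalInv hB, sub_self]
  rw [← sub_eq_zero, ← inner_self_eq_zero (𝕜 := ℝ)]
  nth_rewrite 2 [← map_sub]
  exact h _

theorem apply_normalInv_of_mem_range (hB : Function.Injective B) {q : Euc ν} (hq : q ∈ range B) :
    B (normalInv B q) = q := by
  obtain ⟨v, rfl⟩ := hq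
  rw [normalInv_apply_self hB]

theorem normalInv_eq_zero (hB : Function.Injective B) {q : Euc ν}
    (hq : ∀ c, inner ℝ q (B c) = 0) : normalInv B q = 0 := by
  refine hB ?_
  rw [map_zero, ← inner_self_eq_zero (𝕜 := ℝ), inner_normalInv hB, hq]

/-- An orthogonal projection is a contraction, by Cauchy–Schwarz of `q` against its own projection;
the final comparison of norms rests on this. -/
theorem norm_apply_normalInv_le (hB : Function.Injective B) (q : Euc ν) :
    ‖B (normalInv B q)‖ ≤ ‖q‖ := by
  have h1 := real_inner_le_norm q (B (normalInv B q))
  rw [← inner_normalInv hB, real_inner_self_eq_norm_mul_norm] at h1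
  rcases (norm_nonneg (B (normalInv B q))).eq_or_lt with h0 | h0
  · rw [← h0]; exact norm_nonneg q
  · exact le_of_mul_le_mul_right h1 h0

theorem continuousAt_normalInv (hB : Function.Injective B) :
    ContinuousAt (fun B : Euc n →L[ℝ] Euc ν => normalInv B) B := by
  obtain ⟨e, he⟩ := exists_equiv_adjoint_comp_self hB
  have h0 : Continuous fun B : Euc n →L[ℝ] Euc ν => ContinuousLinearMap.adjoint B :=
    (ContinuousLinearMap.adjoint (𝕜 := ℝ) (E := Euc n) (F := Euc ν)).continuous
  have h1 : Continuous fun B : Euc n →L[ℝ] Euc ν => ContinuousLinearMap.adjoint B ∘L B :=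
    h0.clm_comp continuous_id
  have h2 : ContinuousAt ContinuousLinearMap.inverse (ContinuousLinearMap.adjoint B ∘L B) := by
    rw [← he]
    exact (contDiffAt_map_inverse (n := 0) e).continuousAt
  exact (ContinuousAt.comp (f := fun B : Euc n →L[ℝ] Euc ν => ContinuousLinearMap.adjoint B ∘L B)
    h2 h1.continuousAt).clm_comp h0.continuousAt

/-- The orthogonal projection onto the range of `B` only depends on the range. -/
theorem comp_normalInv_comp_eq {B' : Euc n →L[ℝ] Euc ν} (hB : Function.Injective B)
    (hB' : Function.Injective B') (h : range B = range B') :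
    B ∘L normalInv B = B' ∘L normalInv B' := by
  ext1 q
  -- The difference of the two projections of `q` lies in the common range and is orthogonal to it.
  obtain ⟨v, hv⟩ : B (normalInv B q) - B' (normalInv B' q) ∈ range B := by
    obtain ⟨w, hw⟩ : B' (normalInv B' q) ∈ range B := h ▸ mem_range_self _
    exact ⟨normalInv B q - w, by rw [map_sub, hw]⟩
  obtain ⟨v', hv'⟩ : B v ∈ range B' := h ▸ mem_range_self _
  have h0 : inner ℝ (B v) (B v) = 0 := by
    nth_rewrite 1 [hv]
    rw [inner_sub_left, inner_normalInv hB, ← hv', inner_normalInv hB', sub_self]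
  have h1 : B v = 0 := inner_self_eq_zero.1 h0
  rw [h1] at hv
  exact sub_eq_zero.1 hv.symm

end NormalInverse

/-! ### Metrics and Christoffel symbols in charts. -/

section Metric

variable {m : ℕ} {M : Type*} [TopologicalSpace M] [ChartedSpace (Euc m) M]
  [IsManifold (𝓡 m) 2 M] {g : Metric m M} {ψ ψ' : OpenPartialHomeomorph M (Euc m)}

theorem metricInChart_apply (g : Metric m M) (ψ : OpenPartialHomeomorph M (Euc m)) (z a b : Euc m) :
    metricInChart g ψ z a b = (g.inner (ψ.symm z) : Euc m →L[ℝ] Euc m →L[ℝ] ℝ)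
      (invDeriv ψ z a) (invDeriv ψ z b) := rfl

theorem metricInChart_symm (g : Metric m M) (ψ : OpenPartialHomeomorph M (Euc m)) (z a b : Euc m) :
    metricInChart g ψ z a b = metricInChart g ψ z b a :=
  g.symm (ψ.symm z) _ _

theorem metricInChart_trans (hψ : ψ ∈ IsManifold.maximalAtlas (𝓡 m) 2 M)
    (hψ' : ψ' ∈ IsManifold.maximalAtlas (𝓡 m) 2 M) {z : Euc m} (hz : z ∈ ψ.target)
    (hz' : ψ.symm z ∈ ψ'.source) (a b : Euc m) :
    metricInChart g ψ z a b = metricInChart g ψ' (ψ' (ψ.symm z))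
      (fderiv ℝ (fun w => ψ' (ψ.symm w)) z a) (fderiv ℝ (fun w => ψ' (ψ.symm w)) z b) := by
  rw [metricInChart_apply, metricInChart_apply, invDeriv_trans hψ hψ' hz hz', ψ'.left_inv hz']
  rfl

theorem metricInChart_injective (hψ : ψ ∈ IsManifold.maximalAtlas (𝓡 m) 2 M) {z : Euc m}
    (hz : z ∈ ψ.target) : Function.Injective (metricInChart g ψ z) := by
  refine (injective_iff_map_eq_zero _).2 fun a ha => ?_
  have h1 : (g.inner (ψ.symm z) : Euc m →L[ℝ] Euc m →L[ℝ] ℝ) (invDeriv ψ z a)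
      (invDeriv ψ z a) = 0 := by
    rw [← metricInChart_apply, ha, zero_apply]
  have h2 : invDeriv ψ z a = 0 := by
    by_contra hne
    have h3 : (0 : ℝ) < (g.inner (ψ.symm z) : Euc m →L[ℝ] Euc m →L[ℝ] ℝ) (invDeriv ψ z a)
      (invDeriv ψ z a) := g.pos _ _ hne
    exact h3.ne' h1
  have h3 := congrArg (fun A : Euc m →L[ℝ] Euc m => A a) (chartDeriv_comp_invDeriv_self hψ hz)
  simp only [ContinuousLinearMap.comp_apply, h2, map_zero] at h3
  exact h3.symm

theorem exists_equiv_metricInChart (hψ : ψ ∈ IsManifold.maximalAtlas (𝓡 m) 2 M) {z : Euc m}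
    (hz : z ∈ ψ.target) : ∃ e : Euc m ≃L[ℝ] (Euc m →L[ℝ] ℝ),
      (e : Euc m →L[ℝ] Euc m →L[ℝ] ℝ) = metricInChart g ψ z := by
  refine exists_continuousLinearEquiv_of_injective ?_ (metricInChart_injective hψ hz)
  rw [← (LinearMap.toContinuousLinearMap (𝕜 := ℝ) (E := Euc m) (F' := ℝ)).finrank_eq]
  exact (Subspace.dual_finrank_eq (K := ℝ) (V := Euc m)).symm

/-- On the target of the chart the metric is nondegenerate, so `ContinuousLinearMap.inverse` is a
genuine inverse there and not its default value. -/
theorem metricInChart_christoffel (hψ : ψ ∈ IsManifold.maximalAtlas (𝓡 m) 2 M) {z : Euc m}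
    (hz : z ∈ ψ.target) (a b c : Euc m) :
    metricInChart g ψ z (christoffel g ψ z a b) c =
      koszulForm (fderiv ℝ (metricInChart g ψ) z) a b c := by
  obtain ⟨e, he⟩ := exists_equiv_metricInChart (g := g) hψ hz
  have h1 : christoffel g ψ z a b = e.symm (koszulForm (fderiv ℝ (metricInChart g ψ) z) a b) := by
    change (metricInChart g ψ z).inverse _ = _
    rw [← he, ContinuousLinearMap.inverse_equiv]
    rfl
  rw [h1, ← he]
  exact congrArg (fun A : Euc m →L[ℝ] ℝ => A c) (e.apply_symm_apply _)

theorem symmL_trivializationAt_eq {x₀ x : M} (hx : x ∈ (chartAt (Euc m) x₀).source) :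
    ((trivializationAt (Euc m) (TangentSpace (𝓡 m) : M → Type) x₀).symmL ℝ x :
      Euc m →L[ℝ] Euc m) = invDeriv (chartAt (Euc m) x₀) (chartAt (Euc m) x₀ x) := by
  have : IsManifold (𝓡 m) 1 M := IsManifold.of_le (n := 2) (by norm_num)
  refine (TangentBundle.symmL_trivializationAt (I := 𝓡 m) hx).trans ?_
  rw [(𝓡 m).range_eq_univ, mfderivWithin_univ]
  rfl

theorem continuousLinearMapAt_trivializationAt_eq {x₀ x : M}
    (hx : x ∈ (chartAt (Euc m) x₀).source) :
    ((trivializationAt (Euc m) (TangentSpace (𝓡 m) : M → Type) x₀).continuousLinearMapAt ℝ x :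
      Euc m →L[ℝ] Euc m) = chartDeriv (chartAt (Euc m) x₀) x := by
  have : IsManifold (𝓡 m) 1 M := IsManifold.of_le (n := 2) (by norm_num)
  refine (TangentBundle.continuousLinearMapAt_trivializationAt (I := 𝓡 m) hx).trans ?_
  exact mfderiv_eq_mapDeriv (f := chartAt (Euc m) x₀) (mdifferentiableAt_extChartAt hx)

/-- Regularity of `g` is stated in the trivializations of a bundle of bilinear forms; at `x` these
coordinates are exactly those of the metric in the preferred chart. -/
theorem contDiffAt_metricInChart_chartAt (g : Metric m M) (x : M) :
    ContDiffAt ℝ 1 (metricInChart g (chartAt (Euc m) x)) (chartAt (Euc m) x x) := by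
  have h1 := ((contMDiffAt_hom_bundle _).1 (g.contMDiff x)).2
  have hx := mem_chart_target (Euc m) x
  have h2 := contMDiffAt_symm_of_mem_maximalAtlas
    ((chartAt_mem_maximalAtlas_two (m := m) x)) hx
  have hxx : (chartAt (Euc m) x).symm (chartAt (Euc m) x x) = x :=
    (chartAt (Euc m) x).left_inv (mem_chart_source _ _)
  have h3 := contMDiffAt_iff_contDiffAt.1 (ContMDiffAt.comp_of_eq
    h1 (h2.of_le (by norm_num : (1 : ℕ∞ω) ≤ 2)) hxx)
  refine h3.congr_of_eventuallyEq ?_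
  filter_upwards [(chartAt (Euc m) x).open_target.mem_nhds hx] with w hw
  have hw' := (chartAt (Euc m) x).map_target hw
  ext a b
  refine Eq.trans ?_ (inCoordinates_apply_eq₂ ?_ ?_ ?_).symm
  · have e := symmL_trivializationAt_eq hw'
    rw [(chartAt (Euc m) x).right_inv hw] at e
    have ea := congrArg (fun A : Euc m →L[ℝ] Euc m => A a) e
    have eb := congrArg (fun A : Euc m →L[ℝ] Euc m => A b) e
    rw [metricInChart_apply, ← ea, ← eb]
    simp
    exact congrArg₂ (fun p q => g.inner ((chartAt (Euc m) x).symm w) p q)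
      (Bundle.Trivialization.symmL_apply _ hw' a) (Bundle.Trivialization.symmL_apply _ hw' b)
  · exact hw'
  · exact hw'
  · simp

theorem contDiffAt_metricInChart (hψ : ψ ∈ IsManifold.maximalAtlas (𝓡 m) 2 M) {z : Euc m}
    (hz : z ∈ ψ.target) : ContDiffAt ℝ 1 (metricInChart g ψ) z := by
  have hκ := chartAt_mem_maximalAtlas_two (m := m) (ψ.symm z)
  refine (koszulForm_pullback (contDiffAt_chart_trans hψ hκ hz (mem_chart_source _ _))
    (contDiffAt_metricInChart_chartAt g (ψ.symm z)) (metricInChart_symm g _ _) ?_).1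
  filter_upwards [ψ.open_target.mem_nhds hz, (ψ.continuousAt_symm hz).eventually_mem
    ((chartAt (Euc m) (ψ.symm z)).open_source.mem_nhds (mem_chart_source _ _))] with w h1 h2 a b
  exact metricInChart_trans hψ hκ h1 h2 a b

/-- The transformation law of the Christoffel symbols, between the chart `ψ` and the preferred
chart. -/
theorem fderiv_christoffel (hψ : ψ ∈ IsManifold.maximalAtlas (𝓡 m) 2 M) {z : Euc m}
    (hz : z ∈ ψ.target) (a b : Euc m) :
    invDeriv ψ z (christoffel g ψ z a b) =
      christoffelAt g (ψ.symm z) (invDeriv ψ z a) (invDeriv ψ z b) +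
        fderiv ℝ (fderiv ℝ fun w => chartAt (Euc m) (ψ.symm z) (ψ.symm w)) z a b := by
  have hκ := chartAt_mem_maximalAtlas_two (m := m) (ψ.symm z)
  have hev : ∀ᶠ w in 𝓝 z, ∀ a b, metricInChart g ψ w a b =
      metricInChart g (chartAt (Euc m) (ψ.symm z)) (chartAt (Euc m) (ψ.symm z) (ψ.symm w))
        (fderiv ℝ (fun w => chartAt (Euc m) (ψ.symm z) (ψ.symm w)) w a)
        (fderiv ℝ (fun w => chartAt (Euc m) (ψ.symm z) (ψ.symm w)) w b) := by
    filter_upwards [ψ.open_target.mem_nhds hz, (ψ.continuousAt_symm hz).eventually_mem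
      ((chartAt (Euc m) (ψ.symm z)).open_source.mem_nhds (mem_chart_source _ _))] with w h1 h2 a b
    exact metricInChart_trans hψ hκ h1 h2 a b
  have hK := (koszulForm_pullback (contDiffAt_chart_trans hψ hκ hz (mem_chart_source _ _))
    (contDiffAt_metricInChart_chartAt g (ψ.symm z)) (metricInChart_symm g _ _) hev).2
  rw [invDeriv_eq_fderiv hψ hz]
  -- By nondegeneracy it suffices to pair with vectors `c'`, all of which have the form `Dh c` for
  -- the change of charts `h`. Both sides then become Koszul forms related by `koszulForm_pullback`.
  refine metricInChart_injective (g := g) hκ (mem_chart_target _ _) ?_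
  ext1 c'
  obtain ⟨c, rfl⟩ : ∃ c, fderiv ℝ (fun w => chartAt (Euc m) (ψ.symm z) (ψ.symm w)) z c = c' := by
    refine ⟨chartDeriv ψ (ψ.symm z) c', ?_⟩
    rw [← invDeriv_eq_fderiv hψ hz]
    have h := invDeriv_comp_chartDeriv_self hψ (ψ.map_target hz)
    rw [ψ.right_inv hz] at h
    exact congrArg (fun A : Euc m →L[ℝ] Euc m => A c') h
  rw [← hev.self_of_nhds, metricInChart_christoffel hψ hz, hK, map_add, add_apply, christoffelAt,
    metricInChart_christoffel hκ (mem_chart_target _ _)]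

theorem continuousOn_christoffel (hψ : ψ ∈ IsManifold.maximalAtlas (𝓡 m) 2 M) :
    ContinuousOn (christoffel g ψ) ψ.target := by
  intro z hz
  refine ContinuousAt.continuousWithinAt ?_
  have hG := contDiffAt_metricInChart (g := g) hψ hz
  have hkos : Continuous (koszulForm (E := Euc m)) := by
    let A : (Euc m →L[ℝ] Euc m →L[ℝ] Euc m →L[ℝ] ℝ) →ₗ[ℝ] (Euc m →L[ℝ] Euc m →L[ℝ] Euc m →L[ℝ] ℝ) :=
      { toFun := koszulForm
        map_add' := fun p q => by ext a b c; simp [koszulForm_apply]; ring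
        map_smul' := fun r p => by ext a b c; simp [koszulForm_apply]; ring }
    exact A.continuous_of_finiteDimensional
  obtain ⟨e, he⟩ := exists_equiv_metricInChart (g := g) hψ hz
  have h2 : ContinuousAt ContinuousLinearMap.inverse (metricInChart g ψ z) := by
    rw [← he]
    exact (contDiffAt_map_inverse (n := 0) e).continuousAt
  have h3 : ContinuousAt (fun w => (metricInChart g ψ w).inverse) z := h2.comp hG.continuousAt
  exact (((ContinuousLinearMap.compL ℝ (Euc m) (Euc m →L[ℝ] ℝ) (Euc m)).continuous.continuousAt.comp
    h3)).clm_comp (hkos.continuousAt.comp (hG.continuousAt_fderiv one_ne_zero))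

end Metric

/-! ### The Gauss formula. -/

section SecondFundamentalForm

variable {n ν : ℕ} {N : Type*} [TopologicalSpace N] [ChartedSpace (Euc n) N]
  [IsManifold (𝓡 n) 2 N] {gN : Metric n N} {ι : N → Euc ν}

/-- The second derivative of `ι : N → ℝ^ν` at `y`, in the preferred chart at `y`. -/
def mapDeriv₂ (n : ℕ) {N : Type*} [TopologicalSpace N] [ChartedSpace (Euc n) N] {ν : ℕ}
    (ι : N → Euc ν) (y : N) : Euc n →L[ℝ] Euc n →L[ℝ] Euc ν :=
  fderiv ℝ (fderiv ℝ fun w => ι ((chartAt (Euc n) y).symm w)) (chartAt (Euc n) y y)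

/-- The second fundamental form of an isometric embedding takes its values in the normal space. -/
theorem IsIsometricEmbedding.inner_secondFundamentalForm (hι : IsIsometricEmbedding gN ι) (y : N)
    (a b c : Euc n) : inner ℝ (mapDeriv₂ n ι y a b - mapDeriv n ι y (christoffelAt gN y a b))
      (mapDeriv n ι y c) = 0 := by
  have hκ := chartAt_mem_maximalAtlas_two (m := n) y
  have hy : (chartAt (Euc n) y).symm (chartAt (Euc n) y y) = y :=
    (chartAt (Euc n) y).left_inv (mem_chart_source _ _)
  have hev : ∀ᶠ w in 𝓝 (chartAt (Euc n) y y), ∀ a b,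
      metricInChart gN (chartAt (Euc n) y) w a b = innerSL ℝ
        (fderiv ℝ (fun w => ι ((chartAt (Euc n) y).symm w)) w a)
        (fderiv ℝ (fun w => ι ((chartAt (Euc n) y).symm w)) w b) := by
    filter_upwards [(chartAt (Euc n) y).open_target.mem_nhds (mem_chart_target _ _)] with w hw a b
    rw [metricInChart_apply, ← hι.inner_mapDeriv,
      ← mapDeriv_comp_invDeriv hκ hw (hι.contMDiff.of_le (by norm_num))]
    rfl
  -- The metric of `N` is the pullback under `ι` of the constant Euclidean metric, whose Koszul form
  -- is zero. Only `⟨D²ι(a, b), Dι c⟩` survives, and it equals `⟨Dι Γ(a, b), Dι c⟩`.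
  have hK := (koszulForm_pullback (G₂ := fun _ : Euc ν => innerSL ℝ)
    (contDiffAt_comp_symm le_rfl hι.contMDiff hκ (mem_chart_target _ _)) contDiffAt_const
    (fun p q => by rw [innerSL_apply_apply, innerSL_apply_apply, real_inner_comm]) hev).2 a b c
  rw [← metricInChart_christoffel hκ (mem_chart_target _ _), hev.self_of_nhds] at hK
  simp only [fderiv_const_apply, koszulForm_apply, zero_apply, innerSL_apply_apply] at hK
  rw [inner_sub_left, sub_eq_zero]
  have h := hK.symm
  simp only [add_zero, sub_zero, mul_zero, zero_add] at h
  exact h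

end SecondFundamentalForm

/-! ### Tangency of the first and second weak derivatives of `ι ∘ u`. -/

section Retraction

variable {n ν : ℕ} {N : Type*} [TopologicalSpace N] [ChartedSpace (Euc n) N]
  [IsManifold (𝓡 n) 2 N] {gN : Metric n N} {ι : N → Euc ν}

/-- Globalizes `HasWeakFDerivOn.exists_ae_eq_fderiv_comp`: by second countability, countably many of
the neighbourhoods cover `S`, and their exceptional null sets can be united. As `R` depends on the
neighbourhood, `Q` records what must be remembered about it. -/
theorem HasWeakFDerivOn.ae_exists_eq_fderiv_comp {m : ℕ} {F : Type*} [NormedAddCommGroup F]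
    [NormedSpace ℝ F] [FiniteDimensional ℝ F] {Ω : Set (Euc m)} {f : Euc m → F}
    {f' : Euc m → Euc m →L[ℝ] F} (hf : HasWeakFDerivOn Ω f f') (hΩ : IsOpen Ω)
    {S : Set F} (hS : ∀ᵐ z ∂volume.restrict Ω, f z ∈ S) {Q : (F → F) → F → Prop}
    (h : ∀ p ∈ S, ∃ R : F → F, ContDiffAt ℝ 1 R p ∧ (∀ᶠ q in 𝓝 p, q ∈ S → R q = q) ∧
      ∀ᶠ q in 𝓝 p, q ∈ S → Q R q) :
    ∀ᵐ z ∂volume.restrict Ω, ∃ R, Q R (f z) ∧ f' z = fderiv ℝ R (f z) ∘L f' z := by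
  have hloc : ∀ p ∈ S, ∃ U : Set F, IsOpen U ∧ p ∈ U ∧ ∀ᵐ z ∂volume.restrict Ω, f z ∈ U →
      ∃ R, Q R (f z) ∧ f' z = fderiv ℝ R (f z) ∘L f' z := by
    intro p hp
    obtain ⟨R, h1, h2, h3⟩ := h p hp
    obtain ⟨U, hU, hpU, hae⟩ := hf.exists_ae_eq_fderiv_comp hΩ hS h1 h2
    obtain ⟨W, hW, hWo, hpW⟩ := mem_nhds_iff.1 h3
    refine ⟨U ∩ W, hU.inter hWo, ⟨hpU, hpW⟩, ?_⟩
    filter_upwards [hae, hS] with z h4 h5 h6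
    exact ⟨R, hW h6.2 h5, h4 h6.1⟩
  choose! U hUo hpU hU using hloc
  have : ProperSpace F := FiniteDimensional.proper ℝ F
  have : SecondCountableTopology F := secondCountable_of_proper
  obtain ⟨t, htS, htc, hcov⟩ := TopologicalSpace.countable_cover_nhdsWithin (s := S) (f := U)
    fun p hp => mem_nhdsWithin_of_mem_nhds ((hUo p hp).mem_nhds (hpU p hp))
  have hall := (ae_ball_iff htc).2 fun p hp => hU p (htS hp)
  filter_upwards [hall, hS] with z h1 h2
  obtain ⟨p, hp, hz⟩ := mem_iUnion₂.1 (hcov h2)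
  exact h1 p hp hz

/-- Near each of its points, the image of `ι` is the set of fixed points of a map of class `C²`. -/
theorem IsIsometricEmbedding.exists_retraction (hι : IsIsometricEmbedding gN ι) (y₀ : N) :
    ∃ A : Euc ν → Euc ν, ContDiffAt ℝ 2 A (ι y₀) ∧ ∀ᶠ q in 𝓝 (ι y₀), ∀ y, ι y = q →
      (∀ᶠ y' in 𝓝 y, A (ι y') = ι y') ∧
        ∀ v, fderiv ℝ A (ι y) v ∈ range (mapDeriv n ι y) := by
  obtain ⟨r, hr, hrι⟩ := hι.exists_leftInverse y₀
  set κ := chartAt (Euc n) y₀ with hκ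
  have hκm : κ ∈ IsManifold.maximalAtlas (𝓡 n) 2 N := chartAt_mem_maximalAtlas_two y₀
  have hry : r (ι y₀) = κ y₀ := (hrι.self_of_nhds y₀ (mem_univ _) rfl).2
  have hj : ∀ η ∈ κ.target, ContDiffAt ℝ 2 (fun w => ι (κ.symm w)) η := fun η hη =>
    contDiffAt_comp_symm le_rfl hι.contMDiff hκm hη
  -- `r` recovers coordinates on `N` from points of `ι(N)`; factoring through `ι ∘ κ⁻¹` forces the
  -- derivative to have tangent values.
  refine ⟨fun q => ι (κ.symm (r q)), ?_, ?_⟩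
  · exact ContDiffAt.comp (ι y₀) (g := fun w => ι (κ.symm w))
      (by rw [hry]; exact hj _ (mem_chart_target _ _)) hr
  · filter_upwards [hrι.eventually_nhds, hr.eventually (by simp)] with q h1 h2 y hy
    subst hy
    obtain ⟨hys, hry⟩ := h1.self_of_nhds y (mem_univ _) rfl
    refine ⟨?_, fun v => ?_⟩
    · filter_upwards [(hι.contMDiff.continuous.tendsto y).eventually h1] with y' hy'
      obtain ⟨h3, h4⟩ := hy' y' (mem_univ _) rfl
      rw [h4]
      exact congrArg ι (κ.left_inv h3)
    · have hry' : r (ι y) = κ y := hry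
      have h3 : fderiv ℝ (fun q => ι (κ.symm (r q))) (ι y) =
          fderiv ℝ (fun w => ι (κ.symm w)) (r (ι y)) ∘L fderiv ℝ r (ι y) :=
        fderiv_comp (ι y) (g := fun w => ι (κ.symm w))
          (by rw [hry']; exact (hj _ (κ.map_source hys)).differentiableAt (by simp))
          (h2.differentiableAt (by simp))
      have h4 := mapDeriv_comp_invDeriv hκm (κ.map_source hys)
        (hι.contMDiff.of_le (by norm_num : (1 : ℕ∞ω) ≤ 2))
      rw [κ.left_inv hys] at h4
      rw [h3, hry', ← h4]
      exact mem_range_self _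

/-- Obtained by differentiating `A ∘ ι = ι` once and twice along `N`. The second relation trades
`D²A` on tangent vectors for the second derivative of `ι`. -/
theorem IsIsometricEmbedding.fderiv_retraction (hι : IsIsometricEmbedding gN ι) {y : N}
    {A : Euc ν → Euc ν} (hA : ContDiffAt ℝ 2 A (ι y)) (hid : ∀ᶠ y' in 𝓝 y, A (ι y') = ι y') :
    (∀ a, fderiv ℝ A (ι y) (mapDeriv n ι y a) = mapDeriv n ι y a) ∧
      ∀ a b, fderiv ℝ (fderiv ℝ A) (ι y) (mapDeriv n ι y a) (mapDeriv n ι y b) +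
        fderiv ℝ A (ι y) (mapDeriv₂ n ι y a b) = mapDeriv₂ n ι y a b := by
  set κ := chartAt (Euc n) y with hκ
  have hκy : κ.symm (κ y) = y := κ.left_inv (mem_chart_source _ _)
  have hκt : κ y ∈ κ.target := mem_chart_target _ _
  let j : Euc n → Euc ν := fun w => ι (κ.symm w)
  have hj : ContDiffAt ℝ 2 j (κ y) := contDiffAt_comp_symm le_rfl hι.contMDiff
    (chartAt_mem_maximalAtlas_two y) hκt
  have hjy : j (κ y) = ι y := by simp only [j, hκy]
  have hAj : ContDiffAt ℝ 2 A (j (κ y)) := by rwa [hjy]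
  have h0 : ∀ᶠ w in 𝓝 (κ y), A (j w) = j w :=
    (κ.continuousAt_symm hκt).eventually (by rwa [hκy])
  have h1 : ∀ᶠ w in 𝓝 (κ y), fderiv ℝ A (j w) ∘L fderiv ℝ j w = fderiv ℝ j w := by
    filter_upwards [h0.eventually_nhds, hj.eventually (by simp),
      hj.continuousAt.eventually (hAj.eventually (by simp))] with w e1 e2 e3
    rw [← fderiv_comp w (e3.differentiableAt (by simp)) (e2.differentiableAt (by simp))]
    exact EventuallyEq.fderiv_eq e1
  have hB : mapDeriv n ι y = fderiv ℝ j (κ y) := rfl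
  refine ⟨fun a => ?_, fun a b => ?_⟩
  · rw [← hjy, hB]
    exact congrArg (fun A : Euc n →L[ℝ] Euc ν => A a) h1.self_of_nhds
  · have d1 : HasFDerivAt (fun w => fderiv ℝ A (j w)) (fderiv ℝ (fderiv ℝ A) (j (κ y)) ∘L
        fderiv ℝ j (κ y)) (κ y) :=
      ((hAj.fderiv_right (m := 1) (by norm_num)).differentiableAt (by simp)).hasFDerivAt.comp (κ y)
        (hj.differentiableAt (by simp)).hasFDerivAt
    have d2 : HasFDerivAt (fderiv ℝ j) (fderiv ℝ (fderiv ℝ j) (κ y)) (κ y) :=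
      ((hj.fderiv_right (m := 1) (by norm_num)).differentiableAt (by simp)).hasFDerivAt
    have d3 := d1.clm_apply (d2.clm_apply (hasFDerivAt_const b (κ y)))
    have d4 := (d2.clm_apply (hasFDerivAt_const b (κ y))).congr_of_eventuallyEq
      (f₁ := fun w => fderiv ℝ A (j w) (fderiv ℝ j w b)) (by
        filter_upwards [h1] with w hw
        exact congrArg (fun A : Euc n →L[ℝ] Euc ν => A b) hw)
    have d5 := congrArg (fun A : Euc n →L[ℝ] Euc ν => A a) (d3.unique d4)
    simp at d5
    rw [hjy] at d5
    rw [add_comm]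
    exact d5

/-- The weak derivative of `ι ∘ u` takes its values in the tangent space. -/
theorem IsIsometricEmbedding.ae_mem_range_mapDeriv (hι : IsIsometricEmbedding gN ι) {m : ℕ}
    {Ω : Set (Euc m)} (hΩ : IsOpen Ω) {u : Euc m → N} {w₁ : Euc m → Euc m →L[ℝ] Euc ν}
    (h₁ : HasWeakFDerivOn Ω (fun z => ι (u z)) w₁) :
    ∀ᵐ z ∂volume.restrict Ω, ∀ e, w₁ z e ∈ range (mapDeriv n ι (u z)) := by
  have h := h₁.ae_exists_eq_fderiv_comp hΩ (S := range ι)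
    (ae_of_all _ fun z => mem_range_self (u z))
    (Q := fun R q => ∀ y, ι y = q → ∀ v, fderiv ℝ R q v ∈ range (mapDeriv n ι y)) (by
      rintro _ ⟨y₀, rfl⟩
      obtain ⟨A, hA, hAι⟩ := hι.exists_retraction y₀
      refine ⟨A, hA.of_le (by norm_num), ?_, ?_⟩
      · filter_upwards [hAι] with q hq
        rintro ⟨y, rfl⟩
        exact (hq y rfl).1.self_of_nhds
      · filter_upwards [hAι] with q hq _ y hy
        subst hy
        exact (hq y rfl).2)
  filter_upwards [h] with z ⟨R, h2, h3⟩ e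
  rw [h3]
  exact h2 (u z) rfl _

/-- The second weak derivative of `ι ∘ u` is tangential, up to the second derivative of `ι`. -/
theorem IsIsometricEmbedding.ae_sub_mem_range_mapDeriv (hι : IsIsometricEmbedding gN ι) {m : ℕ}
    {Ω : Set (Euc m)} (hΩ : IsOpen Ω) {u : Euc m → N} {w₁ : Euc m → Euc m →L[ℝ] Euc ν}
    {w₂ : Euc m → Euc m →L[ℝ] Euc m →L[ℝ] Euc ν}
    (h₁ : HasWeakFDerivOn Ω (fun z => ι (u z)) w₁) (h₂ : HasWeakFDerivOn Ω w₁ w₂) :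
    ∀ᵐ z ∂volume.restrict Ω, ∀ e a, w₂ z e a - mapDeriv₂ n ι (u z)
      (normalInv (mapDeriv n ι (u z)) (w₁ z e)) (normalInv (mapDeriv n ι (u z)) (w₁ z a)) ∈
        range (mapDeriv n ι (u z)) := by
  -- The prolongation of `A` to first derivatives, of class `C¹` where `A` is `C²`. It fixes `(v,
  -- Dv)` almost everywhere, and its derivative applied to `(Dv, D²v)` yields `w₂ = D²A(w₁, w₁) + DA
  -- w₂`.
  let ret : (Euc ν → Euc ν) → Euc ν × (Euc m →L[ℝ] Euc ν) → Euc ν × (Euc m →L[ℝ] Euc ν) :=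
    fun A p => (A p.1, fderiv ℝ A p.1 ∘L p.2)
  have hr := hι.ae_mem_range_mapDeriv hΩ h₁
  have h := (h₁.prodMk h₂ hΩ).ae_exists_eq_fderiv_comp hΩ
    (S := {p | ∃ y, ι y = p.1 ∧ ∀ e, p.2 e ∈ range (mapDeriv n ι y)})
    (by filter_upwards [hr] with z hz using ⟨u z, rfl, hz⟩)
    (Q := fun R p => ∃ A, R = ret A ∧ ContDiffAt ℝ 2 A p.1 ∧ ∀ y, ι y = p.1 →
      (∀ᶠ y' in 𝓝 y, A (ι y') = ι y') ∧ ∀ v, fderiv ℝ A (ι y) v ∈ range (mapDeriv n ι y)) (by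
      rintro ⟨_, W₀⟩ ⟨y₀, rfl, -⟩
      obtain ⟨A, hA, hAι⟩ := hι.exists_retraction y₀
      have hev : ∀ᶠ p : Euc ν × (Euc m →L[ℝ] Euc ν) in 𝓝 (ι y₀, W₀), ContDiffAt ℝ 2 A p.1 ∧
          ∀ y, ι y = p.1 → (∀ᶠ y' in 𝓝 y, A (ι y') = ι y') ∧
            ∀ v, fderiv ℝ A (ι y) v ∈ range (mapDeriv n ι y) :=
        (continuous_fst.tendsto (ι y₀, W₀)).eventually ((hA.eventually (by simp)).and hAι)
      have hA' : ContDiffAt ℝ 1 (fderiv ℝ A) (ι y₀) := hA.fderiv_right (by norm_num)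
      refine ⟨ret A, ?_, ?_, ?_⟩
      · have e1 : ContDiffAt ℝ 1 (fun p : Euc ν × (Euc m →L[ℝ] Euc ν) => A p.1) (ι y₀, W₀) :=
          ContDiffAt.comp _ (g := A) (hA.of_le (by norm_num)) contDiffAt_fst
        have e2 : ContDiffAt ℝ 1 (fun p : Euc ν × (Euc m →L[ℝ] Euc ν) => fderiv ℝ A p.1)
            (ι y₀, W₀) := ContDiffAt.comp _ (g := fderiv ℝ A) hA' contDiffAt_fst
        exact e1.prodMk (e2.clm_comp contDiffAt_snd)
      · filter_upwards [hev] with p hp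
        rintro ⟨y, hy, hyr⟩
        obtain ⟨e1, e2⟩ := hp.2 y hy
        have e3 := (hι.fderiv_retraction (by rw [hy]; exact hp.1) e1).1
        refine Prod.ext ?_ ?_
        · change A p.1 = p.1
          rw [← hy]
          exact e1.self_of_nhds
        · change fderiv ℝ A p.1 ∘L p.2 = p.2
          ext1 e
          obtain ⟨v, hv⟩ := hyr e
          rw [ContinuousLinearMap.comp_apply, ← hv, ← hy, e3]
      · filter_upwards [hev] with p hp _
        exact ⟨A, rfl, hp⟩)
  filter_upwards [h, hr] with z ⟨R, ⟨A, hRA, hA, hAι⟩, h3⟩ h4 e a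
  obtain ⟨e1, e2⟩ := hAι (u z) rfl
  obtain ⟨e3, e4⟩ := hι.fderiv_retraction hA e1
  have hd : HasFDerivAt (fun p : Euc ν × (Euc m →L[ℝ] Euc ν) => fderiv ℝ A p.1 (p.2 a))
      _ (ι (u z), w₁ z) :=
    HasFDerivAt.clm_apply (HasFDerivAt.comp (ι (u z), w₁ z) (g := fderiv ℝ A)
      (((hA.fderiv_right (m := 1) (by norm_num)).differentiableAt (by simp)).hasFDerivAt)
      hasFDerivAt_fst) (hasFDerivAt_snd.clm_apply (hasFDerivAt_const a _))
  have hRd : DifferentiableAt ℝ (ret A) (ι (u z), w₁ z) := by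
    have d1 : DifferentiableAt ℝ (fun p : Euc ν × (Euc m →L[ℝ] Euc ν) => A p.1)
        (ι (u z), w₁ z) := DifferentiableAt.comp _ (g := A) (hA.differentiableAt (by simp))
          differentiableAt_fst
    have d2 : DifferentiableAt ℝ (fun p : Euc ν × (Euc m →L[ℝ] Euc ν) => fderiv ℝ A p.1)
        (ι (u z), w₁ z) := DifferentiableAt.comp _ (g := fderiv ℝ A)
          ((hA.fderiv_right (m := 1) (by norm_num)).differentiableAt (by simp))
          differentiableAt_fst
    exact d1.prodMk (d2.clm_comp differentiableAt_snd)
  have hd2 := (hRd.hasFDerivAt.snd.clm_apply (hasFDerivAt_const a _)).unique hd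
  have h5 := congrArg (fun B : Euc ν × (Euc m →L[ℝ] Euc ν) →L[ℝ] Euc ν => B (w₁ z e, w₂ z e)) hd2
  have h6 := congrArg (fun B : Euc m →L[ℝ] Euc ν × (Euc m →L[ℝ] Euc ν) => (B e).2 a) h3
  rw [hRA] at h6
  simp at h5 h6
  rw [← h6] at h5
  have hT : ∀ c, mapDeriv n ι (u z) (normalInv (mapDeriv n ι (u z)) (w₁ z c)) = w₁ z c := fun c =>
    apply_normalInv_of_mem_range (hι.mapDeriv_injective _) (h4 c)
  have h7 := e4 (normalInv (mapDeriv n ι (u z)) (w₁ z e)) (normalInv (mapDeriv n ι (u z)) (w₁ z a))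
  rw [hT, hT] at h7
  -- Subtracting `D²ι = D²A(Dι, Dι) + DA D²ι` from the relation for `w₂` eliminates `D²A`; what
  -- remains is `DA(w₂ - D²ι)`, in the range of `DA` and so tangent.
  rw [← h7, h5, add_comm (fderiv ℝ (fderiv ℝ A) _ _ _), add_sub_add_right_eq_sub, ← map_sub]
  exact e2 _

end Retraction

/-! ### Coordinates on `T*M ⊗ TN` and `T*M ⊗ T*M ⊗ TN`. -/

section TensorBundleCharts

variable {m n : ℕ} {M N : Type*} [TopologicalSpace M] [ChartedSpace (Euc m) M]
  [TopologicalSpace N] [ChartedSpace (Euc n) N]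

/-- The linear map which a point of `T*M ⊗ TN` represents, in the preferred charts. -/
def fibreMap (p : TensorBundle m n M N) : Euc m →L[ℝ] Euc n := p.2

/-- The bilinear map which a point of `T*M ⊗ T*M ⊗ TN` represents, in the preferred charts. -/
def fibreMap₂ (p : TensorBundle₂ m n M N) : Euc m →L[ℝ] Euc m →L[ℝ] Euc n := p.2

/-- The model of the manifold `T*M ⊗ T*M ⊗ TN`. -/
abbrev tensorModel₂ (m n : ℕ) :
    ModelWithCorners ℝ ((Euc m × Euc n) × (Euc m →L[ℝ] Euc m →L[ℝ] Euc n))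
      (ModelProd (ModelProd (Euc m) (Euc n)) (Euc m →L[ℝ] Euc m →L[ℝ] Euc n)) :=
  ((𝓡 m).prod (𝓡 n)).prod 𝓘(ℝ, Euc m →L[ℝ] Euc m →L[ℝ] Euc n)

/-- The expression in coordinates of a bilinear map, where `A` is the change of coordinates in the
codomain and `C` the inverse of that in the domain. -/
def bilinConj {E E' G G' : Type*} [NormedAddCommGroup E] [NormedSpace ℝ E] [NormedAddCommGroup E']
    [NormedSpace ℝ E'] [NormedAddCommGroup G] [NormedSpace ℝ G] [NormedAddCommGroup G']
    [NormedSpace ℝ G'] (A : G →L[ℝ] G') (B : E →L[ℝ] E →L[ℝ] G) (C : E' →L[ℝ] E) :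
    E' →L[ℝ] E' →L[ℝ] G' :=
  ContinuousLinearMap.compL ℝ E' G G' A ∘L (B.bilinearComp C C)

@[simp]
theorem bilinConj_apply {E E' G G' : Type*} [NormedAddCommGroup E] [NormedSpace ℝ E]
    [NormedAddCommGroup E'] [NormedSpace ℝ E'] [NormedAddCommGroup G] [NormedSpace ℝ G]
    [NormedAddCommGroup G'] [NormedSpace ℝ G'] (A : G →L[ℝ] G') (B : E →L[ℝ] E →L[ℝ] G)
    (C : E' →L[ℝ] E) (a b : E') : bilinConj A B C a b = A (B (C a) (C b)) := rfl

variable [IsManifold (𝓡 m) 2 M] [IsManifold (𝓡 n) 2 N]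

omit [IsManifold (𝓡 n) 2 N] in
-- The forward coordinate map of the pulled-back bundle is by definition that of `TM`; the inverse
-- is then identified by uniqueness of inverses.
theorem symmL_domTangent {q₀ q : M × N} (hq : q.1 ∈ (chartAt (Euc m) q₀.1).source) :
    ((trivializationAt (Euc m) (DomTangent m n : M × N → Type) q₀).symmL ℝ q :
      Euc m →L[ℝ] Euc m) = invDeriv (chartAt (Euc m) q₀.1) (chartAt (Euc m) q₀.1 q.1) := by
  have h1 : ((trivializationAt (Euc m) (DomTangent m n : M × N → Type) q₀).continuousLinearMapAt
      ℝ q : Euc m →L[ℝ] Euc m) = chartDeriv (chartAt (Euc m) q₀.1) q.1 := by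
    rw [← continuousLinearMapAt_trivializationAt_eq hq]
    rfl
  have hb : q ∈ (trivializationAt (Euc m) (DomTangent m n : M × N → Type) q₀).baseSet := hq
  ext1 v
  have h2 := chartDeriv_comp_invDeriv_self (chartAt_mem_maximalAtlas_two (m := m) q₀.1)
    ((chartAt (Euc m) q₀.1).map_source hq)
  rw [(chartAt (Euc m) q₀.1).left_inv hq, ← h1] at h2
  have h3 := (trivializationAt (Euc m) (DomTangent m n : M × N → Type)
    q₀).symmL_continuousLinearMapAt (R := ℝ) hb
    (invDeriv (chartAt (Euc m) q₀.1) (chartAt (Euc m) q₀.1 q.1) v)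
  have h4 := congrArg (fun A : Euc m →L[ℝ] Euc m => A v) h2
  refine Eq.trans ?_ h3
  exact congrArg ((trivializationAt (Euc m) (DomTangent m n : M × N → Type) q₀).symmL ℝ q)
    h4.symm

omit [IsManifold (𝓡 m) 2 M] in
theorem continuousLinearMapAt_codTangent {q₀ q : M × N}
    (hq : q.2 ∈ (chartAt (Euc n) q₀.2).source) :
    ((trivializationAt (Euc n) (CodTangent m n : M × N → Type) q₀).continuousLinearMapAt ℝ q :
      Euc n →L[ℝ] Euc n) = chartDeriv (chartAt (Euc n) q₀.2) q.2 := by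
  rw [← continuousLinearMapAt_trivializationAt_eq hq]
  rfl

theorem inCoordinates_tensorFibre {q₀ q : M × N} (hx : q.1 ∈ (chartAt (Euc m) q₀.1).source)
    (hy : q.2 ∈ (chartAt (Euc n) q₀.2).source) (L : TensorFibre m n q) :
    ContinuousLinearMap.inCoordinates (Euc m) (DomTangent m n : M × N → Type) (Euc n)
      (CodTangent m n : M × N → Type) q₀ q q₀ q L =
      chartDeriv (chartAt (Euc n) q₀.2) q.2 ∘L (L : Euc m →L[ℝ] Euc n) ∘L
        invDeriv (chartAt (Euc m) q₀.1) (chartAt (Euc m) q₀.1 q.1) := by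
  rw [ContinuousLinearMap.inCoordinates, ← symmL_domTangent (n := n) hx,
    ← continuousLinearMapAt_codTangent (m := m) hy]
  rfl

theorem mem_chartAt_source_tensorBundle {p₀ p : TensorBundle m n M N} :
    p ∈ (chartAt (ModelProd (ModelProd (Euc m) (Euc n)) (Euc m →L[ℝ] Euc n)) p₀).source ↔
      p.1.1 ∈ (chartAt (Euc m) p₀.1.1).source ∧ p.1.2 ∈ (chartAt (Euc n) p₀.1.2).source := by
  rw [FiberBundle.chartedSpace_chartAt]
  simp only [OpenPartialHomeomorph.trans_source, hom_trivializationAt_source, mem_inter_iff,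
    mem_preimage]
  refine ⟨fun h => h.2.1, fun h => ⟨h, ⟨h, trivial⟩⟩⟩

theorem extChartAt_tensorBundle {p₀ p : TensorBundle m n M N}
    (hx : p.1.1 ∈ (chartAt (Euc m) p₀.1.1).source)
    (hy : p.1.2 ∈ (chartAt (Euc n) p₀.1.2).source) :
    extChartAt (tensorModel m n) p₀ p =
      ((chartAt (Euc m) p₀.1.1 p.1.1, chartAt (Euc n) p₀.1.2 p.1.2),
        chartDeriv (chartAt (Euc n) p₀.1.2) p.1.2 ∘L fibreMap p ∘L
          invDeriv (chartAt (Euc m) p₀.1.1) (chartAt (Euc m) p₀.1.1 p.1.1)) := by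
  have h := hom_chart (𝕜 := ℝ) (HB := ModelProd (Euc m) (Euc n)) (F₁ := Euc m) (F₂ := Euc n)
    (E₁ := (DomTangent m n : M × N → Type)) (E₂ := (CodTangent m n : M × N → Type)) p₀ p
  have h1 : (extChartAt (tensorModel m n) p₀ p : (Euc m × Euc n) × (Euc m →L[ℝ] Euc n)) =
    chartAt (ModelProd (ModelProd (Euc m) (Euc n)) (Euc m →L[ℝ] Euc n)) p₀ p := rfl
  rw [h1, h]
  exact Prod.ext rfl (inCoordinates_tensorFibre hx hy p.2)

theorem mem_chartAt_source_tensorBundle₂ {p₀ p : TensorBundle₂ m n M N} :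
    p ∈ (chartAt (ModelProd (ModelProd (Euc m) (Euc n))
      (Euc m →L[ℝ] Euc m →L[ℝ] Euc n)) p₀).source ↔
      p.1.1 ∈ (chartAt (Euc m) p₀.1.1).source ∧ p.1.2 ∈ (chartAt (Euc n) p₀.1.2).source := by
  rw [FiberBundle.chartedSpace_chartAt]
  simp only [OpenPartialHomeomorph.trans_source, hom_trivializationAt_source, mem_inter_iff,
    mem_preimage]
  refine ⟨fun h => h.2.1, fun h => ⟨⟨h.1, h⟩, ⟨h, trivial⟩⟩⟩

theorem extChartAt_tensorBundle₂ {p₀ p : TensorBundle₂ m n M N}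
    (hx : p.1.1 ∈ (chartAt (Euc m) p₀.1.1).source)
    (hy : p.1.2 ∈ (chartAt (Euc n) p₀.1.2).source) :
    extChartAt (tensorModel₂ m n) p₀ p =
      ((chartAt (Euc m) p₀.1.1 p.1.1, chartAt (Euc n) p₀.1.2 p.1.2),
        bilinConj (chartDeriv (chartAt (Euc n) p₀.1.2) p.1.2) (fibreMap₂ p)
          (invDeriv (chartAt (Euc m) p₀.1.1) (chartAt (Euc m) p₀.1.1 p.1.1))) := by
  have h := hom_chart (𝕜 := ℝ) (HB := ModelProd (Euc m) (Euc n)) (F₁ := Euc m)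
    (F₂ := Euc m →L[ℝ] Euc n)
    (E₁ := (DomTangent m n : M × N → Type)) (E₂ := (TensorFibre m n : M × N → Type)) p₀ p
  have h1 : (extChartAt (tensorModel₂ m n) p₀ p :
      (Euc m × Euc n) × (Euc m →L[ℝ] Euc m →L[ℝ] Euc n)) =
    chartAt (ModelProd (ModelProd (Euc m) (Euc n)) (Euc m →L[ℝ] Euc m →L[ℝ] Euc n)) p₀ p := rfl
  rw [h1, h]
  refine Prod.ext rfl ?_
  ext1 a
  rw [ContinuousLinearMap.inCoordinates]
  have hb : p.1 ∈ (trivializationAt (Euc m →L[ℝ] Euc n) (TensorFibre m n : M × N → Type)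
    p₀.1).baseSet := ⟨hx, hy⟩
  have h2 : ∀ L : TensorFibre m n p.1, (trivializationAt (Euc m →L[ℝ] Euc n)
      (TensorFibre m n : M × N → Type) p₀.1).continuousLinearMapAt ℝ p.1 L =
      chartDeriv (chartAt (Euc n) p₀.1.2) p.1.2 ∘L (L : Euc m →L[ℝ] Euc n) ∘L
        invDeriv (chartAt (Euc m) p₀.1.1) (chartAt (Euc m) p₀.1.1 p.1.1) := by
    intro L
    rw [Bundle.Trivialization.continuousLinearMapAt_apply,
      Bundle.Trivialization.linearMapAt_apply, if_pos hb]
    exact inCoordinates_tensorFibre hx hy L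
  refine (h2 _).trans ?_
  have h3 := congrArg (fun A : Euc m →L[ℝ] Euc m => A a) (symmL_domTangent (n := n) hx)
  ext1 b
  have h4 : (p.2 ((trivializationAt (Euc m) (DomTangent m n : M × N → Type) p₀.1).symmL ℝ p.1 a) :
      Euc m →L[ℝ] Euc n) = fibreMap₂ p
        (invDeriv (chartAt (Euc m) p₀.1.1) (chartAt (Euc m) p₀.1.1 p.1.1) a) :=
    congrArg (fibreMap₂ p) h3
  exact congrArg (fun A : Euc m →L[ℝ] Euc n => chartDeriv (chartAt (Euc n) p₀.1.2) p.1.2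
    (A (invDeriv (chartAt (Euc m) p₀.1.1) (chartAt (Euc m) p₀.1.1 p.1.1) b))) h4

end TensorBundleCharts

/-! ### Euclidean embeddings of the tensor bundles and their local inverses. -/

section TensorEmbedding

variable {m n ν : ℕ} {M N : Type*} [TopologicalSpace M] [ChartedSpace (Euc m) M]
  [TopologicalSpace N] [ChartedSpace (Euc n) N]

/-- The map `(x, y, L) ↦ (ψ(x), ι(y), Dι(y) ∘ L ∘ Dψ(x)⁻¹)`. -/
def tensorEmb (ψ : OpenPartialHomeomorph M (Euc m)) (ι : N → Euc ν) (p : TensorBundle m n M N) :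
    Euc m × Euc ν × (Euc m →L[ℝ] Euc ν) :=
  (ψ p.1.1, ι p.1.2, mapDeriv n ι p.1.2 ∘L fibreMap p ∘L invDeriv ψ (ψ p.1.1))

/-- The map `(x, y, B) ↦ (ψ(x), ι(y), Dι(y) ∘ B ∘ (Dψ(x)⁻¹ × Dψ(x)⁻¹))`. -/
def tensorEmb₂ (ψ : OpenPartialHomeomorph M (Euc m)) (ι : N → Euc ν)
    (p : TensorBundle₂ m n M N) : Euc m × Euc ν × (Euc m →L[ℝ] Euc m →L[ℝ] Euc ν) :=
  (ψ p.1.1, ι p.1.2, bilinConj (mapDeriv n ι p.1.2) (fibreMap₂ p) (invDeriv ψ (ψ p.1.1)))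

variable [IsManifold (𝓡 m) 2 M] [IsManifold (𝓡 n) 2 N] {gN : Metric n N} {ι : N → Euc ν}
  {ψ : OpenPartialHomeomorph M (Euc m)}

omit [TopologicalSpace M] [ChartedSpace (Euc m) M] [IsManifold (𝓡 m) 2 M] in
-- `mapDeriv n ι y` refers to the chart at `y`, which may jump as `y` varies; this isolates the jump
-- in `chartDeriv`, leaving a factor continuous in `y`.
theorem IsIsometricEmbedding.mapDeriv_eq_comp_chartDeriv (hι : IsIsometricEmbedding gN ι)
    {y₀ y : N} (hy : y ∈ (chartAt (Euc n) y₀).source) :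
    mapDeriv n ι y = fderiv ℝ (fun w => ι ((chartAt (Euc n) y₀).symm w))
      (chartAt (Euc n) y₀ y) ∘L chartDeriv (chartAt (Euc n) y₀) y := by
  have h1 := mapDeriv_comp_invDeriv (chartAt_mem_maximalAtlas_two (m := n) y₀)
    ((chartAt (Euc n) y₀).map_source hy) (hι.contMDiff.of_le (by norm_num))
  rw [(chartAt (Euc n) y₀).left_inv hy] at h1
  rw [← h1, ContinuousLinearMap.comp_assoc,
    invDeriv_comp_chartDeriv_self (chartAt_mem_maximalAtlas_two (m := n) y₀) hy,
    ContinuousLinearMap.comp_id]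

/-- `ι` has local left inverses `r` of class `C²`, and `Dr` is then a left inverse of `Dι`. -/
theorem IsIsometricEmbedding.exists_leftInverse_fderiv (hι : IsIsometricEmbedding gN ι) (y₀ : N) :
    ∃ r : Euc ν → Euc n, ContDiffAt ℝ 2 r (ι y₀) ∧ ∀ᶠ ζ in 𝓝 (ι y₀), ∀ y, ι y = ζ →
      y ∈ (chartAt (Euc n) y₀).source ∧ r ζ = chartAt (Euc n) y₀ y ∧
        fderiv ℝ r ζ ∘L mapDeriv n ι y = chartDeriv (chartAt (Euc n) y₀) y := by
  obtain ⟨r, hr, hl⟩ := hι.exists_leftInverse y₀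
  refine ⟨r, hr, ?_⟩
  filter_upwards [hl.eventually_nhds, hr.eventually (by simp)] with ζ h1 h2 y hy
  subst hy
  have h3 := h1.self_of_nhds y trivial rfl
  refine ⟨h3.1, h3.2, ?_⟩
  set κ := chartAt (Euc n) y
  have hκ : κ.symm (κ y) = y := κ.left_inv (mem_chart_source _ _)
  have hc : ContinuousAt (fun w => ι (κ.symm w)) (κ y) :=
    ContinuousAt.comp (g := ι) hι.contMDiff.continuous.continuousAt
      (κ.continuousAt_symm (mem_chart_target _ _))
  have h4 : (fun w => chartAt (Euc n) y₀ (κ.symm w)) =ᶠ[𝓝 (κ y)] fun w => r (ι (κ.symm w)) := by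
    have h5 : Tendsto (fun w => ι (κ.symm w)) (𝓝 (κ y)) (𝓝 (ι y)) := by
      have := hc.tendsto
      rwa [hκ] at this
    filter_upwards [h5.eventually h1] with w hw
    exact (hw _ trivial rfl).2.symm
  rw [chartDeriv, h4.fderiv_eq, mapDeriv]
  have h6 := fderiv_comp (κ y) (g := r) (f := fun w => ι (κ.symm w))
    (by rw [hκ]; exact h2.differentiableAt (by simp))
    ((contDiffAt_comp_symm le_rfl hι.contMDiff (chartAt_mem_maximalAtlas_two (m := n) y)
      (mem_chart_target _ _)).differentiableAt (by simp))
  rw [hκ] at h6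
  exact h6.symm

/-- The inverse of `tensorEmb`, in coordinates. -/
theorem exists_leftInverse_tensorEmb (hι : IsIsometricEmbedding gN ι)
    (hψ : ψ ∈ IsManifold.maximalAtlas (𝓡 m) 2 M) {S : Set (TensorBundle m n M N)}
    (hS : ∀ p ∈ S, p.1.1 ∈ ψ.source) {p₀ : TensorBundle m n M N} (hp₀ : p₀ ∈ S) :
    ∃ r, ContDiffAt ℝ 1 r (tensorEmb ψ ι p₀) ∧
      IsLeftInverseInChart (tensorModel m n) (tensorEmb ψ ι) S p₀ r := by
  obtain ⟨r, hr, hl⟩ := hι.exists_leftInverse_fderiv p₀.1.2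
  set κ := chartAt (Euc m) p₀.1.1 with hκ
  have hκa : κ ∈ IsManifold.maximalAtlas (𝓡 m) 2 M := chartAt_mem_maximalAtlas_two _
  have hx₀ := hS p₀ hp₀
  have hxs : ψ.symm (ψ p₀.1.1) = p₀.1.1 := ψ.left_inv hx₀
  have hxκ : κ.symm (κ p₀.1.1) = p₀.1.1 := κ.left_inv (mem_chart_source _ _)
  have hσ : ContDiffAt ℝ 2 (fun w => κ (ψ.symm w)) (ψ p₀.1.1) :=
    contDiffAt_chart_trans hψ hκa (ψ.map_source hx₀) (by rw [hxs]; exact mem_chart_source _ _)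
  have hτ : ContDiffAt ℝ 2 (fun w => ψ (κ.symm w)) (κ p₀.1.1) :=
    contDiffAt_chart_trans hκa hψ (mem_chart_target _ _) (by rwa [hxκ])
  -- On the fibre, `Dr` undoes `Dι` and the derivative of the change of charts undoes `Dψ⁻¹`. Since
  -- `r` and the changes of charts are `C²`, this formula is `C¹`.
  refine ⟨fun ζ => ((κ (ψ.symm ζ.1), r ζ.2.1), fderiv ℝ r ζ.2.1 ∘L ζ.2.2 ∘L
    fderiv ℝ (fun w => ψ (κ.symm w)) (κ (ψ.symm ζ.1))), ?_, ?_⟩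
  · have h1 : ContDiffAt ℝ 1 (fun ζ : Euc m × Euc ν × (Euc m →L[ℝ] Euc ν) => κ (ψ.symm ζ.1))
        (tensorEmb ψ ι p₀) :=
      ContDiffAt.comp (tensorEmb ψ ι p₀) (g := fun w => κ (ψ.symm w)) (hσ.of_le one_le_two)
        contDiffAt_fst
    have h2 : ContDiffAt ℝ 1 (fun ζ : Euc m × Euc ν × (Euc m →L[ℝ] Euc ν) => r ζ.2.1)
        (tensorEmb ψ ι p₀) :=
      (hr.of_le one_le_two).comp (tensorEmb ψ ι p₀) (contDiffAt_fst.comp _ contDiffAt_snd)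
    have h3 : ContDiffAt ℝ 1 (fun ζ : Euc m × Euc ν × (Euc m →L[ℝ] Euc ν) => fderiv ℝ r ζ.2.1)
        (tensorEmb ψ ι p₀) :=
      (hr.fderiv_right (m := 1) (by norm_num)).comp (tensorEmb ψ ι p₀)
        (contDiffAt_fst.comp _ contDiffAt_snd)
    have h4 : ContDiffAt ℝ 1 (fun ζ : Euc m × Euc ν × (Euc m →L[ℝ] Euc ν) =>
        fderiv ℝ (fun w => ψ (κ.symm w)) (κ (ψ.symm ζ.1))) (tensorEmb ψ ι p₀) := by
      refine ContDiffAt.comp (tensorEmb ψ ι p₀) (g := fderiv ℝ (fun w => ψ (κ.symm w))) ?_ h1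
      have : κ (ψ.symm (tensorEmb ψ ι p₀).1) = κ p₀.1.1 := congrArg κ hxs
      rw [this]
      exact hτ.fderiv_right (m := 1) (by norm_num)
    have h5 : ContDiffAt ℝ 1 (fun ζ : Euc m × Euc ν × (Euc m →L[ℝ] Euc ν) => ζ.2.2)
        (tensorEmb ψ ι p₀) := contDiffAt_snd.comp _ contDiffAt_snd
    exact (h1.prodMk h2).prodMk (h3.clm_comp (h5.clm_comp h4))
  · have e1 : ∀ᶠ ζ : Euc m × Euc ν × (Euc m →L[ℝ] Euc ν) in 𝓝 (tensorEmb ψ ι p₀),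
        ψ.symm ζ.1 ∈ κ.source := by
      have : ContinuousAt (fun ζ : Euc m × Euc ν × (Euc m →L[ℝ] Euc ν) => ψ.symm ζ.1)
          (tensorEmb ψ ι p₀) :=
        ContinuousAt.comp (g := ψ.symm) (ψ.continuousAt_symm (ψ.map_source hx₀)) continuousAt_fst
      refine this.eventually_mem (κ.open_source.mem_nhds ?_)
      have : ψ.symm (tensorEmb ψ ι p₀).1 = p₀.1.1 := hxs
      rw [this]
      exact mem_chart_source _ _
    have ht : Tendsto (fun ζ : Euc m × Euc ν × (Euc m →L[ℝ] Euc ν) => ζ.2.1)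
        (𝓝 (tensorEmb ψ ι p₀)) (𝓝 (ι p₀.1.2)) := (continuous_fst.comp continuous_snd).continuousAt
    have e2 : ∀ᶠ ζ : Euc m × Euc ν × (Euc m →L[ℝ] Euc ν) in 𝓝 (tensorEmb ψ ι p₀),
        ∀ y, ι y = ζ.2.1 → y ∈ (chartAt (Euc n) p₀.1.2).source ∧
          r ζ.2.1 = chartAt (Euc n) p₀.1.2 y ∧
          fderiv ℝ r ζ.2.1 ∘L mapDeriv n ι y = chartDeriv (chartAt (Euc n) p₀.1.2) y :=
      ht.eventually hl
    filter_upwards [e1, e2] with ζ h1 h2 p hp hpζ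
    subst hpζ
    have hx := hS p hp
    obtain ⟨hy, hry, hDr⟩ := h2 p.1.2 rfl
    have hxx : ψ.symm (ψ p.1.1) = p.1.1 := ψ.left_inv hx
    have hxκ : p.1.1 ∈ κ.source := by
      have : ψ.symm (tensorEmb ψ ι p).1 = p.1.1 := hxx
      rwa [this] at h1
    refine ⟨mem_chartAt_source_tensorBundle.2 ⟨hxκ, hy⟩, ?_⟩
    rw [extChartAt_tensorBundle hxκ hy]
    have h3 := invDeriv_trans hκa hψ (κ.map_source hxκ) (by rwa [κ.left_inv hxκ])
    rw [κ.left_inv hxκ] at h3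
    refine Prod.ext (Prod.ext (congrArg κ hxx) hry) ?_
    change fderiv ℝ r (ι p.1.2) ∘L (mapDeriv n ι p.1.2 ∘L fibreMap p ∘L invDeriv ψ (ψ p.1.1)) ∘L
      fderiv ℝ (fun w => ψ (κ.symm w)) (κ (ψ.symm (ψ p.1.1))) = _
    rw [hxx, ← hκ, h3, ← hDr]
    rfl

theorem bilinConj_eq_comp {E E' G G' : Type*} [NormedAddCommGroup E] [NormedSpace ℝ E]
    [NormedAddCommGroup E'] [NormedSpace ℝ E'] [NormedAddCommGroup G] [NormedSpace ℝ G]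
    [NormedAddCommGroup G'] [NormedSpace ℝ G'] (A : G →L[ℝ] G') (B : E →L[ℝ] E →L[ℝ] G)
    (C : E' →L[ℝ] E) : bilinConj A B C = (ContinuousLinearMap.compL ℝ E' G G' A) ∘L
      ((ContinuousLinearMap.compL ℝ E' E G).flip C) ∘L B ∘L C := rfl

theorem bilinConj_bilinConj {E E' E'' G G' G'' : Type*} [NormedAddCommGroup E] [NormedSpace ℝ E]
    [NormedAddCommGroup E'] [NormedSpace ℝ E'] [NormedAddCommGroup E''] [NormedSpace ℝ E'']
    [NormedAddCommGroup G] [NormedSpace ℝ G] [NormedAddCommGroup G'] [NormedSpace ℝ G']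
    [NormedAddCommGroup G''] [NormedSpace ℝ G''] (A' : G' →L[ℝ] G'') (A : G →L[ℝ] G')
    (B : E →L[ℝ] E →L[ℝ] G) (C : E' →L[ℝ] E) (C' : E'' →L[ℝ] E') :
    bilinConj A' (bilinConj A B C) C' = bilinConj (A' ∘L A) B (C ∘L C') := rfl

theorem continuous_bilinConj {E E' G G' : Type*} [NormedAddCommGroup E] [NormedSpace ℝ E]
    [NormedAddCommGroup E'] [NormedSpace ℝ E'] [NormedAddCommGroup G] [NormedSpace ℝ G]
    [NormedAddCommGroup G'] [NormedSpace ℝ G'] :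
    Continuous fun q : (G →L[ℝ] G') × (E →L[ℝ] E →L[ℝ] G) × (E' →L[ℝ] E) =>
      bilinConj q.1 q.2.1 q.2.2 := by
  simp only [bilinConj_eq_comp]
  fun_prop

/-- The inverse of `tensorEmb₂`, in coordinates. -/
theorem exists_leftInverse_tensorEmb₂ (hι : IsIsometricEmbedding gN ι)
    (hψ : ψ ∈ IsManifold.maximalAtlas (𝓡 m) 2 M) {S : Set (TensorBundle₂ m n M N)}
    (hS : ∀ p ∈ S, p.1.1 ∈ ψ.source) {p₀ : TensorBundle₂ m n M N} (hp₀ : p₀ ∈ S) :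
    ∃ r, ContinuousAt r (tensorEmb₂ ψ ι p₀) ∧
      IsLeftInverseInChart (tensorModel₂ m n) (tensorEmb₂ ψ ι) S p₀ r := by
  obtain ⟨r, hr, hl⟩ := hι.exists_leftInverse_fderiv p₀.1.2
  set κ := chartAt (Euc m) p₀.1.1 with hκ
  have hκa : κ ∈ IsManifold.maximalAtlas (𝓡 m) 2 M := chartAt_mem_maximalAtlas_two _
  have hx₀ := hS p₀ hp₀
  have hxs : ψ.symm (ψ p₀.1.1) = p₀.1.1 := ψ.left_inv hx₀
  have hxκ : κ.symm (κ p₀.1.1) = p₀.1.1 := κ.left_inv (mem_chart_source _ _)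
  have hσ : ContDiffAt ℝ 2 (fun w => κ (ψ.symm w)) (ψ p₀.1.1) :=
    contDiffAt_chart_trans hψ hκa (ψ.map_source hx₀) (by rw [hxs]; exact mem_chart_source _ _)
  have hτ : ContDiffAt ℝ 2 (fun w => ψ (κ.symm w)) (κ p₀.1.1) :=
    contDiffAt_chart_trans hκa hψ (mem_chart_target _ _) (by rwa [hxκ])
  -- Continuity is enough here: this second embedding only serves to prove measurability of `D`.
  refine ⟨fun ζ => ((κ (ψ.symm ζ.1), r ζ.2.1), bilinConj (fderiv ℝ r ζ.2.1) ζ.2.2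
    (fderiv ℝ (fun w => ψ (κ.symm w)) (κ (ψ.symm ζ.1)))), ?_, ?_⟩
  · have h1 : ContinuousAt (fun ζ : Euc m × Euc ν × (Euc m →L[ℝ] Euc m →L[ℝ] Euc ν) =>
        κ (ψ.symm ζ.1)) (tensorEmb₂ ψ ι p₀) :=
      ContinuousAt.comp (g := fun w => κ (ψ.symm w)) hσ.continuousAt continuousAt_fst
    have h0 : ContinuousAt (fun ζ : Euc m × Euc ν × (Euc m →L[ℝ] Euc m →L[ℝ] Euc ν) => ζ.2.1)
        (tensorEmb₂ ψ ι p₀) := (continuous_fst.comp continuous_snd).continuousAt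
    have h2 : ContinuousAt (fun ζ : Euc m × Euc ν × (Euc m →L[ℝ] Euc m →L[ℝ] Euc ν) => r ζ.2.1)
        (tensorEmb₂ ψ ι p₀) := ContinuousAt.comp (g := r) hr.continuousAt h0
    have h3 : ContinuousAt (fun ζ : Euc m × Euc ν × (Euc m →L[ℝ] Euc m →L[ℝ] Euc ν) =>
        fderiv ℝ r ζ.2.1) (tensorEmb₂ ψ ι p₀) :=
      ContinuousAt.comp (g := fderiv ℝ r)
        (hr.fderiv_right (m := 1) (by norm_num)).continuousAt h0
    have h4 : ContinuousAt (fun ζ : Euc m × Euc ν × (Euc m →L[ℝ] Euc m →L[ℝ] Euc ν) =>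
        fderiv ℝ (fun w => ψ (κ.symm w)) (κ (ψ.symm ζ.1))) (tensorEmb₂ ψ ι p₀) := by
      refine ContinuousAt.comp (g := fderiv ℝ (fun w => ψ (κ.symm w))) ?_ h1
      have : κ (ψ.symm (tensorEmb₂ ψ ι p₀).1) = κ p₀.1.1 := congrArg κ hxs
      rw [this]
      exact (hτ.fderiv_right (m := 1) (by norm_num)).continuousAt
    have h5 : ContinuousAt (fun ζ : Euc m × Euc ν × (Euc m →L[ℝ] Euc m →L[ℝ] Euc ν) => ζ.2.2)
        (tensorEmb₂ ψ ι p₀) := (continuous_snd.comp continuous_snd).continuousAt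
    exact (h1.prodMk h2).prodMk
      (continuous_bilinConj.continuousAt.comp (h3.prodMk (h5.prodMk h4)))
  · have e1 : ∀ᶠ ζ : Euc m × Euc ν × (Euc m →L[ℝ] Euc m →L[ℝ] Euc ν) in 𝓝 (tensorEmb₂ ψ ι p₀),
        ψ.symm ζ.1 ∈ κ.source := by
      have : ContinuousAt (fun ζ : Euc m × Euc ν × (Euc m →L[ℝ] Euc m →L[ℝ] Euc ν) => ψ.symm ζ.1)
          (tensorEmb₂ ψ ι p₀) :=
        ContinuousAt.comp (g := ψ.symm) (ψ.continuousAt_symm (ψ.map_source hx₀)) continuousAt_fst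
      refine this.eventually_mem (κ.open_source.mem_nhds ?_)
      have : ψ.symm (tensorEmb₂ ψ ι p₀).1 = p₀.1.1 := hxs
      rw [this]
      exact mem_chart_source _ _
    have ht : Tendsto (fun ζ : Euc m × Euc ν × (Euc m →L[ℝ] Euc m →L[ℝ] Euc ν) => ζ.2.1)
        (𝓝 (tensorEmb₂ ψ ι p₀)) (𝓝 (ι p₀.1.2)) := (continuous_fst.comp continuous_snd).continuousAt
    have e2 : ∀ᶠ ζ : Euc m × Euc ν × (Euc m →L[ℝ] Euc m →L[ℝ] Euc ν) in 𝓝 (tensorEmb₂ ψ ι p₀),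
        ∀ y, ι y = ζ.2.1 → y ∈ (chartAt (Euc n) p₀.1.2).source ∧
          r ζ.2.1 = chartAt (Euc n) p₀.1.2 y ∧
          fderiv ℝ r ζ.2.1 ∘L mapDeriv n ι y = chartDeriv (chartAt (Euc n) p₀.1.2) y :=
      ht.eventually hl
    filter_upwards [e1, e2] with ζ h1 h2 p hp hpζ
    subst hpζ
    have hx := hS p hp
    obtain ⟨hy, hry, hDr⟩ := h2 p.1.2 rfl
    have hxx : ψ.symm (ψ p.1.1) = p.1.1 := ψ.left_inv hx
    have hxκ : p.1.1 ∈ κ.source := by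
      have : ψ.symm (tensorEmb₂ ψ ι p).1 = p.1.1 := hxx
      rwa [this] at h1
    refine ⟨mem_chartAt_source_tensorBundle₂.2 ⟨hxκ, hy⟩, ?_⟩
    rw [extChartAt_tensorBundle₂ hxκ hy]
    have h3 := invDeriv_trans hκa hψ (κ.map_source hxκ) (by rwa [κ.left_inv hxκ])
    rw [κ.left_inv hxκ] at h3
    refine Prod.ext (Prod.ext (congrArg κ hxx) hry) ?_
    have h4 : ∀ x', x' = p.1.1 → bilinConj (fderiv ℝ r (ι p.1.2))
        (bilinConj (mapDeriv n ι p.1.2) (fibreMap₂ p) (invDeriv ψ (ψ p.1.1)))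
        (fderiv ℝ (fun w => ψ (κ.symm w)) (κ x')) =
        bilinConj (chartDeriv (chartAt (Euc n) p₀.1.2) p.1.2) (fibreMap₂ p)
          (invDeriv κ (κ p.1.1)) := by
      rintro _ rfl
      have h5 : fderiv ℝ r (ι p.1.2) ∘L mapDeriv n ι p.1.2 =
        chartDeriv (chartAt (Euc n) p₀.1.2) p.1.2 := hDr
      rw [bilinConj_bilinConj, h5, ← h3]
    exact h4 _ hxx

end TensorEmbedding

/-! ### The derivative of the embedding of `T*M ⊗ TN`. -/

section TensorEmbeddingDeriv

variable {m n ν : ℕ} {M N : Type*} [TopologicalSpace M] [ChartedSpace (Euc m) M]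
  [TopologicalSpace N] [ChartedSpace (Euc n) N] [IsManifold (𝓡 m) 2 M] [IsManifold (𝓡 n) 2 N]
  {gM : Metric m M} {gN : Metric n N} {ι : N → Euc ν} {ψ : OpenPartialHomeomorph M (Euc m)}

/-- The map `tensorEmb` in the preferred chart at `p₀`. -/
theorem tensorEmb_eq_chart (hι : IsIsometricEmbedding gN ι)
    (hψ : ψ ∈ IsManifold.maximalAtlas (𝓡 m) 2 M) {p₀ p : TensorBundle m n M N}
    (hx : p.1.1 ∈ (chartAt (Euc m) p₀.1.1).source) (hxψ : p.1.1 ∈ ψ.source)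
    (hy : p.1.2 ∈ (chartAt (Euc n) p₀.1.2).source)
    {q : (Euc m × Euc n) × (Euc m →L[ℝ] Euc n)} (hq : extChartAt (tensorModel m n) p₀ p = q) :
    tensorEmb ψ ι p = (ψ ((chartAt (Euc m) p₀.1.1).symm q.1.1),
      ι ((chartAt (Euc n) p₀.1.2).symm q.1.2),
      fderiv ℝ (fun w => ι ((chartAt (Euc n) p₀.1.2).symm w)) q.1.2 ∘L q.2 ∘L
        fderiv ℝ (fun w => chartAt (Euc m) p₀.1.1 (ψ.symm w))
          (ψ ((chartAt (Euc m) p₀.1.1).symm q.1.1))) := by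
  rw [extChartAt_tensorBundle hx hy] at hq
  subst hq
  have h1 := invDeriv_trans hψ (chartAt_mem_maximalAtlas_two (m := m) p₀.1.1)
    (ψ.map_source hxψ) (by rwa [ψ.left_inv hxψ])
  rw [ψ.left_inv hxψ] at h1
  dsimp only
  rw [(chartAt (Euc m) p₀.1.1).left_inv hx, (chartAt (Euc n) p₀.1.2).left_inv hy, tensorEmb,
    hι.mapDeriv_eq_comp_chartDeriv hy, h1]
  rfl

/-- The derivative of `tensorEmb` in the preferred chart. -/
theorem exists_hasFDerivAt_tensorEmb (hι : IsIsometricEmbedding gN ι)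
    (hψ : ψ ∈ IsManifold.maximalAtlas (𝓡 m) 2 M) {p : TensorBundle m n M N} {z : Euc m}
    (hz : z ∈ ψ.target) (hpz : p.1.1 = ψ.symm z) :
    ∃ J' : (Euc m × Euc n) × (Euc m →L[ℝ] Euc n) →L[ℝ] Euc m × Euc ν × (Euc m →L[ℝ] Euc ν),
      HasFDerivAt (fun ξ => tensorEmb ψ ι ((extChartAt (tensorModel m n) p).symm ξ)) J'
        (extChartAt (tensorModel m n) p p) ∧
      ∀ e η ℓ a, (J' ((invDeriv ψ z e, η), ℓ)).1 = e ∧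
        (J' ((invDeriv ψ z e, η), ℓ)).2.1 = mapDeriv n ι p.1.2 η ∧
        (J' ((invDeriv ψ z e, η), ℓ)).2.2 a =
          mapDeriv₂ n ι p.1.2 η (fibreMap p (invDeriv ψ z a)) +
          mapDeriv n ι p.1.2 (ℓ (invDeriv ψ z a)) +
          mapDeriv n ι p.1.2 (fibreMap p
            (fderiv ℝ (fderiv ℝ fun w => chartAt (Euc m) (ψ.symm z) (ψ.symm w)) z e a)) := by
  obtain ⟨⟨x, y⟩, L⟩ := p
  obtain rfl : x = ψ.symm z := hpz
  set p : TensorBundle m n M N := ⟨(ψ.symm z, y), L⟩ with hp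
  set κ := chartAt (Euc m) (ψ.symm z) with hκ
  set κ' := chartAt (Euc n) y with hκ'
  have hκa : κ ∈ IsManifold.maximalAtlas (𝓡 m) 2 M := chartAt_mem_maximalAtlas_two _
  have hκa' : κ' ∈ IsManifold.maximalAtlas (𝓡 n) 2 N := chartAt_mem_maximalAtlas_two _
  have hxκ : ψ.symm z ∈ κ.source := mem_chart_source _ _
  have hyκ : y ∈ κ'.source := mem_chart_source _ _
  have hx : κ.symm (κ (ψ.symm z)) = ψ.symm z := κ.left_inv hxκ
  have hq : extChartAt (tensorModel m n) p p = ((κ (ψ.symm z), κ' y), fibreMap p) := by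
    rw [extChartAt_tensorBundle (mem_chart_source _ _) (mem_chart_source _ _)]
    refine Prod.ext rfl ?_
    have h1 : chartDeriv κ' y = ContinuousLinearMap.id ℝ (Euc n) :=
      fderiv_symm_self (κ'.map_source hyκ)
    change chartDeriv κ' y ∘L fibreMap p ∘L invDeriv κ (κ (ψ.symm z)) = fibreMap p
    rw [h1, invDeriv_chartAt_self, ContinuousLinearMap.comp_id, ContinuousLinearMap.id_comp]
  set q₀ : (Euc m × Euc n) × (Euc m →L[ℝ] Euc n) := ((κ (ψ.symm z), κ' y), fibreMap p) with hq₀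
  have hτ : HasFDerivAt (fun w => ψ (κ.symm w)) (chartDeriv ψ (ψ.symm z)) (κ (ψ.symm z)) :=
    ((contDiffAt_chart_trans hκa hψ (κ.map_source hxκ)
      (by rw [hx]; exact ψ.map_target hz)).differentiableAt (by simp)).hasFDerivAt
  have hσ : ContDiffAt ℝ 2 (fun w => κ (ψ.symm w)) z := contDiffAt_chart_trans hψ hκa hz hxκ
  have hj : ContDiffAt ℝ 2 (fun w => ι (κ'.symm w)) (κ' y) :=
    contDiffAt_comp_symm le_rfl hι.contMDiff hκa' (κ'.map_source hyκ)
  have hj1 : HasFDerivAt (fun w => ι (κ'.symm w)) (mapDeriv n ι y) (κ' y) :=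
    (hj.differentiableAt (by simp)).hasFDerivAt
  have hj2 : HasFDerivAt (fderiv ℝ fun w => ι (κ'.symm w)) (mapDeriv₂ n ι y) (κ' y) :=
    ((hj.fderiv_right (m := 1) (by norm_num)).differentiableAt (by simp)).hasFDerivAt
  have hτz : ψ (κ.symm (κ (ψ.symm z))) = z := by rw [hx, ψ.right_inv hz]
  have hσ2 : HasFDerivAt (fderiv ℝ fun w => κ (ψ.symm w))
      (fderiv ℝ (fderiv ℝ fun w => κ (ψ.symm w)) z) (ψ (κ.symm (κ (ψ.symm z)))) := by
    rw [hτz]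
    exact ((hσ.fderiv_right (m := 1) (by norm_num)).differentiableAt (by simp)).hasFDerivAt
  have hfst : HasFDerivAt (fun q : (Euc m × Euc n) × (Euc m →L[ℝ] Euc n) => q.1.1)
      (ContinuousLinearMap.fst ℝ (Euc m) (Euc n) ∘L ContinuousLinearMap.fst ℝ (Euc m × Euc n)
        (Euc m →L[ℝ] Euc n)) q₀ := hasFDerivAt_fst.comp q₀ hasFDerivAt_fst
  have hsnd : HasFDerivAt (fun q : (Euc m × Euc n) × (Euc m →L[ℝ] Euc n) => q.1.2)
      (ContinuousLinearMap.snd ℝ (Euc m) (Euc n) ∘L ContinuousLinearMap.fst ℝ (Euc m × Euc n)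
        (Euc m →L[ℝ] Euc n)) q₀ := hasFDerivAt_snd.comp q₀ hasFDerivAt_fst
  have hlast : HasFDerivAt (fun q : (Euc m × Euc n) × (Euc m →L[ℝ] Euc n) => q.2)
      (ContinuousLinearMap.snd ℝ (Euc m × Euc n) (Euc m →L[ℝ] Euc n)) q₀ := hasFDerivAt_snd
  have hτ' := HasFDerivAt.comp q₀ (g := fun w => ψ (κ.symm w)) hτ hfst
  have hj1' := HasFDerivAt.comp q₀ (g := fun w => ι (κ'.symm w)) hj1 hsnd
  have hj2' := HasFDerivAt.comp q₀ (g := fderiv ℝ fun w => ι (κ'.symm w)) hj2 hsnd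
  have hσ2' := HasFDerivAt.comp q₀ (g := fderiv ℝ fun w => κ (ψ.symm w)) hσ2 hτ'
  -- In the chart at `p` the last component is `Dj(y) ∘ L ∘ Dσ(τ(x))` with `j = ι ∘ κ'⁻¹`, `σ = κ ∘
  -- ψ⁻¹`, `τ = ψ ∘ κ⁻¹`. The product rule gives three terms; the one with `D²σ` accounts for the
  -- change of `Γ^M` between the charts.
  have hF := hτ'.prodMk (hj1'.prodMk (hj2'.clm_comp (hlast.clm_comp hσ2')))
  have hev : (fun ξ => tensorEmb ψ ι ((extChartAt (tensorModel m n) p).symm ξ)) =ᶠ[𝓝 q₀]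
      fun q => (ψ (κ.symm q.1.1), ι (κ'.symm q.1.2),
        fderiv ℝ (fun w => ι (κ'.symm w)) q.1.2 ∘L q.2 ∘L
          fderiv ℝ (fun w => κ (ψ.symm w)) (ψ (κ.symm q.1.1))) := by
    have h1 : ∀ᶠ ξ in 𝓝 q₀, ξ ∈ (extChartAt (tensorModel m n) p).target := by
      rw [← hq]
      exact extChartAt_target_mem_nhds p
    have h2 : ∀ᶠ ξ in 𝓝 q₀, ((extChartAt (tensorModel m n) p).symm ξ).1.1 ∈ ψ.source := by
      have h3 : ContinuousAt (fun ξ => ((extChartAt (tensorModel m n) p).symm ξ).1.1) q₀ := by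
        rw [← hq]
        exact continuous_fst.continuousAt.comp
          (ContinuousAt.comp
            (g := (Bundle.TotalSpace.proj : TensorBundle m n M N → M × N))
            (FiberBundle.continuous_proj _ _).continuousAt (continuousAt_extChartAt_symm p))
      refine h3.eventually_mem (ψ.open_source.mem_nhds ?_)
      rw [← hq, extChartAt_to_inv]
      exact ψ.map_target hz
    filter_upwards [h1, h2] with ξ h1 h2
    have h3 := (extChartAt (tensorModel m n) p).map_target h1
    rw [extChartAt_source] at h3
    obtain ⟨h4, h5⟩ := mem_chartAt_source_tensorBundle.1 h3
    exact tensorEmb_eq_chart hι hψ h4 h2 h5 ((extChartAt (tensorModel m n) p).right_inv h1)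
  rw [hq]
  refine ⟨_, HasFDerivAt.congr_of_eventuallyEq hF hev, fun e η ℓ a => ?_⟩
  have h1 := congrArg (fun A : Euc m →L[ℝ] Euc m => A e) (chartDeriv_comp_invDeriv_self hψ hz)
  have h1' : chartDeriv ψ (ψ.symm z) (invDeriv ψ z e) = e := h1
  have h2 : fderiv ℝ (fun w => κ (ψ.symm w)) (ψ (κ.symm (κ (ψ.symm z)))) = invDeriv ψ z := by
    rw [hτz, invDeriv_eq_fderiv hψ hz]
  refine ⟨h1', rfl, ?_⟩
  change mapDeriv n ι y (fibreMap p (fderiv ℝ (fderiv ℝ fun w => κ (ψ.symm w)) z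
      (chartDeriv ψ (ψ.symm z) (invDeriv ψ z e)) a) +
        ℓ (fderiv ℝ (fun w => κ (ψ.symm w)) (ψ (κ.symm (κ (ψ.symm z)))) a)) +
      mapDeriv₂ n ι y η (fibreMap p
        (fderiv ℝ (fun w => κ (ψ.symm w)) (ψ (κ.symm (κ (ψ.symm z)))) a)) =
    mapDeriv₂ n ι y η (fibreMap p (invDeriv ψ z a)) + mapDeriv n ι y (ℓ (invDeriv ψ z a)) +
      mapDeriv n ι y (fibreMap p (fderiv ℝ (fderiv ℝ fun w => κ (ψ.symm w)) z e a))
  rw [h1', h2, map_add]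
  abel

/-- `tensorEmb` is continuous. -/
theorem continuousAt_tensorEmb (hι : IsIsometricEmbedding gN ι)
    (hψ : ψ ∈ IsManifold.maximalAtlas (𝓡 m) 2 M) {p : TensorBundle m n M N}
    (hp : p.1.1 ∈ ψ.source) : ContinuousAt (tensorEmb ψ ι) p := by
  obtain ⟨J', h, -⟩ := exists_hasFDerivAt_tensorEmb hι hψ (ψ.map_source hp) (ψ.left_inv hp).symm
  have h1 := ContinuousAt.comp
    (g := fun ξ => tensorEmb ψ ι ((extChartAt (tensorModel m n) p).symm ξ)) h.continuousAt
    (continuousAt_extChartAt (I := tensorModel m n) p)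
  refine h1.congr ?_
  filter_upwards [extChartAt_source_mem_nhds (I := tensorModel m n) p] with q hq
  exact congrArg (tensorEmb ψ ι) ((extChartAt (tensorModel m n) p).left_inv hq)

end TensorEmbeddingDeriv

/-! ### The covariant derivative identified by the Gauss formula. -/

section PointwiseIdentity

variable {m n ν : ℕ} {M N : Type*} [TopologicalSpace M] [ChartedSpace (Euc m) M]
  [TopologicalSpace N] [ChartedSpace (Euc n) N] [IsManifold (𝓡 m) 2 M] [IsManifold (𝓡 n) 2 N]
  {gM : Metric m M} {gN : Metric n N} {ι : N → Euc ν} {ψ : OpenPartialHomeomorph M (Euc m)}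

/-- The sum of the vertical lift of `D` and of the horizontal lift of `(id, L)`. -/
def tensorVelocity (gM : Metric m M) (gN : Metric n N) (x : M) (y : N)
    (L : TangentSpace (𝓡 m) x →L[ℝ] TangentSpace (𝓡 n) y)
    (D : TangentSpace (𝓡 m) x →L[ℝ] TangentSpace (𝓡 m) x →L[ℝ] TangentSpace (𝓡 n) y) :
    TangentSpace (𝓡 m) x →L[ℝ] TangentSpace (tensorModel m n) (tensorPoint x y L) :=
  vertLift x y L ∘L D +
    horLift gM gN x y L ∘L ((ContinuousLinearMap.id ℝ (TangentSpace (𝓡 m) x)).prod L)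

/-- The derivative of `tensorEmb` along the velocity of `Tu`, which is the sum of the vertical lift
of the covariant derivative and of the horizontal lift of `(e, Tu[e])`. -/
theorem exists_hasFDerivAt_tensorEmb_comp (hι : IsIsometricEmbedding gN ι)
    (hψ : ψ ∈ IsManifold.maximalAtlas (𝓡 m) 2 M) {z : Euc m} (hz : z ∈ ψ.target) {y : N}
    {L : TangentSpace (𝓡 m) (ψ.symm z) →L[ℝ] TangentSpace (𝓡 n) y}
    {D : TangentSpace (𝓡 m) (ψ.symm z) →L[ℝ] TangentSpace (𝓡 m) (ψ.symm z) →L[ℝ]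
      TangentSpace (𝓡 n) y} {H : Euc m →L[ℝ] Euc m →L[ℝ] Euc ν} {w₁ : Euc m →L[ℝ] Euc ν}
    {w₂ : Euc m →L[ℝ] Euc m →L[ℝ] Euc ν}
    (hL : ∀ e, (L : Euc m →L[ℝ] Euc n) (invDeriv ψ z e) = normalInv (mapDeriv n ι y) (w₁ e))
    (hD : ∀ a b, (D : Euc m →L[ℝ] Euc m →L[ℝ] Euc n) a b = normalInv (mapDeriv n ι y) (H a b))
    (hH : ∀ a b, H (invDeriv ψ z a) (invDeriv ψ z b) = w₂ a b - w₁ (christoffel gM ψ z a b))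
    (h₁ : ∀ e, w₁ e ∈ range (mapDeriv n ι y))
    (h₂ : ∀ e a, w₂ e a - mapDeriv₂ n ι y (normalInv (mapDeriv n ι y) (w₁ e))
      (normalInv (mapDeriv n ι y) (w₁ a)) ∈ range (mapDeriv n ι y)) :
    ∃ J' : (Euc m × Euc n) × (Euc m →L[ℝ] Euc n) →L[ℝ] Euc m × Euc ν × (Euc m →L[ℝ] Euc ν),
      HasFDerivAt (fun ξ => tensorEmb ψ ι ((extChartAt (tensorModel m n)
        (tensorPoint (ψ.symm z) y L)).symm ξ)) J'
        (extChartAt (tensorModel m n) (tensorPoint (ψ.symm z) y L)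
          (tensorPoint (ψ.symm z) y L)) ∧
      (ContinuousLinearMap.id ℝ (Euc m)).prod (w₁.prod w₂) = J' ∘L
        ((tensorVelocity gM gN (ψ.symm z) y L D ∘L chartInvDeriv ψ z :
          Euc m →L[ℝ] TangentSpace (tensorModel m n) (tensorPoint (ψ.symm z) y L)) :
          Euc m →L[ℝ] (Euc m × Euc n) × (Euc m →L[ℝ] Euc n)) := by
  obtain ⟨J', hJ, hJ'⟩ := exists_hasFDerivAt_tensorEmb (n := n) (p := tensorPoint (ψ.symm z) y L) hι
    hψ hz
    rfl
  refine ⟨J', hJ, ?_⟩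
  let L₀ : Euc m →L[ℝ] Euc n := L
  let D₀ : Euc m →L[ℝ] Euc m →L[ℝ] Euc n := D
  have hB := hι.mapDeriv_injective y
  set B := mapDeriv n ι y with hBdef
  have hLB : ∀ e, B (L₀ (invDeriv ψ z e)) = w₁ e := fun e => by
    exact (congrArg B (hL e)).trans (apply_normalInv_of_mem_range hB (h₁ e))
  ext1 e
  -- The fibre component of the velocity: `D` from the vertical lift, `L Γ^M - Γ^N(L, L)` from the
  -- horizontal one.
  let ℓ : Euc m →L[ℝ] Euc n := D₀ (invDeriv ψ z e) + (L₀ ∘L christoffelAt gM (ψ.symm z)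
    (invDeriv ψ z e) - christoffelAt gN y (L₀ (invDeriv ψ z e)) ∘L L₀)
  have hT : ((tensorVelocity gM gN (ψ.symm z) y L D ∘L chartInvDeriv ψ z :
          Euc m →L[ℝ] TangentSpace (tensorModel m n) (tensorPoint (ψ.symm z) y L)) :
          Euc m →L[ℝ] (Euc m × Euc n) × (Euc m →L[ℝ] Euc n)) e =
      ((invDeriv ψ z e, L₀ (invDeriv ψ z e)), ℓ) := by
    have : (((0 : Euc m × Euc n), D₀ (invDeriv ψ z e)) : (Euc m × Euc n) × (Euc m →L[ℝ] Euc n)) +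
      ((invDeriv ψ z e, L₀ (invDeriv ψ z e)), L₀ ∘L christoffelAt gM (ψ.symm z)
    (invDeriv ψ z e) - christoffelAt gN y (L₀ (invDeriv ψ z e)) ∘L L₀) =
      ((invDeriv ψ z e, L₀ (invDeriv ψ z e)), ℓ) := by
      rw [Prod.mk_add_mk, zero_add]
    exact this
  have h3 := hJ' e (L₀ (invDeriv ψ z e)) ℓ
  refine Eq.trans ?_ (congrArg J' hT).symm
  refine Prod.ext (h3 0).1.symm (Prod.ext ((h3 0).2.1.trans (hLB e)).symm ?_)
  ext1 a
  refine Eq.trans ?_ (h3 a).2.2.symm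
  change w₂ e a = mapDeriv₂ n ι y (L₀ (invDeriv ψ z e)) (L₀ (invDeriv ψ z a)) +
    B (D₀ (invDeriv ψ z e) (invDeriv ψ z a) + (L₀ (christoffelAt gM (ψ.symm z)
      (invDeriv ψ z e) (invDeriv ψ z a)) - christoffelAt gN y (L₀ (invDeriv ψ z e))
        (L₀ (invDeriv ψ z a)))) +
    B (L₀ (fderiv ℝ (fderiv ℝ fun w => chartAt (Euc m) (ψ.symm z) (ψ.symm w)) z e a))
  -- The transformation law of the Christoffel symbols: `Γ^M` in the preferred chart together with
  -- the `D²σ` term is `Γ^M` in `ψ`, which cancels against the one contained in `D²v`.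
  have h4 : B (L₀ (christoffelAt gM (ψ.symm z) (invDeriv ψ z e) (invDeriv ψ z a))) +
      B (L₀ (fderiv ℝ (fderiv ℝ fun w => chartAt (Euc m) (ψ.symm z) (ψ.symm w)) z e a)) =
      w₁ (christoffel gM ψ z e a) := by
    rw [← map_add, ← map_add, ← fderiv_christoffel hψ hz, hLB]
  have h5 : B (D₀ (invDeriv ψ z e) (invDeriv ψ z a)) = B (normalInv B (w₂ e a)) -
      w₁ (christoffel gM ψ z e a) := by
    have h0 : D₀ (invDeriv ψ z e) (invDeriv ψ z a) = normalInv B _ := hD _ _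
    rw [h0, hH, map_sub, map_sub, apply_normalInv_of_mem_range hB (h₁ _)]
  -- The tangent vector `w₂ - D²ι` equals its own projection, and by `h7` the projection of `D²ι` is
  -- the `Γ^N` term, the second fundamental form being normal.
  have h6 := apply_normalInv_of_mem_range hB (h₂ e a)
  have h7 := normalInv_eq_zero hB
    (hι.inner_secondFundamentalForm y (L₀ (invDeriv ψ z e)) (L₀ (invDeriv ψ z a)))
  rw [map_sub, ← hBdef, normalInv_apply_self hB, sub_eq_zero] at h7
  have hL' : ∀ e, L₀ (invDeriv ψ z e) = normalInv B (w₁ e) := hL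
  rw [map_sub, map_sub, ← hL', ← hL', h7] at h6
  rw [map_add, map_sub, h5]
  linear_combination (norm := module) -h6 - h4

end PointwiseIdentity

/-! ### Gluing weak derivatives over charts. -/

section GlobalDerivative

variable {m : ℕ} {M : Type*} [TopologicalSpace M] [ChartedSpace (Euc m) M]
  {F : Type*} [NormedAddCommGroup F] [NormedSpace ℝ F] {v : M → F}

/-- The change of charts for weak derivatives. -/
theorem HasWeakFDerivOn.ae_eq_comp_chart_trans [CompleteSpace F]
    {ψ ψ' : OpenPartialHomeomorph M (Euc m)}
    (hψ : ψ ∈ IsManifold.maximalAtlas (𝓡 m) 2 M) (hψ' : ψ' ∈ IsManifold.maximalAtlas (𝓡 m) 2 M)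
    {w w' : Euc m → Euc m →L[ℝ] F} (hw : HasWeakFDerivOn ψ.target (v ∘ ψ.symm) w)
    (hw' : HasWeakFDerivOn ψ'.target (v ∘ ψ'.symm) w') :
    ∀ᵐ z ∂volume.restrict ψ.target, ψ.symm z ∈ ψ'.source →
      w z = w' (ψ' (ψ.symm z)) ∘L fderiv ℝ (fun y => ψ' (ψ.symm y)) z := by
  let e : OpenPartialHomeomorph (Euc m) (Euc m) := ψ.symm.trans ψ'
  have hes : e.source = ψ.target ∩ ψ.symm ⁻¹' ψ'.source := ψ.symm.trans_source ψ'
  have het : e.target = ψ'.target ∩ ψ'.symm ⁻¹' ψ.source := ψ.symm.trans_target ψ'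
  have he : ContDiffOn ℝ 1 e e.source := fun z hz => by
    rw [hes] at hz
    exact ((contDiffAt_chart_trans hψ hψ' hz.1 hz.2).of_le one_le_two).contDiffWithinAt
  have he' : ContDiffOn ℝ 1 e.symm e.target := fun z hz => by
    rw [het] at hz
    exact ((contDiffAt_chart_trans hψ' hψ hz.1 hz.2).of_le one_le_two).contDiffWithinAt
  have hsub : e.source ⊆ ψ.target := hes ▸ inter_subset_left
  have h1 := hw'.comp_openPartialHomeomorph ψ'.open_target e (het ▸ inter_subset_left) he he'
  have h2 := (h1.congr_ae e.open_source (g := v ∘ ψ.symm) (by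
    filter_upwards [ae_restrict_mem e.open_source.measurableSet] with z hz
    rw [hes] at hz
    exact congrArg v (ψ'.left_inv hz.2)) (ae_eq_refl _)).unique (hw.mono hsub) e.open_source
  rw [EventuallyEq, ae_restrict_iff' e.open_source.measurableSet] at h2
  rw [ae_restrict_iff' ψ.open_target.measurableSet]
  filter_upwards [h2] with z hz h3 h4
  exact (hz (by rw [hes]; exact ⟨h3, h4⟩)).symm

/-- The weak derivatives of `v` in the various charts are those of a section of `T*M ⊗ F`. -/
theorem IsWeaklyDifferentiable.exists_deriv [IsManifold (𝓡 m) 2 M] [SecondCountableTopology M]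
    [CompleteSpace F] (h : IsWeaklyDifferentiable m v) :
    ∃ Dv : M → Euc m →L[ℝ] F, ∀ ψ ∈ IsManifold.maximalAtlas (𝓡 m) 2 M,
      ∀ w, HasWeakFDerivOn ψ.target (v ∘ ψ.symm) w →
        ∀ᵐ z ∂volume.restrict ψ.target, Dv (ψ.symm z) ∘L invDeriv ψ z = w z := by
  choose ψ₀ hψ₀ hmem w₀ hw₀ using h
  -- At each point the derivative is read in some chart from a countable family. The arbitrary
  -- choice is harmless, since the readings in two charts agree almost everywhere on the overlap and
  -- only countably many null sets arise.
  obtain ⟨s, hs, hsu⟩ := TopologicalSpace.countable_cover_nhds fun x =>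
    (ψ₀ x).open_source.mem_nhds (hmem x)
  have hcov : ∀ x, ∃ i ∈ s, x ∈ (ψ₀ i).source := fun x => by
    have hx : x ∈ ⋃ i ∈ s, (ψ₀ i).source := hsu ▸ mem_univ x
    simpa using hx
  choose i hi hxi using hcov
  refine ⟨fun x => w₀ (i x) (ψ₀ (i x) x) ∘L chartDeriv (ψ₀ (i x)) x, fun ψ hψ w hw => ?_⟩
  have hae : ∀ᵐ z ∂volume.restrict ψ.target, ∀ j ∈ s, ψ.symm z ∈ (ψ₀ j).source →
      w z = w₀ j (ψ₀ j (ψ.symm z)) ∘L fderiv ℝ (fun y => ψ₀ j (ψ.symm y)) z :=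
    (ae_ball_iff hs).2 fun j _ => hw.ae_eq_comp_chart_trans hψ (hψ₀ j) (hw₀ j)
  filter_upwards [hae, ae_restrict_mem ψ.open_target.measurableSet] with z hz hzt
  rw [hz _ (hi (ψ.symm z)) (hxi _), ContinuousLinearMap.comp_assoc,
    chartDeriv_comp_invDeriv hψ (hψ₀ _) hzt (hxi _)]

end GlobalDerivative

/-! ### Measurability through embeddings, and of the tangential projection. -/

section Measurability

variable {m : ℕ} {X Z : Type*} [TopologicalSpace X]

omit [TopologicalSpace X] in
-- Up to a null set, `γ z ∈ O` is the condition `V z ∈ O'`, and `V` is measurable.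
theorem nullMeasurableSet_inter_preimage_of_embedding [NormedAddCommGroup Z] {J : X → Z}
    {S O : Set X} (hO : ∃ O' : Set Z, IsOpen O' ∧ ∀ x ∈ S, J x ∈ O' ↔ x ∈ O) {Ω : Set (Euc m)}
    (hΩ : IsOpen Ω) {γ : Euc m → X} {V : Euc m → Z} (hS : ∀ z ∈ Ω, γ z ∈ S)
    (hV : AEStronglyMeasurable V (volume.restrict Ω))
    (hγ : ∀ᵐ z ∂volume.restrict Ω, J (γ z) = V z) : NullMeasurableSet (Ω ∩ γ ⁻¹' O) := by
  obtain ⟨O', hO', hJ⟩ := hO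
  borelize Z
  have h1 : NullMeasurableSet (V ⁻¹' O') (volume.restrict Ω) :=
    hV.aemeasurable.nullMeasurable hO'.measurableSet
  have h2 : NullMeasurableSet (γ ⁻¹' O) (volume.restrict Ω) := by
    refine h1.congr ?_
    filter_upwards [hγ, ae_restrict_mem hΩ.measurableSet] with z hz hzΩ
    refine propext ?_
    change V z ∈ O' ↔ γ z ∈ O
    rw [← hz, hJ _ (hS z hzΩ)]
  rw [inter_comm]
  exact (nullMeasurableSet_restrict hΩ.measurableSet.nullMeasurableSet).1 h2

theorem aestronglyMeasurable_comp_of_forall_isOpen [NormedAddCommGroup Z]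
    [SecondCountableTopology Z] {Q : X → Z} (hQ : Continuous Q)
    {Ω : Set (Euc m)} (hΩ : IsOpen Ω) {γ : Euc m → X}
    (hγ : ∀ O : Set X, IsOpen O → NullMeasurableSet (Ω ∩ γ ⁻¹' O)) :
    AEStronglyMeasurable (fun z => Q (γ z)) (volume.restrict Ω) := by
  borelize Z
  refine AEMeasurable.aestronglyMeasurable (NullMeasurable.aemeasurable ?_)
  refine measurable_of_isOpen fun O hO => ?_
  have h1 := hγ _ (hO.preimage hQ)
  rw [inter_comm] at h1
  exact (nullMeasurableSet_restrict hΩ.measurableSet.nullMeasurableSet).2 h1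

variable {n ν : ℕ} {N : Type*} [TopologicalSpace N] [ChartedSpace (Euc n) N]
  [IsManifold (𝓡 n) 2 N] {gN : Metric n N} {ι : N → Euc ν}

/-- The orthogonal projections onto the tangent spaces depend continuously on the point. -/
theorem IsIsometricEmbedding.continuous_projection (hι : IsIsometricEmbedding gN ι) :
    Continuous fun y => mapDeriv n ι y ∘L normalInv (mapDeriv n ι y) := by
  refine continuous_iff_continuousAt.2 fun y₀ => ?_
  set κ := chartAt (Euc n) y₀ with hκ
  have hκa : κ ∈ IsManifold.maximalAtlas (𝓡 n) 2 N := chartAt_mem_maximalAtlas_two _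
  -- The differential of `ι` in the fixed chart at `y₀`: unlike `mapDeriv n ι y`, it is continuous
  -- at `y₀`. Both have the same range near `y₀`, and the projection depends on the range only.
  let B : N → Euc n →L[ℝ] Euc ν := fun y => fderiv ℝ (fun w => ι (κ.symm w)) (κ y)
  have hy₀ : y₀ ∈ κ.source := mem_chart_source _ _
  have hBc : ContinuousAt B y₀ :=
    ContinuousAt.comp (g := fderiv ℝ fun w => ι (κ.symm w))
      (((contDiffAt_comp_symm le_rfl hι.contMDiff hκa (κ.map_source hy₀)).fderiv_right
        (m := 1) (by norm_num)).continuousAt) (κ.continuousAt hy₀)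
  have hc : ContinuousAt (fun y => B y ∘L normalInv (B y)) y₀ :=
    hBc.clm_comp (ContinuousAt.comp (g := fun B : Euc n →L[ℝ] Euc ν => normalInv B)
      (continuousAt_normalInv (hι.mapDeriv_injective y₀)) hBc)
  refine hc.congr ?_
  filter_upwards [κ.open_source.mem_nhds hy₀] with y hy
  have h1 : mapDeriv n ι y = B y ∘L chartDeriv κ y := hι.mapDeriv_eq_comp_chartDeriv hy
  have h2 : mapDeriv n ι y ∘L invDeriv κ (κ y) = B y := by
    have h3 := mapDeriv_comp_invDeriv hκa (κ.map_source hy) (hι.contMDiff.of_le (by norm_num))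
    rwa [κ.left_inv hy] at h3
  have hinj : Function.Injective (B y) := by
    rw [← h2]
    refine (hι.mapDeriv_injective y).comp ?_
    have h4 := invDeriv_comp_chartDeriv_self hκa hy
    have h5 := chartDeriv_comp_invDeriv_self hκa (κ.map_source hy)
    rw [κ.left_inv hy] at h5
    exact Function.LeftInverse.injective (g := chartDeriv κ y) fun e =>
      congrArg (fun A : Euc n →L[ℝ] Euc n => A e) h5
  refine comp_normalInv_comp_eq hinj (hι.mapDeriv_injective y) (subset_antisymm ?_ ?_)
  · rintro _ ⟨e, rfl⟩
    exact ⟨invDeriv κ (κ y) e, congrArg (fun A : Euc n →L[ℝ] Euc ν => A e) h2⟩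
  · rintro _ ⟨e, rfl⟩
    exact ⟨chartDeriv κ y e, (congrArg (fun A : Euc n →L[ℝ] Euc ν => A e) h1).symm⟩

end Measurability

/-! ### The tangential parts of `Dv` and `D²v` as colocal derivatives. -/

section Projection

variable {m n ν : ℕ} {M N : Type*} [TopologicalSpace M] [ChartedSpace (Euc m) M]
  [IsManifold (𝓡 m) 2 M] [TopologicalSpace N] [ChartedSpace (Euc n) N] [IsManifold (𝓡 n) 2 N]
  {gM : Metric m M} {gN : Metric n N} {ι : N → Euc ν} {u : M → N}

/-- In the chart `ψ`, the map `v` has the weak derivatives `w₁` and `w₂`, and these represent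
`Dv` and the second covariant derivative `H`. -/
structure IsHessianChart (gM : Metric m M) (v : M → Euc ν) (Dv : M → Euc m →L[ℝ] Euc ν)
    (H : M → Euc m →L[ℝ] Euc m →L[ℝ] Euc ν) (ψ : OpenPartialHomeomorph M (Euc m))
    (w₁ : Euc m → Euc m →L[ℝ] Euc ν)
    (w₂ : Euc m → Euc m →L[ℝ] Euc m →L[ℝ] Euc ν) : Prop where
  mem_maximalAtlas : ψ ∈ IsManifold.maximalAtlas (𝓡 m) 2 M
  hasWeakFDerivOn : HasWeakFDerivOn ψ.target (fun z => v (ψ.symm z)) w₁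
  hasWeakFDerivOn₂ : HasWeakFDerivOn ψ.target w₁ w₂
  deriv_eq : ∀ᵐ z ∂volume.restrict ψ.target, Dv (ψ.symm z) ∘L invDeriv ψ z = w₁ z
  hessian_eq : ∀ᵐ z ∂volume.restrict ψ.target, ∀ a b : Euc m,
    H (ψ.symm z) (invDeriv ψ z a) (invDeriv ψ z b) =
      w₂ z a b - w₁ z (christoffel gM ψ z a b)

/-- A weak Hessian provides first derivatives chart by chart only; a single section `Dv` is fixed
here, from which a single `Tu` can be built. -/
theorem HasWeakHessian.exists_isHessianChart [SecondCountableTopology M] {v : M → Euc ν}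
    {H : ∀ x : M, TangentSpace (𝓡 m) x →L[ℝ] TangentSpace (𝓡 m) x →L[ℝ] Euc ν}
    (h : HasWeakHessian gM v H) : ∃ Dv : M → Euc m →L[ℝ] Euc ν, ∀ x₀, ∃ ψ w₁ w₂,
      x₀ ∈ ψ.source ∧ IsHessianChart gM v Dv H ψ w₁ w₂ := by
  have hw : IsWeaklyDifferentiable m v := fun x₀ => by
    obtain ⟨ψ, hψ, hx, w₁, w₂, h₁, -⟩ := h x₀
    exact ⟨ψ, hψ, hx, w₁, h₁⟩
  obtain ⟨Dv, hDv⟩ := hw.exists_deriv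
  refine ⟨Dv, fun x₀ => ?_⟩
  obtain ⟨ψ, hψ, hx, w₁, w₂, h₁, h₂, hH⟩ := h x₀
  exact ⟨ψ, w₁, w₂, hx, hψ, h₁, h₂, hDv ψ hψ w₁ h₁, hH⟩

variable {Dv : M → Euc m →L[ℝ] Euc ν}
  {H : M → Euc m →L[ℝ] Euc m →L[ℝ] Euc ν}
  {ψ : OpenPartialHomeomorph M (Euc m)} {w₁ : Euc m → Euc m →L[ℝ] Euc ν}
  {w₂ : Euc m → Euc m →L[ℝ] Euc m →L[ℝ] Euc ν}

/-- The linear map `T_x M → T_{u(x)} N` of which `Dv(x)` is the image under `Dι`. -/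
def tangentLift (n : ℕ) {N : Type*} [TopologicalSpace N] [ChartedSpace (Euc n) N]
    (ι : N → Euc ν) (u : M → N) (Dv : M → Euc m →L[ℝ] Euc ν) (x : M) :
    TangentSpace (𝓡 m) x →L[ℝ] TangentSpace (𝓡 n) (u x) :=
  normalInv (mapDeriv n ι (u x)) ∘L Dv x

/-- The bilinear map `T_x M × T_x M → T_{u(x)} N` of which the tangential part of `H(x)` is the
image under `Dι`. -/
def tangentLift₂ (n : ℕ) {N : Type*} [TopologicalSpace N] [ChartedSpace (Euc n) N]
    (ι : N → Euc ν) (u : M → N) (H : M → Euc m →L[ℝ] Euc m →L[ℝ] Euc ν) (x : M) :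
    TangentSpace (𝓡 m) x →L[ℝ] TangentSpace (𝓡 m) x →L[ℝ] TangentSpace (𝓡 n) (u x) :=
  ContinuousLinearMap.compL ℝ (Euc m) (Euc ν) (Euc n) (normalInv (mapDeriv n ι (u x))) ∘L
    H x

omit [IsManifold (𝓡 m) 2 M] [IsManifold (𝓡 n) 2 N] in
theorem tangentLift₂_apply (x : M) (a b : Euc m) :
    (tangentLift₂ n ι u H x : Euc m →L[ℝ] Euc m →L[ℝ] Euc n) a b =
      normalInv (mapDeriv n ι (u x)) (H x a b) := rfl

/-- Nothing is lost in projecting, because `w₁` is already tangent almost everywhere. -/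
theorem IsHessianChart.ae_comp_tangentLift (hι : IsIsometricEmbedding gN ι)
    (h : IsHessianChart gM (ι ∘ u) Dv H ψ w₁ w₂) :
    ∀ᵐ z ∂volume.restrict ψ.target, mapDeriv n ι (u (ψ.symm z)) ∘L
      (tangentLift n ι u Dv (ψ.symm z) : Euc m →L[ℝ] Euc n) ∘L invDeriv ψ z = w₁ z := by
  filter_upwards [h.deriv_eq, hι.ae_mem_range_mapDeriv ψ.open_target h.hasWeakFDerivOn]
    with z h1 h2
  ext1 e
  have h3 : Dv (ψ.symm z) (invDeriv ψ z e) = w₁ z e :=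
    congrArg (fun A : Euc m →L[ℝ] Euc ν => A e) h1
  have h4 := apply_normalInv_of_mem_range (hι.mapDeriv_injective _) (h2 e)
  rw [← h3] at h4 ⊢
  exact h4

/-- The embedding turns `Tu` into a Euclidean map each of whose components is weakly differentiable.
-/
theorem IsHessianChart.ae_tensorEmb (hι : IsIsometricEmbedding gN ι)
    (h : IsHessianChart gM (ι ∘ u) Dv H ψ w₁ w₂) :
    ∀ᵐ z ∂volume.restrict ψ.target, tensorEmb ψ ι (tensorPoint (ψ.symm z) (u (ψ.symm z))
      (tangentLift n ι u Dv (ψ.symm z))) = (z, ι (u (ψ.symm z)), w₁ z) := by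
  filter_upwards [h.ae_comp_tangentLift hι, ae_restrict_mem ψ.open_target.measurableSet]
    with z h1 hz
  have h2 := ψ.right_inv hz
  refine Prod.ext h2 (Prod.ext rfl ?_)
  rw [← h1]
  change mapDeriv n ι (u (ψ.symm z)) ∘L
      (tangentLift n ι u Dv (ψ.symm z) : Euc m →L[ℝ] Euc n) ∘L invDeriv ψ (ψ (ψ.symm z)) = _
  rw [h2]

theorem IsHessianChart.nullMeasurableSet_preimage (hι : IsIsometricEmbedding gN ι)
    (h : IsHessianChart gM (ι ∘ u) Dv H ψ w₁ w₂) {O : Set N} (hO : IsOpen O) :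
    NullMeasurableSet (ψ.target ∩ ψ.symm ⁻¹' (u ⁻¹' O)) := by
  refine nullMeasurableSet_inter_preimage_of_embedding (J := ι) (S := univ)
    (γ := fun z => u (ψ.symm z)) ?_ ψ.open_target (fun _ _ => trivial)
    h.hasWeakFDerivOn.1.aestronglyMeasurable (ae_of_all _ fun _ => rfl)
  obtain ⟨O', hO', rfl⟩ := hι.isEmbedding.isOpen_iff.1 hO
  exact ⟨O', hO', fun _ _ => Iff.rfl⟩

theorem IsHessianChart.nullMeasurableSet_preimage_tensorPoint (hι : IsIsometricEmbedding gN ι)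
    (h : IsHessianChart gM (ι ∘ u) Dv H ψ w₁ w₂) {O : Set (TensorBundle m n M N)}
    (hO : IsOpen O) : NullMeasurableSet (ψ.target ∩ ψ.symm ⁻¹'
      ((fun x => tensorPoint x (u x) (tangentLift n ι u Dv x)) ⁻¹' O)) := by
  refine nullMeasurableSet_inter_preimage_of_embedding (J := tensorEmb ψ ι)
    (S := {p | p.1.1 ∈ ψ.source})
    (γ := fun z => tensorPoint (ψ.symm z) (u (ψ.symm z)) (tangentLift n ι u Dv (ψ.symm z)))
    (V := fun z => (z, ι (u (ψ.symm z)), w₁ z)) ?_ ψ.open_target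
    (fun z hz => ψ.map_target hz) ?_ (h.ae_tensorEmb hι)
  · refine exists_isOpen_preimage_of_leftInverse (I := tensorModel m n) (fun p hp => ?_) hO
    obtain ⟨r, hr, hr'⟩ := exists_leftInverse_tensorEmb hι h.mem_maximalAtlas (fun _ hp => hp) hp
    exact ⟨r, hr.continuousAt, hr'⟩
  · exact aestronglyMeasurable_id.prodMk (h.hasWeakFDerivOn.1.aestronglyMeasurable.prodMk
      h.hasWeakFDerivOn.2.1.aestronglyMeasurable)

omit [IsManifold (𝓡 m) 2 M] [IsManifold (𝓡 n) 2 N] in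
theorem tensorEmb₂_tensorPoint₂ (x : M) (y : N)
    (B : TangentSpace (𝓡 m) x →L[ℝ] TangentSpace (𝓡 m) x →L[ℝ] TangentSpace (𝓡 n) y) :
    tensorEmb₂ ψ ι (tensorPoint₂ x y B) = (ψ x, ι y,
      bilinConj (mapDeriv n ι y) (B : Euc m →L[ℝ] Euc m →L[ℝ] Euc n) (invDeriv ψ (ψ x))) := rfl

/-- The image under `P` of the second covariant derivative in a chart. -/
def projHessian (q : (Euc ν →L[ℝ] Euc ν) × (Euc m →L[ℝ] Euc ν) × (Euc m →L[ℝ] Euc m →L[ℝ] Euc ν) ×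
      (Euc m →L[ℝ] Euc m →L[ℝ] Euc m)) : Euc m →L[ℝ] Euc m →L[ℝ] Euc ν :=
  ContinuousLinearMap.compL ℝ (Euc m) (Euc ν) (Euc ν) q.1 ∘L
    (q.2.2.1 - ContinuousLinearMap.compL ℝ (Euc m) (Euc m) (Euc ν) q.2.1 ∘L q.2.2.2)

theorem projHessian_apply (P : Euc ν →L[ℝ] Euc ν) (w₁ : Euc m →L[ℝ] Euc ν)
    (w₂ : Euc m →L[ℝ] Euc m →L[ℝ] Euc ν) (Γ : Euc m →L[ℝ] Euc m →L[ℝ] Euc m) (a b : Euc m) :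
    projHessian (P, w₁, w₂, Γ) a b = P (w₂ a b - w₁ (Γ a b)) := rfl

theorem continuous_projHessian : Continuous (projHessian (m := m) (ν := ν)) := by
  unfold projHessian
  fun_prop

omit [IsManifold (𝓡 n) 2 N] in
theorem IsHessianChart.ae_tensorEmb₂
    (h : IsHessianChart gM (ι ∘ u) Dv H ψ w₁ w₂) :
    ∀ᵐ z ∂volume.restrict ψ.target, tensorEmb₂ ψ ι (tensorPoint₂ (ψ.symm z) (u (ψ.symm z))
      (tangentLift₂ n ι u H (ψ.symm z))) = (z, ι (u (ψ.symm z)), projHessian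
        (mapDeriv n ι (u (ψ.symm z)) ∘L normalInv (mapDeriv n ι (u (ψ.symm z))),
          w₁ z, w₂ z, christoffel gM ψ z)) := by
  filter_upwards [h.hessian_eq, ae_restrict_mem ψ.open_target.measurableSet] with z hH hz
  rw [tensorEmb₂_tensorPoint₂, ψ.right_inv hz]
  refine Prod.ext rfl (Prod.ext rfl ?_)
  dsimp only
  ext1 a
  ext1 b
  rw [projHessian_apply, ← hH]
  exact (bilinConj_apply _ _ _ a b).trans
    (congrArg (mapDeriv n ι (u (ψ.symm z))) (tangentLift₂_apply (ψ.symm z) _ _))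

theorem IsHessianChart.nullMeasurableSet_preimage_tensorPoint₂ (hι : IsIsometricEmbedding gN ι)
    (h : IsHessianChart gM (ι ∘ u) Dv H ψ w₁ w₂) {O : Set (TensorBundle₂ m n M N)}
    (hO : IsOpen O) : NullMeasurableSet (ψ.target ∩ ψ.symm ⁻¹'
      ((fun x => tensorPoint₂ x (u x) (tangentLift₂ n ι u H x)) ⁻¹' O)) := by
  -- Unlike `Dv`, the Hessian of `v` is not tangent, so the projection remains in the formula; it is
  -- measurable as a continuous function of `u`.
  have hP : AEStronglyMeasurable (fun z => mapDeriv n ι (u (ψ.symm z)) ∘L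
      normalInv (mapDeriv n ι (u (ψ.symm z)))) (volume.restrict ψ.target) :=
    aestronglyMeasurable_comp_of_forall_isOpen (γ := fun z => u (ψ.symm z))
      hι.continuous_projection ψ.open_target fun O hO => h.nullMeasurableSet_preimage hι hO
  have hΓ : AEStronglyMeasurable (christoffel gM ψ) (volume.restrict ψ.target) :=
    (continuousOn_christoffel h.mem_maximalAtlas).aestronglyMeasurable
      ψ.open_target.measurableSet
  have hV := (aestronglyMeasurable_id (α := Euc m) (μ := volume.restrict ψ.target)).prodMk
    (h.hasWeakFDerivOn.1.aestronglyMeasurable.prodMk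
    (continuous_projHessian.comp_aestronglyMeasurable
      (hP.prodMk (h.hasWeakFDerivOn.2.1.aestronglyMeasurable.prodMk
      (h.hasWeakFDerivOn₂.2.1.aestronglyMeasurable.prodMk hΓ)))))
  exact nullMeasurableSet_inter_preimage_of_embedding (J := tensorEmb₂ ψ ι)
    (S := {p | p.1.1 ∈ ψ.source})
    (γ := fun z => tensorPoint₂ (ψ.symm z) (u (ψ.symm z)) (tangentLift₂ n ι u H (ψ.symm z)))
    (exists_isOpen_preimage_of_leftInverse (I := tensorModel₂ m n) (fun p hp =>
      exists_leftInverse_tensorEmb₂ hι h.mem_maximalAtlas (fun _ hp => hp) hp) hO)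
    ψ.open_target (fun z hz => ψ.map_target hz) hV h.ae_tensorEmb₂

theorem IsHessianChart.hasWeakFDerivOn_comp (hι : IsIsometricEmbedding gN ι)
    (h : IsHessianChart gM (ι ∘ u) Dv H ψ w₁ w₂) {f : N → ℝ}
    (hf : ContMDiff (𝓡 n) 𝓘(ℝ, ℝ) 1 f) (hc : HasCompactSupport f) :
    HasWeakFDerivOn ψ.target (fun z => f (u (ψ.symm z))) fun z =>
      (mfderiv (𝓡 n) 𝓘(ℝ, ℝ) f (u (ψ.symm z)) : TangentSpace (𝓡 n) (u (ψ.symm z)) →L[ℝ] ℝ) ∘L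
        (tangentLift n ι u Dv (ψ.symm z) ∘L chartInvDeriv ψ z) := by
  refine hasWeakFDerivOn_comp_of_embedding (I := 𝓡 n) (J := ι) (S := univ)
    (γ := fun z => u (ψ.symm z)) hι.contMDiff.continuous.continuousOn (fun y _ => ?_) hf
    (by rw [univ_inter]; exact hc) ψ.open_target h.hasWeakFDerivOn (fun _ _ => univ_mem)
    (ae_of_all _ fun _ => rfl) ?_
  · obtain ⟨r, hr, hr'⟩ := hι.exists_leftInverse y
    exact ⟨r, hr.of_le one_le_two, hr'⟩
  · filter_upwards [h.ae_comp_tangentLift hι] with z hz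
    exact ⟨mapDeriv n ι (u (ψ.symm z)), ((contDiffAt_comp_symm le_rfl hι.contMDiff
      (chartAt_mem_maximalAtlas_two (m := n) _)
      (mem_chart_target _ _)).differentiableAt (by simp)).hasFDerivAt, hz.symm⟩

/-- `tensorEmb ψ ι` is controlled over the domain of `ψ` only, which the support of `f` may leave. A
closed `K` inside that domain makes the relevant part of the support compact, and the formula is
obtained over the interior of `K`. -/
theorem IsHessianChart.hasWeakFDerivOn_comp_tensorPoint (hι : IsIsometricEmbedding gN ι)
    (h : IsHessianChart gM (ι ∘ u) Dv H ψ w₁ w₂) {K : Set M} (hK : IsClosed K)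
    (hKψ : K ⊆ ψ.source) {Ω : Set (Euc m)} (hΩ : IsOpen Ω) (hΩψ : Ω ⊆ ψ.target)
    (hΩK : ∀ z ∈ Ω, K ∈ 𝓝 (ψ.symm z)) {f : TensorBundle m n M N → ℝ}
    (hf : ContMDiff (tensorModel m n) 𝓘(ℝ, ℝ) 1 f) (hc : HasCompactSupport f) :
    HasWeakFDerivOn Ω (fun z => f (tensorPoint (ψ.symm z) (u (ψ.symm z))
      (tangentLift n ι u Dv (ψ.symm z)))) fun z =>
      (mfderiv (tensorModel m n) 𝓘(ℝ, ℝ) f (tensorPoint (ψ.symm z) (u (ψ.symm z))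
        (tangentLift n ι u Dv (ψ.symm z))) :
          TangentSpace (tensorModel m n) (tensorPoint (ψ.symm z) (u (ψ.symm z))
            (tangentLift n ι u Dv (ψ.symm z))) →L[ℝ] ℝ) ∘L
        (tensorVelocity gM gN (ψ.symm z) (u (ψ.symm z)) (tangentLift n ι u Dv (ψ.symm z))
          (tangentLift₂ n ι u H (ψ.symm z)) ∘L chartInvDeriv ψ z) := by
  have hproj : Continuous fun p : TensorBundle m n M N => p.1.1 :=
    continuous_fst.comp (FiberBundle.continuous_proj _ _)
  refine hasWeakFDerivOn_comp_of_embedding (I := tensorModel m n) (J := tensorEmb ψ ι)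
    (S := {p | p.1.1 ∈ K}) (V := fun z => (z, ι (u (ψ.symm z)), w₁ z))
    (V' := fun z => (ContinuousLinearMap.id ℝ (Euc m)).prod ((w₁ z).prod (w₂ z)))
    (γ := fun z => tensorPoint (ψ.symm z) (u (ψ.symm z)) (tangentLift n ι u Dv (ψ.symm z)))
    (fun p hp => (continuousAt_tensorEmb hι h.mem_maximalAtlas
      (hKψ hp)).continuousWithinAt) (fun p hp => exists_leftInverse_tensorEmb hι
        h.mem_maximalAtlas (fun p hp => hKψ hp) hp) hf
    (IsCompact.inter_left hc (hK.preimage hproj)) hΩ ?_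
    (fun z hz => hproj.continuousAt.preimage_mem_nhds (hΩK z hz))
    (ae_restrict_of_ae_restrict_of_subset hΩψ (h.ae_tensorEmb hι)) ?_
  · have h1 : HasWeakFDerivOn ψ.target (fun z : Euc m => z)
        fun _ => ContinuousLinearMap.id ℝ (Euc m) := by
      have h2 := hasWeakFDerivOn_of_contDiffOn ψ.open_target
        (contDiff_id (𝕜 := ℝ) (E := Euc m) (n := 1)).contDiffOn
      have h3 : fderiv ℝ (id : Euc m → Euc m) = fun _ => ContinuousLinearMap.id ℝ (Euc m) :=
        funext fun _ => fderiv_id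
      rwa [h3] at h2
    exact (h1.prodMk (h.hasWeakFDerivOn.prodMk h.hasWeakFDerivOn₂ ψ.open_target)
      ψ.open_target).mono hΩψ
  · refine ae_restrict_of_ae_restrict_of_subset hΩψ ?_
    filter_upwards [h.deriv_eq, h.hessian_eq, ae_restrict_mem ψ.open_target.measurableSet,
      hι.ae_mem_range_mapDeriv ψ.open_target h.hasWeakFDerivOn,
      hι.ae_sub_mem_range_mapDeriv ψ.open_target h.hasWeakFDerivOn h.hasWeakFDerivOn₂]
      with z h1 h2 hz h3 h4
    have hL : ∀ e, (tangentLift n ι u Dv (ψ.symm z) : Euc m →L[ℝ] Euc n) (invDeriv ψ z e) =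
        normalInv (mapDeriv n ι (u (ψ.symm z))) (w₁ z e) := fun e => by
      rw [← h1]
      rfl
    exact exists_hasFDerivAt_tensorEmb_comp hι h.mem_maximalAtlas hz hL
      (tangentLift₂_apply (ψ.symm z)) h2 h3 h4

end Projection

/-! ### The norm estimate and the inclusion of the Sobolev spaces. -/

section Inclusion

variable {m n ν : ℕ} {M N : Type*} [TopologicalSpace M] [ChartedSpace (Euc m) M]
  [IsManifold (𝓡 m) 2 M] [TopologicalSpace N] [ChartedSpace (Euc n) N] [IsManifold (𝓡 n) 2 N]
  {gM : Metric m M} {gN : Metric n N} {ι : N → Euc ν} {u : M → N}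
  {Dv : M → Euc m →L[ℝ] Euc ν}
  {H : M → Euc m →L[ℝ] Euc m →L[ℝ] Euc ν}

/-- Holds term by term in an orthonormal frame: as `ι` is isometric, the `gN`-norm of a lifted
vector is the Euclidean norm of a projection. -/
theorem tensorNorm_tangentLift₂_le (hι : IsIsometricEmbedding gN ι) (x : M) :
    tensorNorm gM gN x (u x) (tangentLift₂ n ι u H x) ≤ hessianNorm gM x (H x) := by
  refine Real.sqrt_le_sqrt (Finset.sum_le_sum fun i _ => Finset.sum_le_sum fun j _ => ?_)
  set q : Euc ν := H x (orthonormalFrame gM x i) (orthonormalFrame gM x j)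
  have h1 : (gN.inner (u x) : Euc n →L[ℝ] Euc n →L[ℝ] ℝ) (normalInv (mapDeriv n ι (u x)) q)
      (normalInv (mapDeriv n ι (u x)) q) ≤ ‖q‖ ^ 2 := by
    rw [← hι.inner_mapDeriv, real_inner_self_eq_norm_sq]
    exact pow_le_pow_left₀ (norm_nonneg _)
      (norm_apply_normalInv_le (hι.mapDeriv_injective _) q) 2
  exact h1

omit [ChartedSpace (Euc m) M] [IsManifold (𝓡 m) 2 M] in
/-- Each point of the domain of `ψ` has a neighbourhood whose closure lies in that domain. -/
theorem exists_restr_subset_isClosed [T2Space M] (ψ : OpenPartialHomeomorph M (Euc m)) {x₀ : M}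
    (hx₀ : x₀ ∈ ψ.source) : ∃ s K : Set M, IsOpen s ∧ IsClosed K ∧ x₀ ∈ s ∧ s ⊆ K ∧
      K ⊆ ψ.source := by
  obtain ⟨ε, hε, hball⟩ := Metric.nhds_basis_closedBall.mem_iff.1
    -- `K` is the preimage of a closed coordinate ball; it is compact, hence closed in the Hausdorff
    -- space `M`.
    (ψ.open_target.mem_nhds (ψ.map_source hx₀))
  refine ⟨ψ.source ∩ ψ ⁻¹' Metric.ball (ψ x₀) ε, ψ.symm '' Metric.closedBall (ψ x₀) ε,
    ψ.isOpen_inter_preimage Metric.isOpen_ball,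
    ((isCompact_closedBall _ _).image_of_continuousOn
      (ψ.continuousOn_symm.mono hball)).isClosed, ⟨hx₀, Metric.mem_ball_self hε⟩, ?_, ?_⟩
  · rintro x ⟨hx, hxb⟩
    exact ⟨ψ x, Metric.ball_subset_closedBall hxb, ψ.left_inv hx⟩
  · rintro _ ⟨z, hz, rfl⟩
    exact ψ.map_target (hball hz)

theorem hasColocalWeakDeriv_tangentLift (hι : IsIsometricEmbedding gN ι)
    (h : ∀ x₀, ∃ ψ w₁ w₂, x₀ ∈ ψ.source ∧ IsHessianChart gM (ι ∘ u) Dv H ψ w₁ w₂) :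
    HasColocalWeakDeriv u (tangentLift n ι u Dv) := by
  refine ⟨fun x₀ => ?_, fun f hf hc x₀ => ?_⟩
  · obtain ⟨ψ, w₁, w₂, hx, hψ⟩ := h x₀
    exact ⟨ψ, hψ.mem_maximalAtlas, hx, fun O hO => hψ.nullMeasurableSet_preimage_tensorPoint hι hO⟩
  · obtain ⟨ψ, w₁, w₂, hx, hψ⟩ := h x₀
    exact ⟨ψ, hψ.mem_maximalAtlas, hx, hψ.hasWeakFDerivOn_comp hι hf hc⟩

theorem hasColocalWeakCovDeriv_tangentLift₂ [T2Space M] (hι : IsIsometricEmbedding gN ι)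
    (h : ∀ x₀, ∃ ψ w₁ w₂, x₀ ∈ ψ.source ∧ IsHessianChart gM (ι ∘ u) Dv H ψ w₁ w₂) :
    HasColocalWeakCovDeriv gM gN u (tangentLift n ι u Dv) (tangentLift₂ n ι u H) := by
  refine ⟨fun x₀ => ?_, fun f hf hc x₀ => ?_⟩
  · obtain ⟨ψ, w₁, w₂, hx, hψ⟩ := h x₀
    exact ⟨ψ, hψ.mem_maximalAtlas, hx,
      fun O hO => hψ.nullMeasurableSet_preimage_tensorPoint₂ hι hO⟩
  · obtain ⟨ψ, w₁, w₂, hx, hψ⟩ := h x₀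
    -- The chart is shrunk so that its domain lies in a closed `K` inside the domain of `ψ`; one
    -- chart around each point is all that is required.
    obtain ⟨s, K, hs, hK, hxs, hsK, hKψ⟩ := exists_restr_subset_isClosed ψ hx
    have ht : (ψ.restr s).target = ψ.target ∩ ψ.symm ⁻¹' s := by
      rw [ψ.restr_target, hs.interior_eq]
    refine ⟨ψ.restr s, restr_mem_maximalAtlas _ hψ.mem_maximalAtlas hs, ?_, ?_⟩
    · rw [ψ.restr_source, hs.interior_eq]
      exact ⟨hx, hxs⟩
    · exact hψ.hasWeakFDerivOn_comp_tensorPoint hι hK hKψ (ψ.restr s).open_target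
        (ht ▸ inter_subset_left) (fun z hz => Filter.mem_of_superset
          (hs.mem_nhds (ht ▸ hz : z ∈ ψ.target ∩ ψ.symm ⁻¹' s).2) hsK) hf hc

omit [IsManifold (𝓡 m) 2 M] in
theorem HasWeakMFDeriv.isWeaklyDifferentiable {F : Type*} [NormedAddCommGroup F]
    [NormedSpace ℝ F] {f : M → F} {f' : ∀ x : M, TangentSpace (𝓡 m) x →L[ℝ] F}
    (h : HasWeakMFDeriv f f') : IsWeaklyDifferentiable m f := fun x₀ => by
  obtain ⟨ψ, hψ, hx, hw⟩ := h x₀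
  exact ⟨ψ, hψ, hx, _, hw⟩

theorem embeddedSobolev_subset_intrinsicSobolev [T2Space M] [SecondCountableTopology M]
    [MeasurableSpace M] (gM : Metric m M) (hι : IsIsometricEmbedding gN ι) {p : ℝ} (hp : 0 ≤ p) :
    embeddedSobolev gM ι p ⊆ intrinsicSobolev gM gN p := by
  rintro u ⟨H, hH, hint⟩
  obtain ⟨Dv, h⟩ := hH.exists_isHessianChart
  have h₁ := hasColocalWeakDeriv_tangentLift hι h
  have h₂ := hasColocalWeakCovDeriv_tangentLift₂ hι h
  refine ⟨⟨fun x₀ => ?_, fun f hf hc => (h₁.2 f hf hc).isWeaklyDifferentiable⟩,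
    tangentLift n ι u Dv, h₁, ⟨h₁.1, fun f hf hc => (h₂.2 f hf hc).isWeaklyDifferentiable⟩,
    tangentLift₂ n ι u H, h₂, ?_⟩
  · obtain ⟨ψ, w₁, w₂, hx, hψ⟩ := h x₀
    exact ⟨ψ, hψ.mem_maximalAtlas, hx, fun O hO => hψ.nullMeasurableSet_preimage hι hO⟩
  · refine lt_of_le_of_lt (lintegral_mono fun x => ?_) hint
    exact ENNReal.rpow_le_rpow (ENNReal.ofReal_le_ofReal (tensorNorm_tangentLift₂_le hι x)) hp

end Inclusion

end ColocalSobolev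

end

theorem proposition4p5 {m n ν : ℕ}
    {M : Type*} [TopologicalSpace M] [T2Space M] [SecondCountableTopology M]
    [ChartedSpace (EuclideanSpace ℝ (Fin m)) M] [IsManifold (𝓡 m) 2 M]
    [MeasurableSpace M] [BorelSpace M]
    {N : Type*} [TopologicalSpace N] [T2Space N] [SecondCountableTopology N]
    [ChartedSpace (EuclideanSpace ℝ (Fin n)) N] [IsManifold (𝓡 n) 2 N]
    (gM : ColocalSobolev.Metric m M) (gN : ColocalSobolev.Metric n N)
    (ι : N → EuclideanSpace ℝ (Fin ν)) (hι : ColocalSobolev.IsIsometricEmbedding gN ι)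
    (p : ℝ) (hp : 1 ≤ p) :
    ColocalSobolev.embeddedSobolev gM ι p ⊆ ColocalSobolev.intrinsicSobolev gM gN p :=
  ColocalSobolev.embeddedSobolev_subset_intrinsicSobolev gM hι (zero_le_one.trans hp)
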